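/- Let $n\ge 0$, $G=SL_{n+1}(\mathbb C)$, $I=\{1,\dots,n\}$, $T\subset G$ the diagonal torus, $U$, $U^-$ the groups of upper, lower unitriangular matrices, $B=TU$, $x_i(t)=1+tE_{i,i+1}$, $y_i(t)=1+tE_{i+1,i}$, and $\alpha_i^\vee(c)=\mathrm{diag}(1,\dots,c,c^{-1},\dots,1)$ with $c$, $c^{-1}$ in positions $i,i+1$. Let $x\in U$ act rationally on $U^-$ by $x(u)=v$ if $xu=vb$ with $v\in U^-$, $b\in B$. For $u\in U^-$ let $\varphi_i(u)$ be the $(i+1,i)$ entry of $u$, and let $f_i(u)$ be the coefficient of the lowest weight vector $u_{n-i+2}\wedge\dots\wedge u_{n+1}$ in $u\cdot(u_1\wedge\dots\wedge u_i)$ in $\bigwedge^i\mathbb C^{n+1}$, with $(u_j)$ the standard basis. Let $\chi_{U^-}=(U^-,\gamma,\{e_i\}_{i\in I})$ with $$\gamma(u)=\prod_{i\in I}\alpha_i^\vee(f_i(u)^{-1}),\qquad e_i^c(u)=x_i\Big(\frac{c-1}{\varphi_i(u)}\Big)(u)\quad(c\in\mathbb C^\times).$$ Let $T_0=(\mathbb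 C^\times)^{n(n+1)/2}$ with coordinates indexed by $1\le k\le j\le n$, and let $\hat\theta=\theta\circ\xi^{-1}:T_0\to U^-$, where $\theta(a)=\prod_{k=1}^{n}\big(y_n(a_{k,n})y_{n-1}(a_{k,n-1})\cdots y_k(a_{k,k})\big)$ (product in the order $k=1,\dots,n$ from left to right), and $\xi:T_0\to T_0$, $a\mapsto A$, and its inverse are given by $$A_{k,j}=\frac{a_{k,j}a_{k-1,j-1}\cdots a_{1,j-k+1}}{a_{k-1,j}a_{k-2,j-1}\cdots a_{1,j-k+2}},\qquad a_{k,j}=\frac{A_{k,j}A_{k-1,j}\cdots A_{1,j}}{A_{k-1,j-1}A_{k-2,j-1}\cdots A_{1,j-1}}.$$ A geometric crystal $(X,\gamma,\{e_i\})$ consists of rational morphisms $\gamma:X\to T$, $e_i:\mathbb C^\times\times X\to X$ with $e_i^1=\mathrm{id}$, $\gamma(e_i^c(x))=\alpha_i^\vee(c)\gamma(x)$, such that for a reduced word $\mathbf i=(i_1,\dots,i_l)$ the rational morphism $(t,x)\mapsto e_{i_1}^{\alpha^{(1)}(t)}\cdots e_{i_l}^{\alpha^{(l)}(t)}(x)$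 on $T\times X$, $\alpha^{(k)}=s_{i_l}\cdots s_{i_{k+1}}(\alpha_{i_k})$, depends only on the Weyl group element $s_{i_1}\cdots s_{i_l}$. A rational morphism $f:(\mathbb C^\times)^m\to(\mathbb C^\times)^{m'}$ is positive if for every co-character $\xi_l(c)=(c^{l_1},\dots,c^{l_m})$, $l\in\mathbb Z^m$, each component $f_j$ is defined at $\xi_l(c)$ for general $c$ and $f_j(\xi_l(c))\in\mathbb C(c)$ is a quotient of nonzero polynomials with nonnegative real coefficients; then $\mathcal{UD}(f):\mathbb Z^m\to\mathbb Z^{m'}$, $l\mapsto(\deg f_j(\xi_l(c)))_j$. A positive structure on a geometric crystal is a birational isomorphism $\theta'$ from a torus $T'$ to $X$ such that $\gamma\circ\theta'$ (with $T\cong(\mathbb C^\times)^n$ by $\prod_i\alpha_i^\vee(c_i)\leftrightarrow(c_i)$) and all $e_{i,\theta'}(c,a)=\theta'^{-1}(e_i^c(\theta'(a)))$ are positive. Then $\mathcal{UD}_{\theta',T'}(\chi)=(X_*(T'),\mathcal{UD}(\gamma\circ\theta'),\{\mathcal{UD}(e_{i,\theta'})\})$, where $X_*(T)=\bigoplus\mathbb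 Z\alpha_i^\vee$ is identified with the root lattice by $\alpha_i^\vee\mapsto\alpha_i$. If it is isomorphic to a free crystal $C$ (a crystal whose operators $\tilde e_i$ are bijective with inverse $\tilde f_i$), i.e. there is a bijection carrying $wt$ and all $\tilde e_i^\beta$, $\beta\in\mathbb Z$, of the one to those of the other, then $\chi$ is called a tropicalization of $C$. Let $B^\sharp=\{v=(B_{k,j})_{1\le k<j\le n+1}: B_{k,j}\in\mathbb Z\}$. For $i\in I$ and $1\le k\le i$ put $$b_k^{(i)}=\sum_{l=1}^{k}B_{l,i+1}-\sum_{l=1}^{k-1}B_{l,i},\quad \varepsilon_i=\max_{1\le k\le i}b^{(i)}_k,\quad wt(v)=-\sum_{i=1}^n\Big(\sum_{k\le i<j}B_{k,j}\Big)\alpha_i,\quad\varphi_i=\langle h_i,wt\rangle+\varepsilon_i.$$ Let $\tilde e_i$ add $1$ to $B_{m,i}$ (if $m<i$) and subtract $1$ from $B_{m,i+1}$, where $m$ is the least $k\le i$ with $b_k^{(i)}=\varepsilon_i$, and let $\tilde f_i$ subtract $1$ from $B_{M,i}$ (if $M<i$) and add $1$ to $B_{M,i+1}$, where $M$ is the greatest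 such $k$. Theorem. (a) $\chi_{U^-}$ is a geometric crystal, the two displayed maps $\xi$, $\xi^{-1}$ are mutually inverse, and $\hat\theta$ is a positive structure on $\chi_{U^-}$. (b) $B^\sharp$ is a free crystal; for all $\beta\in\mathbb Z$, $\tilde e_i^\beta$ (which is $\tilde f_i^{-\beta}$ for $\beta<0$) adds $\beta_k^{(i)}$ to $B_{k,i}$ ($1\le k<i$), subtracts $\beta^{(i)}_k$ from $B_{k,i+1}$ ($1\le k\le i$), and fixes the other entries, where (with $\max\emptyset=-\infty$) $$\beta_k^{(i)}=\max\big(\beta+\max_{1\le j\le k}b_j^{(i)},\max_{k<j\le i}b_j^{(i)}\big)-\max\big(\beta+\max_{1\le j<k}b_j^{(i)},\max_{k\le j\le i}b_j^{(i)}\big).$$ (c) Under the identification $X_*(T_0)\cong B^\sharp$ in which the coordinate $(k,j)$ corresponds to $B_{k,j+1}$, $$\mathcal{UD}_{\hat\theta,T_0}(\chi_{U^-})=(B^\sharp,wt,\{\tilde e_i\}_{i\in I}),$$ that is, $\mathcal{UD}(\gamma\circ\hat\theta)=wt$ and $\mathcal{UD}(e_{i,\hat\theta})(\beta,\cdot)=\tilde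 e_i^\beta$ for all $i\in I$, $\beta\in\mathbb Z$. In particular $\chi_{U^-}$ is a tropicalization of $B^\sharp$. -/

import Mathlib

noncomputable section

namespace GeomCrys

/-! ## Rational morphisms

Varieties are given by their complex points together with coordinate functions that embed them into
an affine space.  A rational morphism is represented by a partial function that is given by
quotients of polynomials in the coordinates on a nonempty Zariski open set.  All varieties below
(tori, the group of lower unitriangular matrices, products of such) are irreducible, so that
nonempty open sets are dense, and identities between rational morphisms are identities on a
nonempty open set. -/

/-- `X` is a set of points of an affine space with coordinates indexed by `ι`. -/
class AffCoords (X : Type) (ι : outParam Type) where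
  coord : X → ι → ℂ

open AffCoords

instance instCoordsGm : AffCoords ℂˣ Unit := ⟨fun c _ => (c : ℂ)⟩

/-- The algebraic torus `(ℂˣ)^σ`. -/
instance instCoordsTorus (σ : Type) : AffCoords (σ → ℂˣ) σ := ⟨fun t s => (t s : ℂ)⟩

instance instCoordsProd (X Y ι κ : Type) [AffCoords X ι] [AffCoords Y κ] :
    AffCoords (X × Y) (ι ⊕ κ) := ⟨fun z => Sum.elim (coord z.1) (coord z.2)⟩

/-- The value of a polynomial at a point of `X`. -/
def evalAt {X ι : Type} [AffCoords X ι] (x : X) (p : MvPolynomial ι ℂ) : ℂ :=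
  MvPolynomial.eval (coord x) p

/-- `P` holds at all points of some nonempty Zariski open (principal) subset of `X`. -/
def Generically {X ι : Type} [AffCoords X ι] (P : X → Prop) : Prop :=
  ∃ q : MvPolynomial ι ℂ, (∃ x : X, evalAt x q ≠ 0) ∧ ∀ x : X, evalAt x q ≠ 0 → P x

/-- The partial function `f` represents a rational morphism from `X` to `Y`. -/
def IsRational {X Y ι κ : Type} [AffCoords X ι] [AffCoords Y κ] (f : X →. Y) : Prop :=
  ∃ (q : MvPolynomial ι ℂ) (p : κ → MvPolynomial ι ℂ), (∃ x : X, evalAt x q ≠ 0) ∧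
    ∀ x : X, evalAt x q ≠ 0 → ∃ y ∈ f x, ∀ j : κ, coord y j = evalAt x (p j) / evalAt x q

/-- The inverse partial function: a point of the fibre, where the fibre is nonempty. -/
def pinv {X Y : Type} (f : X →. Y) : Y →. X := fun y => ⟨∃ x, y ∈ f x, fun h => h.choose⟩

/-- `f` is a birational isomorphism. -/
def IsBirational {X Y ι κ : Type} [AffCoords X ι] [AffCoords Y κ] (f : X →. Y) : Prop :=
  IsRational f ∧ IsRational (pinv f) ∧
    Generically (fun x : X => ∃ y ∈ f x, x ∈ pinv f y) ∧
    Generically (fun y : Y => ∃ x ∈ pinv f y, y ∈ f x)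

/-! ## Positive rational morphisms of tori and ultra-discretization

The lattice of co-characters of `(ℂˣ)^σ` is `σ → ℤ`, where `l` stands for
`c ↦ (c ^ l s)` for `s` in `σ`. -/

/-- Substitution of the co-character `l` into a polynomial function on the torus `(ℂˣ)^σ`. -/
def cocharEval {σ : Type} (l : σ → ℤ) : MvPolynomial σ ℂ →ₐ[ℂ] RatFunc ℂ :=
  MvPolynomial.aeval fun s => (RatFunc.X : RatFunc ℂ) ^ l s

/-- `r` is the rational function `f_j(ξ(c))` of `c`, where `f_j` is the `j`-th component of the
rational morphism `f` and `ξ` is the co-character `l`; it exists if the rational function `f_j`,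
written as a suitable quotient of polynomials, is defined at the general point of the image
of `ξ`. -/
def RestrictsTo {σ τ : Type} (f : (σ → ℂˣ) →. (τ → ℂˣ)) (l : σ → ℤ) (j : τ) (r : RatFunc ℂ) :
    Prop :=
  ∃ p q : MvPolynomial σ ℂ, cocharEval l q ≠ 0 ∧
    Generically (fun t : σ → ℂˣ => ∃ s ∈ f t, ((s j : ℂˣ) : ℂ) * evalAt t q = evalAt t p) ∧
    r = cocharEval l p / cocharEval l q

/-- A positive rational function of one variable: a quotient of two nonzero polynomials with
nonnegative real coefficients. -/
def IsPositiveRat (r : RatFunc ℂ) : Prop :=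
  ∃ P Q : Polynomial ℝ, P ≠ 0 ∧ Q ≠ 0 ∧ (∀ k, 0 ≤ P.coeff k) ∧ (∀ k, 0 ≤ Q.coeff k) ∧
    r = algebraMap (Polynomial ℂ) (RatFunc ℂ) (P.map (algebraMap ℝ ℂ)) /
      algebraMap (Polynomial ℂ) (RatFunc ℂ) (Q.map (algebraMap ℝ ℂ))

/-- Positive rational morphisms of tori. -/
def IsPositiveMor {σ τ : Type} (f : (σ → ℂˣ) →. (τ → ℂˣ)) : Prop :=
  IsRational f ∧ ∀ (l : σ → ℤ) (j : τ), ∃ r, RestrictsTo f l j r ∧ IsPositiveRat r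

open Classical in
/-- The ultra-discretization of a (positive) rational morphism of tori: the map
`l ↦ (deg f_j(ξ(c)))_j` between the co-character lattices, where `deg` of a quotient of
polynomials is the difference of the degrees. -/
def ultraDisc {σ τ : Type} (f : (σ → ℂˣ) →. (τ → ℂˣ)) (l : σ → ℤ) (j : τ) : ℤ :=
  if h : ∃ r, RestrictsTo f l j r then h.choose.intDegree else 0

/-! ## Root data of type `A_n`

Indices are 0-based: `I = Fin n`.  The weight lattice `P` is `Fin n → ℤ` in the basis of
fundamental weights, so that `⟨h_i, λ⟩ = λ i`. -/

/-- The simple root `α_j` as an element of the weight lattice. -/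
def simpleRoot (n : ℕ) (j : Fin n) : Fin n → ℤ := fun i => CartanMatrix.A n i j

/-- The group `G = SL_{n+1}(ℂ)`. -/
abbrev G (n : ℕ) : Type := Matrix.SpecialLinearGroup (Fin (n + 1)) ℂ

/-- `x_i(t) = exp (t e_i)`, where `e_i = E_{i,i+1}`. -/
def xGen {n : ℕ} (i : Fin n) (t : ℂ) : G n :=
  ⟨Matrix.transvection i.castSucc i.succ t,
    Matrix.det_transvection_of_ne _ _ Fin.castSucc_lt_succ.ne t⟩

/-- `y_i(t) = exp (t f_i)`, where `f_i = E_{i+1,i}`. -/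
def yGen {n : ℕ} (i : Fin n) (t : ℂ) : G n :=
  ⟨Matrix.transvection i.succ i.castSucc t,
    Matrix.det_transvection_of_ne _ _ Fin.castSucc_lt_succ.ne' t⟩

/-- The maximal torus `T` of diagonal matrices of determinant one, given by the diagonals. -/
def T (n : ℕ) : Subgroup (Fin (n + 1) → ℂˣ) where
  carrier := {t | ∏ k, t k = 1}
  one_mem' := by simp
  mul_mem' := by
    intro a b ha hb
    simp only [Set.mem_ofPred_eq] at ha hb ⊢
    simp [Finset.prod_mul_distrib, ha, hb]
  inv_mem' := by
    intro a ha
    simp only [Set.mem_ofPred_eq] at ha ⊢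
    simp [ha]

instance instCoordsT (n : ℕ) : AffCoords (T n) (Fin (n + 1)) := ⟨fun t k => (t.1 k : ℂ)⟩

/-- The simple co-root `α_i^∨(c) = diag(1, …, c, c⁻¹, …, 1)`. -/
def coroot {n : ℕ} (i : Fin n) (c : ℂˣ) : T n :=
  ⟨Pi.mulSingle i.castSucc c * Pi.mulSingle i.succ c⁻¹, by
    change ∏ k, (Pi.mulSingle i.castSucc c * Pi.mulSingle i.succ c⁻¹ : Fin (n + 1) → ℂˣ) k = 1
    simp [Finset.prod_mul_distrib]⟩

/-- The isomorphism `T → (ℂˣ)^n` given by the fundamental characters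
`Λ_i(t) = t_1 ⋯ t_i`; its inverse is `(c_i) ↦ ∏ α_i^∨(c_i)`. -/
def fundCoords {n : ℕ} (t : T n) : Fin n → ℂˣ :=
  fun i => ∏ k ∈ Finset.Iic i.castSucc, t.1 k

/-- The value at `t` of the character `∑ m_j α_j` of `T`, where `α_j(t) = t_j / t_{j+1}`. -/
def rootChar {n : ℕ} (m : Fin n → ℤ) (t : T n) : ℂˣ :=
  ∏ j : Fin n, (t.1 j.castSucc / t.1 j.succ) ^ m j

/-- The simple reflection `s_i(λ) = λ - ⟨h_i, λ⟩ α_i` on the root lattice, where `m` is the family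
of the coefficients of `λ` in the basis of simple roots. -/
def rootReflection {n : ℕ} (i : Fin n) (m : Fin n → ℤ) : Fin n → ℤ :=
  m - Pi.single i (∑ j, CartanMatrix.A n i j * m j)

/-- `s_{i_1} ⋯ s_{i_l}` in the Weyl group, which is the symmetric group. -/
def wordProd {n : ℕ} (w : List (Fin n)) : Equiv.Perm (Fin (n + 1)) :=
  (w.map fun i => Equiv.swap i.castSucc i.succ).prod

/-- A word is reduced if its length is the length of the Weyl group element it represents. -/
def IsReducedWord {n : ℕ} (w : List (Fin n)) : Prop :=
  ∀ w' : List (Fin n), wordProd w' = wordProd w → w.length ≤ w'.length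

/-! ## Geometric crystals for `SL_{n+1}` -/

/-- The data of a geometric crystal on `X`; `e i (c, x)` is `e_i^c(x)`. -/
structure GeomCrystalData (n : ℕ) (X : Type) where
  γ : X →. T n
  e : Fin n → (ℂˣ × X →. X)

/-- `e_𝐢^t(x) = e_{i_1}^{α^{(1)}(t)} ⋯ e_{i_l}^{α^{(l)}(t)}(x)` for a word
`𝐢 = (i_1, …, i_l)`, where `α^{(k)} = s_{i_l} ⋯ s_{i_{k+1}}(α_{i_k})`. -/
def GeomCrystalData.eWord {n : ℕ} {X : Type} (χ : GeomCrystalData n X) :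
    List (Fin n) → (T n × X →. X)
  | [] => fun z => Part.some z.2
  | i :: w => fun z => (χ.eWord w z).bind fun y =>
      χ.e i (rootChar (w.foldl (fun m j => rootReflection j m) (Pi.single i 1)) z.1, y)

/-- The axioms of a geometric crystal. -/
structure IsGeometricCrystal {n : ℕ} {X ι : Type} [AffCoords X ι] (χ : GeomCrystalData n X) :
    Prop where
  rational_γ : IsRational χ.γ
  rational_e : ∀ i, IsRational (χ.e i)
  e_one : ∀ i, Generically fun x : X => x ∈ χ.e i (1, x)
  γ_e : ∀ i, Generically fun z : ℂˣ × X =>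
    ∃ y ∈ χ.e i z, ∃ t ∈ χ.γ z.2, coroot i z.1 * t ∈ χ.γ y
  e_word : ∀ w w' : List (Fin n), IsReducedWord w → IsReducedWord w' → wordProd w = wordProd w' →
    Generically fun z : T n × X => ∃ y, y ∈ χ.eWord w z ∧ y ∈ χ.eWord w' z

/-- `γ ∘ θ : T' → T ≅ (ℂˣ)^n`. -/
def GeomCrystalData.γPull {n : ℕ} {X σ : Type} (χ : GeomCrystalData n X) (θ : (σ → ℂˣ) →. X) :
    (σ → ℂˣ) →. (Fin n → ℂˣ) :=
  fun a => (θ a).bind fun x => (χ.γ x).map fundCoords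

/-- `e_{i,θ}(c, a) = θ⁻¹(e_i^c(θ(a)))` as a partial map of tori `ℂˣ × (ℂˣ)^σ → (ℂˣ)^σ`; the
coordinate `none` is `c`. -/
def GeomCrystalData.ePull {n : ℕ} {X σ : Type} (χ : GeomCrystalData n X) (θ : (σ → ℂˣ) →. X)
    (i : Fin n) : (Option σ → ℂˣ) →. (σ → ℂˣ) :=
  fun a => (θ fun s => a (some s)).bind fun x => (χ.e i (a none, x)).bind fun y => pinv θ y

/-- `θ : (ℂˣ)^σ → X` is a positive structure on `χ`. -/
structure IsPositiveStructure {n : ℕ} {X σ ι : Type} [AffCoords X ι] (χ : GeomCrystalData n X)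
    (θ : (σ → ℂˣ) →. X) : Prop where
  birational : IsBirational θ
  positive_γ : IsPositiveMor (χ.γPull θ)
  positive_e : ∀ i, IsPositiveMor (χ.ePull θ i)

/-! ## Crystals -/

/-- The data of a crystal: `none` plays the role of `0`, and `⊥` that of `-∞`. -/
structure CrystalData (n : ℕ) (B : Type) where
  wt : B → (Fin n → ℤ)
  ε : Fin n → B → WithBot ℤ
  φ : Fin n → B → WithBot ℤ
  e : Fin n → B → Option B
  f : Fin n → B → Option B

/-- The axioms of a crystal. -/
structure IsCrystal {n : ℕ} {B : Type} (C : CrystalData n B) : Prop where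
  φ_eq : ∀ i b, C.φ i b = C.ε i b + ((C.wt b i : ℤ) : WithBot ℤ)
  wt_e : ∀ i b b', C.e i b = some b' → C.wt b' = C.wt b + simpleRoot n i
  wt_f : ∀ i b b', C.f i b = some b' → C.wt b' = C.wt b - simpleRoot n i
  e_iff_f : ∀ i b₁ b₂, C.e i b₂ = some b₁ ↔ C.f i b₁ = some b₂
  of_bot : ∀ i b, C.ε i b = ⊥ → C.e i b = none ∧ C.f i b = none

/-- A free crystal: each `ẽ_i` is a bijection of `B`, with inverse `f̃_i`. -/
def IsFreeCrystal {n : ℕ} {B : Type} (C : CrystalData n B) : Prop :=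
  IsCrystal C ∧ ∀ i, ∃ g : Equiv.Perm B,
    (∀ b, C.e i b = some (g b)) ∧ (∀ b, C.f i b = some (g.symm b))

/-- A triplet `(B, wt, {ẽ_i})` as it describes a free crystal; `e i β` is `ẽ_i^β` for an integer
`β`. -/
structure FreeTriplet (n : ℕ) (B : Type) where
  wt : B → (Fin n → ℤ)
  e : Fin n → ℤ → B → B

/-- The triplet of a free crystal: `ẽ_i^β` is the `β`-th iterate of `ẽ_i` for `β ≥ 0`, and the
`(-β)`-th iterate of `f̃_i = ẽ_i⁻¹` for `β < 0`.  (The value at `none` never occurs in a free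
crystal.) -/
def CrystalData.triplet {n : ℕ} {B : Type} (C : CrystalData n B) : FreeTriplet n B where
  wt := C.wt
  e i
    | Int.ofNat m => (fun b => (C.e i b).getD b)^[m]
    | Int.negSucc m => (fun b => (C.f i b).getD b)^[m + 1]

/-- The bijection `h` identifies the two triplets. -/
def FreeTriplet.IdentifiedBy {n : ℕ} {B B' : Type} (F : FreeTriplet n B) (F' : FreeTriplet n B')
    (h : B ≃ B') : Prop :=
  (∀ b, F'.wt (h b) = F.wt b) ∧ ∀ i β b, F'.e i β (h b) = h (F.e i β b)

/-- The ultra-discretization of a geometric crystal with respect to `θ`: the triplet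
`(X_*(T'), γ̃, {ẽ_i})`.  Here `γ̃` has values in `X_*(T) = ⨁ ℤ α_i^∨`, which is identified with
the root lattice by `α_i^∨ ↦ α_i`. -/
def ultraDiscCrystal {n : ℕ} {X σ : Type} (χ : GeomCrystalData n X) (θ : (σ → ℂˣ) →. X) :
    FreeTriplet n (σ → ℤ) where
  wt l := ∑ i, ultraDisc (χ.γPull θ) l i • simpleRoot n i
  e i β l := ultraDisc (χ.ePull θ i) fun o => o.elim β l

/-- `χ` is a tropicalization of the free crystal `C`. -/
def IsTropicalization {n : ℕ} {X B ι : Type} [AffCoords X ι] (χ : GeomCrystalData n X)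
    (C : CrystalData n B) : Prop :=
  IsGeometricCrystal χ ∧ IsFreeCrystal C ∧
    ∃ (σ : Type) (_ : Finite σ) (θ : (σ → ℂˣ) →. X), IsPositiveStructure χ θ ∧
      ∃ h : (σ → ℤ) ≃ B, (ultraDiscCrystal χ θ).IdentifiedBy C.triplet h

/-! ## The geometric crystal on `U⁻` -/

/-- The group `U⁻` of lower triangular matrices with unit diagonal. -/
def UMinus (n : ℕ) : Subgroup (G n) where
  carrier := {g | ∀ j k, j ≤ k → g.1 j k = (1 : Matrix (Fin (n + 1)) (Fin (n + 1)) ℂ) j k}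
  one_mem' := by
    intro j k _
    rfl
  mul_mem' := by
    intro g h hg hh j k hjk
    change (g.1 * h.1) j k = _
    rw [Matrix.mul_apply, Finset.sum_eq_single j]
    · rw [hg j j le_rfl, hh j k hjk]
      simp
    · intro l _ hl
      rcases lt_or_gt_of_ne hl with h1 | h1
      · rw [hh l k (h1.le.trans hjk), Matrix.one_apply_ne (h1.trans_le hjk).ne, mul_zero]
      · rw [hg j l h1.le, Matrix.one_apply_ne h1.ne, zero_mul]
    · simp
  inv_mem' := by
    intro g hg j
    induction j using WellFoundedLT.induction with
    | ind j ih =>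
      intro k hjk
      have h1 : (g.1 * (g⁻¹).1) j k = (1 : Matrix (Fin (n + 1)) (Fin (n + 1)) ℂ) j k := by
        have h2 : (g * g⁻¹).1 = g.1 * (g⁻¹).1 := rfl
        rw [← h2, mul_inv_cancel]
        rfl
      rw [Matrix.mul_apply, Finset.sum_eq_single j] at h1
      · rw [hg j j le_rfl] at h1
        simpa using h1
      · intro l _ hl
        rcases lt_or_gt_of_ne hl with h2 | h2
        · rw [ih l h2 k (h2.le.trans hjk), Matrix.one_apply_ne (h2.trans_le hjk).ne, mul_zero]
        · rw [hg j l h2.le, Matrix.one_apply_ne h2.ne, zero_mul]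
      · simp

/-- The coordinates of a point of `U⁻` are its matrix entries. -/
instance instCoordsUMinus (n : ℕ) : AffCoords (UMinus n) (Fin (n + 1) × Fin (n + 1)) :=
  ⟨fun u p => u.1.1 p.1 p.2⟩

lemma yGen_mem {n : ℕ} (i : Fin n) (t : ℂ) : yGen i t ∈ UMinus n := by
  intro j k hjk
  change Matrix.transvection i.succ i.castSucc t j k = _
  have h : ¬ (i.succ = j ∧ i.castSucc = k) := by
    rintro ⟨rfl, rfl⟩
    exact absurd hjk (not_le.mpr Fin.castSucc_lt_succ)
  simp [Matrix.transvection, h]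

/-- `y_i(t)` as an element of `U⁻`. -/
def yMinus {n : ℕ} (i : Fin n) (t : ℂ) : UMinus n := ⟨yGen i t, yGen_mem i t⟩

/-- The projection `π⁻⁻ : G → U⁻`, `π⁻⁻(v b) = v` for `v` in `U⁻` and `b` in the Borel subgroup `B`
of upper triangular matrices. -/
def piMM {n : ℕ} : G n →. UMinus n := fun g =>
  ⟨∃ v : UMinus n, ∃ b : G n, (∀ j k, k < j → b.1 j k = 0) ∧ g = v.1 * b, fun h => h.choose⟩

/-- The rational action of `x` in `U` on `U⁻`: `u ↦ π⁻⁻(x u)`. -/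
def actU {n : ℕ} (x : G n) : UMinus n →. UMinus n := fun u => piMM (x * u.1)

/-- The function `φ_i = y_i⁻¹ ∘ ξ_i` on `U⁻`, where `ξ_i` is the canonical projection of `U⁻` to
its root subgroup for `-α_i`: the entry at `(i+1, i)`. -/
def phi {n : ℕ} (i : Fin n) (u : UMinus n) : ℂ := u.1.1 i.succ i.castSucc

/-- The matrix coefficient `f_i(g) = ⟨g u_{Λ_i}, v*_{Λ_i}⟩` of the fundamental representation
`⋀^i ℂ^{n+1}` (with 1-based `i`), for the highest weight vector `u_1 ∧ ⋯ ∧ u_i` and the functional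
dual to the lowest weight vector `u_{n-i+2} ∧ ⋯ ∧ u_{n+1}`. -/
def fCoeff {n : ℕ} (i : Fin n) (g : G n) : ℂ :=
  exteriorPower.pairingDual ℂ (Fin (n + 1) → ℂ) (i + 1)
    (exteriorPower.ιMulti ℂ (i + 1) fun r : Fin (i + 1) =>
      (LinearMap.proj (⟨n - i + r, by omega⟩ : Fin (n + 1)) :
        (Fin (n + 1) → ℂ) →ₗ[ℂ] ℂ))
    (exteriorPower.map (i + 1) (Matrix.mulVecLin g.1)
      (exteriorPower.ιMulti ℂ (i + 1) fun r : Fin (i + 1) =>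
        (Pi.single (⟨r, by omega⟩ : Fin (n + 1)) 1 : Fin (n + 1) → ℂ)))

/-- The geometric crystal `χ_{U⁻} = (U⁻, γ, {e_i})` with
`γ(u) = ∏ α_i^∨(f_i(u)⁻¹)` and `e_i^c(u) = x_i((c - 1) / φ_i(u))(u)`. -/
def chiUMinus (n : ℕ) : GeomCrystalData n (UMinus n) where
  γ u := ⟨∀ i : Fin n, fCoeff i u.1 ≠ 0,
    fun h => ∏ i : Fin n, coroot i (Units.mk0 (fCoeff i u.1) (h i))⁻¹⟩
  e i z := Part.assert (phi i z.2 ≠ 0) fun _ =>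
    actU (xGen i (((z.1 : ℂ) - 1) / phi i z.2)) z.2

/-! ## The positive structure `θ̂` -/

/-- The indices `(k, j)` with `k ≤ j` of the coordinates of `T_0 = (ℂˣ)^{n(n+1)/2}`. -/
abbrev TriIdx (n : ℕ) : Type := {p : Fin n × Fin n // p.1 ≤ p.2}

/-- `Y(a)`, the product over the rows `k` (increasing, from left to right) of
`y_n(a_{k,n}) ⋯ y_k(a_{k,k})`. -/
def theta {n : ℕ} (a : TriIdx n → ℂˣ) : UMinus n :=
  ((List.finRange n).map fun k =>
    ((List.finRange n).reverse.map fun j =>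
      if h : k ≤ j then yMinus j (a ⟨(k, j), h⟩ : ℂ) else 1).prod).prod

/-- The entry `A_{k,j}`, and `1` if there is no such entry. -/
def entry {n : ℕ} (A : TriIdx n → ℂˣ) (k j : ℕ) : ℂˣ :=
  if h : k ≤ j ∧ j < n then A ⟨(⟨k, h.1.trans_lt h.2⟩, ⟨j, h.2⟩), h.1⟩ else 1

/-- The map `ξ : T_0 → T_0`,
`A_{i,j} = (a_{i,j} a_{i-1,j-1} ⋯ ) / (a_{i-1,j} a_{i-2,j-1} ⋯ )`. -/
def xi {n : ℕ} (a : TriIdx n → ℂˣ) : TriIdx n → ℂˣ := fun p =>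
  (∏ l ∈ Finset.range (p.1.1 + 1), entry a (p.1.1 - l) (p.1.2 - l)) /
    ∏ l ∈ Finset.range p.1.1, entry a (p.1.1 - (l + 1)) (p.1.2 - l)

/-- The inverse of `ξ`: `a_{i,j} = (A_{i,j} ⋯ A_{1,j}) / (A_{i-1,j-1} ⋯ A_{1,j-1})`. -/
def xiInv {n : ℕ} (A : TriIdx n → ℂˣ) : TriIdx n → ℂˣ := fun p =>
  (∏ l ∈ Finset.range (p.1.1 + 1), entry A l p.1.2) /
    ∏ l ∈ Finset.range p.1.1, entry A l (p.1.2 - 1)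

/-- `θ̂ = θ ∘ ξ⁻¹`. -/
def thetaHat (n : ℕ) : (TriIdx n → ℂˣ) →. UMinus n := fun A => Part.some (theta (xiInv A))

/-! ## The free crystal `B^♯` of generalized Young tableaux -/

/-- The indices `(k, j)` with `k < j`. -/
abbrev SharpIdx (n : ℕ) : Type := {p : Fin (n + 1) × Fin (n + 1) // p.1 < p.2}

/-- The lattice `B^♯` of all integer families `(B_{k,j})_{k < j}`. -/
abbrev Bsharp (n : ℕ) : Type := SharpIdx n → ℤ

/-- The entry `B_{k,j}`, and `0` if there is no such entry. -/
def bEntry {n : ℕ} (v : Bsharp n) (k j : ℕ) : ℤ :=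
  if h : k < j ∧ j < n + 1 then v ⟨(⟨k, h.1.trans h.2⟩, ⟨j, h.2⟩), h.1⟩ else 0

/-- `b_k^{(i)}(v) = ∑_{l ≤ k} B_{l,i+1} - ∑_{l < k} B_{l,i}`. -/
def bSum {n : ℕ} (v : Bsharp n) (i k : ℕ) : ℤ :=
  ∑ l ∈ Finset.range (k + 1), bEntry v l (i + 1) - ∑ l ∈ Finset.range k, bEntry v l i

/-- `ε_i(v) = max_{k ≤ i} b_k^{(i)}(v)`. -/
def sharpEps {n : ℕ} (i : Fin n) (v : Bsharp n) : ℤ :=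
  (Finset.Iic i).sup' Finset.nonempty_Iic fun k => bSum v i k

/-- The set of all `k ≤ i` with `b_k^{(i)}(v) = ε_i(v)`. -/
def argmax {n : ℕ} (i : Fin n) (v : Bsharp n) : Finset (Fin n) :=
  (Finset.Iic i).filter fun k => bSum v i k = sharpEps i v

lemma argmax_nonempty {n : ℕ} (i : Fin n) (v : Bsharp n) : (argmax i v).Nonempty := by
  obtain ⟨k, hk, h⟩ := Finset.exists_mem_eq_sup' (s := Finset.Iic i) Finset.nonempty_Iic
    fun k => bSum v i k
  exact ⟨k, Finset.mem_filter.mpr ⟨hk, h.symm⟩⟩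

/-- `wt(v) = -∑_i (∑_{k ≤ i, j ≥ i+1} B_{k,j}) α_i`. -/
def sharpWt {n : ℕ} (v : Bsharp n) : Fin n → ℤ :=
  -∑ i : Fin n, (∑ p : SharpIdx n,
    if p.1.1 ≤ i.castSucc ∧ i.succ ≤ p.1.2 then v p else 0) • simpleRoot n i

/-- Add `d` to the entry `B_{m,i}` (if it exists) and subtract `d` from `B_{m,i+1}`. -/
def shiftRow {n : ℕ} (i m : Fin n) (d : ℤ) (v : Bsharp n) : Bsharp n := fun p =>
  if p.1 = (m.castSucc, i.castSucc) then v p + d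
  else if p.1 = (m.castSucc, i.succ) then v p - d
  else v p

/-- The crystal `B^♯`: `ẽ_i` raises `B_{m,i}` and lowers `B_{m,i+1}` by one for the smallest `m`
in `argmax i v`, and `f̃_i` does the opposite for the largest one. -/
def sharpCrystal (n : ℕ) : CrystalData n (Bsharp n) where
  wt := sharpWt
  ε i v := (sharpEps i v : ℤ)
  φ i v := ((sharpWt v i + sharpEps i v : ℤ) : WithBot ℤ)
  e i v := some (shiftRow i ((argmax i v).min' (argmax_nonempty i v)) 1 v)
  f i v := some (shiftRow i ((argmax i v).max' (argmax_nonempty i v)) (-1) v)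

/-- The maximum of `b_k^{(i)}(v)` over a finite set of `k`; it is `-∞` if the set is empty. -/
def bMax {n : ℕ} (v : Bsharp n) (i : ℕ) (S : Finset ℕ) : WithBot ℤ :=
  S.sup fun k => ((bSum v i k : ℤ) : WithBot ℤ)

/-- `β_k^{(i)} = max(β + max_{j ≤ k} b_j, max_{k < j ≤ i} b_j)
- max(β + max_{j < k} b_j, max_{k ≤ j ≤ i} b_j)` with `b_j = b_j^{(i)}(v)`, for `k ≤ i`. -/
def betaCoeff {n : ℕ} (i : Fin n) (β : ℤ) (v : Bsharp n) (k : ℕ) : ℤ :=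
  (max ((β : WithBot ℤ) + bMax v i (Finset.Iic k)) (bMax v i (Finset.Ioc k i))).unbotD 0 -
    (max ((β : WithBot ℤ) + bMax v i (Finset.Iio k)) (bMax v i (Finset.Icc k i))).unbotD 0

/-- The explicit action of `ẽ_i^β` on `B^♯`: it adds `β_k^{(i)}` to `B_{k,i}` and subtracts it from
`B_{k,i+1}`. -/
def sharpAct {n : ℕ} (i : Fin n) (β : ℤ) (v : Bsharp n) : Bsharp n := fun p =>
  if p.1.2 = i.castSucc then v p + betaCoeff i β v p.1.1
  else if p.1.2 = i.succ then v p - betaCoeff i β v p.1.1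
  else v p

/-- The bijection of indices `(k, j) ↦ (k, j + 1)`. -/
def idxEquiv (n : ℕ) : TriIdx n ≃ SharpIdx n where
  toFun p := ⟨(p.1.1.castSucc, p.1.2.succ), Fin.castSucc_lt_succ_iff.mpr p.2⟩
  invFun p := ⟨(⟨p.1.1, lt_of_lt_of_le p.2 (Nat.lt_succ_iff.mp p.1.2.2)⟩,
    ⟨p.1.2 - 1, by have := p.1.2.2; have : p.1.1.1 < p.1.2.1 := p.2; omega⟩), by
      have : p.1.1.1 < p.1.2.1 := p.2
      rw [Fin.mk_le_mk]
      omega⟩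
  left_inv p := by
    ext <;> simp
  right_inv p := by
    have : p.1.1.1 < p.1.2.1 := p.2
    ext
    · simp
    · simp only [Fin.val_succ]
      omega

/-- The identification of `X_*(T_0)` with `B^♯` for which the coordinate `A_{k,j}` corresponds to
the entry `B_{k,j+1}`. -/
def cocharEquiv (n : ℕ) : (TriIdx n → ℤ) ≃ Bsharp n :=
  (idxEquiv n).arrowCongr (Equiv.refl ℤ)

end GeomCrys

end

/-!
The key identity is that a matrix `x` supported on the diagonal and at the position `(i, i + 1)`
can be moved through a factor `y_j(a)`, at the price of rescaling `a` (`hMat_mul_y`).  Moved through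
all factors of `θ(a)`, the matrix `x_i(s)` with `s = (c - 1) / φ_i` picks up torus factors `d_k`
on its way past the rows; these are quotients of the sums `∑_l c^{[l < k]} a_{l,i}`, and in the
coordinates `A = ξ(a)` the result is that `e_i^c` multiplies two adjacent columns by quotients of
successive `d_k` (`hMat_mul_theta`, `entry_xiInv_scaleCols`, `chi_e_theta`).  These formulas are
subtraction-free; they tropicalize to the coefficients `β_k^{(i)}`, which are differences of
`max_j (b_j + [j < k] β)`.  Likewise the minors `f_i` are monomials in `A` (`fCoeff_theta`), which
tropicalize to the weight.

Genericity is handled by positivity.  A rational function that does not vanish on a set `S` can be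
inverted near `S`, so that all denominators which occur are harmless as soon as they are nonzero at
the totally positive points (`Near`, `RatOn`, `posU`); the subtraction-free functions on a torus,
which are moreover nonzero on every co-character, form a calculus with a degree (`HasTrop`).  The
inverse of `θ` is an elimination that peels off one row of parameters after the other
(`peel_theta`, `theta_eq_of_peel`).

That the operator attached to a word depends only on the Weyl group element `w` needs no braid
relations.  If `t` is in the torus, then the operator attached to the word takes `u` to an element
`y` of `U⁻` such that `y w(t)⁻¹` is conjugate to `u t⁻¹` under the group `U` (`ConjBy.eMinus`,
`eWord_spec`).  If the entries of `t` are distinct, then a lower triangular matrix with the diagonal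
`w(t)⁻¹` is determined by its `U`-orbit (`conj_lower_unique`), and so is `y`.

On the combinatorial side, the explicit formula for `ẽ_i^β` holds since it is additive in `β`: by
`tropSum_succ` an increase of `β` by one changes exactly the coefficient `β_m^{(i)}` for the least
maximum point `m` of the functions `b_k^{(i)}` after the action of `ẽ_i^β`.
-/

noncomputable section

namespace GeomCrys

open AffCoords
open scoped ComplexOrder

/-! ### Rational functions that are regular at prescribed points -/

section Regular

variable {X ι : Type} [AffCoords X ι]

/-- `P` holds on a principal open set that contains `S`. -/
def Near (S : Set X) (P : X → Prop) : Prop :=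
  ∃ q : MvPolynomial ι ℂ, (∀ x ∈ S, evalAt x q ≠ 0) ∧ ∀ x, evalAt x q ≠ 0 → P x

/-- `F` is a quotient of polynomials on a principal open set that contains `S`.  Outside of that
set the value of the total function `F` is irrelevant. -/
def RatOn (S : Set X) (F : X → ℂ) : Prop :=
  ∃ p q : MvPolynomial ι ℂ, (∀ x ∈ S, evalAt x q ≠ 0) ∧
    ∀ x, evalAt x q ≠ 0 → F x = evalAt x p / evalAt x q

lemma evalAt_mul (x : X) (p q : MvPolynomial ι ℂ) : evalAt x (p * q) = evalAt x p * evalAt x q :=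
  map_mul _ _ _

lemma evalAt_add (x : X) (p q : MvPolynomial ι ℂ) : evalAt x (p + q) = evalAt x p + evalAt x q :=
  map_add _ _ _

lemma evalAt_one (x : X) : evalAt x (1 : MvPolynomial ι ℂ) = 1 := map_one _

lemma evalAt_C (x : X) (c : ℂ) : evalAt x (MvPolynomial.C c : MvPolynomial ι ℂ) = c :=
  MvPolynomial.eval_C _

lemma evalAt_X (x : X) (i : ι) : evalAt x (MvPolynomial.X i : MvPolynomial ι ℂ) = coord x i :=
  MvPolynomial.eval_X _

lemma evalAt_prod {κ : Type*} (s : Finset κ) (x : X) (p : κ → MvPolynomial ι ℂ) :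
    evalAt x (∏ k ∈ s, p k) = ∏ k ∈ s, evalAt x (p k) :=
  map_prod (MvPolynomial.eval (coord x)) _ _

variable {S : Set X}

lemma Near.of_forall {P : X → Prop} (h : ∀ x, P x) : Near S P :=
  ⟨1, fun x _ => by simp [evalAt_one], fun x _ => h x⟩

lemma Near.mono {P Q : X → Prop} (hP : Near S P) (h : ∀ x, P x → Q x) : Near S Q := by
  obtain ⟨q, hq, hP⟩ := hP
  exact ⟨q, hq, fun x hx => h x (hP x hx)⟩

lemma Near.and {P Q : X → Prop} (hP : Near S P) (hQ : Near S Q) :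
    Near S fun x => P x ∧ Q x := by
  obtain ⟨p, hp, hP⟩ := hP
  obtain ⟨q, hq, hQ⟩ := hQ
  refine ⟨p * q, fun x hx => ?_, fun x hx => ?_⟩
  · rw [evalAt_mul]
    exact mul_ne_zero (hp x hx) (hq x hx)
  · rw [evalAt_mul] at hx
    exact ⟨hP x (left_ne_zero_of_mul hx), hQ x (right_ne_zero_of_mul hx)⟩

lemma Near.forall {κ : Type*} [Finite κ] {P : κ → X → Prop} (h : ∀ k, Near S (P k)) :
    Near S fun x => ∀ k, P k x := by
  cases nonempty_fintype κ
  choose q hq hP using h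
  refine ⟨∏ k, q k, fun x hx => ?_, fun x hx k => ?_⟩
  · rw [evalAt_prod]
    exact Finset.prod_ne_zero_iff.mpr fun k _ => hq k x hx
  · rw [evalAt_prod] at hx
    exact hP k x (Finset.prod_ne_zero_iff.mp hx k (Finset.mem_univ k))

lemma Near.generically {P : X → Prop} (h : Near S P) (hS : S.Nonempty) : Generically P := by
  obtain ⟨q, hq, hP⟩ := h
  obtain ⟨x, hx⟩ := hS
  exact ⟨q, ⟨x, hq x hx⟩, hP⟩

lemma RatOn.const (c : ℂ) : RatOn S fun _ => c :=
  ⟨MvPolynomial.C c, 1, fun x _ => by simp [evalAt_one], fun x _ => by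
    simp [evalAt_one, evalAt_C]⟩

lemma RatOn.coord (i : ι) : RatOn S fun x => coord x i :=
  ⟨MvPolynomial.X i, 1, fun x _ => by simp [evalAt_one], fun x _ => by
    simp [evalAt_one, evalAt_X]⟩

lemma RatOn.add {F G : X → ℂ} (hF : RatOn S F) (hG : RatOn S G) : RatOn S fun x => F x + G x := by
  obtain ⟨p, q, hq, hF⟩ := hF
  obtain ⟨p', q', hq', hG⟩ := hG
  refine ⟨p * q' + q * p', q * q', fun x hx => ?_, fun x hx => ?_⟩
  · rw [evalAt_mul]
    exact mul_ne_zero (hq x hx) (hq' x hx)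
  · rw [evalAt_mul] at hx
    have h1 := left_ne_zero_of_mul hx
    have h2 := right_ne_zero_of_mul hx
    beta_reduce
    rw [hF x h1, hG x h2, evalAt_mul, evalAt_add, evalAt_mul, evalAt_mul, div_add_div _ _ h1 h2]

lemma RatOn.mul {F G : X → ℂ} (hF : RatOn S F) (hG : RatOn S G) : RatOn S fun x => F x * G x := by
  obtain ⟨p, q, hq, hF⟩ := hF
  obtain ⟨p', q', hq', hG⟩ := hG
  refine ⟨p * p', q * q', fun x hx => ?_, fun x hx => ?_⟩
  · rw [evalAt_mul]
    exact mul_ne_zero (hq x hx) (hq' x hx)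
  · rw [evalAt_mul] at hx
    have h1 := left_ne_zero_of_mul hx
    have h2 := right_ne_zero_of_mul hx
    beta_reduce
    rw [hF x h1, hG x h2, evalAt_mul, evalAt_mul, div_mul_div_comm]

lemma RatOn.neg {F : X → ℂ} (hF : RatOn S F) : RatOn S fun x => -F x := by
  simpa using (RatOn.const (S := S) (-1)).mul hF

lemma RatOn.sub {F G : X → ℂ} (hF : RatOn S F) (hG : RatOn S G) : RatOn S fun x => F x - G x := by
  simpa [sub_eq_add_neg] using hF.add hG.neg

lemma RatOn.inv {F : X → ℂ} (hF : RatOn S F) (h0 : ∀ x ∈ S, F x ≠ 0) :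
    RatOn S fun x => (F x)⁻¹ := by
  obtain ⟨p, q, hq, hF⟩ := hF
  refine ⟨q * q, p * q, fun x hx => ?_, fun x hx => ?_⟩
  · have := h0 x hx
    rw [hF x (hq x hx)] at this
    rw [evalAt_mul]
    exact mul_ne_zero (div_ne_zero_iff.mp this).1 (hq x hx)
  · rw [evalAt_mul] at hx
    have h2 := right_ne_zero_of_mul hx
    beta_reduce
    rw [hF x h2, evalAt_mul, evalAt_mul, inv_div, mul_div_mul_right _ _ h2]

lemma RatOn.div {F G : X → ℂ} (hF : RatOn S F) (hG : RatOn S G) (h0 : ∀ x ∈ S, G x ≠ 0) :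
    RatOn S fun x => F x / G x := by
  simpa [div_eq_mul_inv] using hF.mul (hG.inv h0)

lemma RatOn.sum {κ : Type*} (s : Finset κ) {F : κ → X → ℂ} (h : ∀ k ∈ s, RatOn S (F k)) :
    RatOn S fun x => ∑ k ∈ s, F k x := by
  classical
  induction s using Finset.induction_on with
  | empty => simpa using RatOn.const (S := S) 0
  | insert a s ha ih =>
    simp only [Finset.sum_insert ha]
    exact (h a (by simp)).add (ih fun k hk => h k (by simp [hk]))

lemma RatOn.prod {κ : Type*} (s : Finset κ) {F : κ → X → ℂ} (h : ∀ k ∈ s, RatOn S (F k)) :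
    RatOn S fun x => ∏ k ∈ s, F k x := by
  classical
  induction s using Finset.induction_on with
  | empty => simpa using RatOn.const (S := S) 1
  | insert a s ha ih =>
    simp only [Finset.prod_insert ha]
    exact (h a (by simp)).mul (ih fun k hk => h k (by simp [hk]))

lemma RatOn.ne_zero {F : X → ℂ} (hF : RatOn S F) (h0 : ∀ x ∈ S, F x ≠ 0) :
    Near S fun x => F x ≠ 0 := by
  obtain ⟨p, q, hq, hF⟩ := hF
  refine ⟨p * q, fun x hx => ?_, fun x hx => ?_⟩
  · have := h0 x hx
    rw [hF x (hq x hx)] at this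
    rw [evalAt_mul]
    exact mul_ne_zero (div_ne_zero_iff.mp this).1 (hq x hx)
  · rw [evalAt_mul] at hx
    have h2 := right_ne_zero_of_mul hx
    rw [hF x h2]
    exact div_ne_zero (left_ne_zero_of_mul hx) h2

/-- Entries of products of matrices of rational functions are rational functions. -/
lemma RatOn.matrix_mul {l m o : Type*} [Fintype m] {M : X → Matrix l m ℂ} {N : X → Matrix m o ℂ}
    (hM : ∀ i j, RatOn S fun x => M x i j) (hN : ∀ i j, RatOn S fun x => N x i j) (i : l) (j : o) :
    RatOn S fun x => (M x * N x) i j := by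
  simp only [Matrix.mul_apply]
  exact RatOn.sum _ fun k _ => (hM i k).mul (hN k j)

lemma RatOn.det {m : Type*} [Fintype m] [DecidableEq m] {M : X → Matrix m m ℂ}
    (hM : ∀ i j, RatOn S fun x => M x i j) : RatOn S fun x => (M x).det := by
  simp only [Matrix.det_apply']
  exact RatOn.sum _ fun σ _ => (RatOn.const _).mul (RatOn.prod _ fun k _ => hM _ _)

/-- A partial function with rational coordinates represents a rational morphism.  The point is to
pass to a common denominator of the coordinates. -/
lemma IsRational.of_ratOn {Y κ : Type} [AffCoords Y κ] [Finite κ] (hS : S.Nonempty) {f : X →. Y}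
    {F : κ → X → ℂ} (hF : ∀ j, RatOn S (F j))
    (h : Near S fun x => ∃ y ∈ f x, ∀ j, AffCoords.coord y j = F j x) : IsRational f := by
  classical
  cases nonempty_fintype κ
  choose p q hq hF using hF
  obtain ⟨r, hr, h⟩ := h
  refine ⟨r * ∏ j, q j, fun j => p j * (r * ∏ k ∈ Finset.univ.erase j, q k), ?_, fun x hx => ?_⟩
  · obtain ⟨x, hx⟩ := hS
    refine ⟨x, ?_⟩
    rw [evalAt_mul, evalAt_prod]
    exact mul_ne_zero (hr x hx) (Finset.prod_ne_zero_iff.mpr fun k _ => hq k x hx)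
  · rw [evalAt_mul, evalAt_prod] at hx
    obtain ⟨y, hy, hyF⟩ := h x (left_ne_zero_of_mul hx)
    have hx' := Finset.prod_ne_zero_iff.mp (right_ne_zero_of_mul hx)
    refine ⟨y, hy, fun j => ?_⟩
    have h1 : ∏ k ∈ Finset.univ.erase j, evalAt x (q k) ≠ 0 :=
      Finset.prod_ne_zero_iff.mpr fun k _ => hx' k (Finset.mem_univ k)
    rw [hyF j, hF j x (hx' j (Finset.mem_univ j)), evalAt_mul, evalAt_mul, evalAt_prod, evalAt_mul,
      evalAt_prod, ← Finset.mul_prod_erase _ _ (Finset.mem_univ j), mul_left_comm (evalAt x r),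
      mul_div_mul_right _ _ (mul_ne_zero (left_ne_zero_of_mul hx) h1)]

end Regular

/-! ### Positive rational functions and their degrees -/

/-- `r` is a quotient of nonzero polynomials with nonnegative coefficients, and `d` is the
difference of their degrees. -/
def PosDeg (r : RatFunc ℂ) (d : ℤ) : Prop :=
  ∃ P Q : Polynomial ℝ, P ≠ 0 ∧ Q ≠ 0 ∧ (∀ k, 0 ≤ P.coeff k) ∧ (∀ k, 0 ≤ Q.coeff k) ∧
    r = algebraMap (Polynomial ℂ) (RatFunc ℂ) (P.map (algebraMap ℝ ℂ)) /
      algebraMap (Polynomial ℂ) (RatFunc ℂ) (Q.map (algebraMap ℝ ℂ)) ∧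
    d = P.natDegree - Q.natDegree

lemma PosDeg.isPositiveRat {r : RatFunc ℂ} {d : ℤ} (h : PosDeg r d) : IsPositiveRat r := by
  obtain ⟨P, Q, h1, h2, h3, h4, h5, -⟩ := h
  exact ⟨P, Q, h1, h2, h3, h4, h5⟩

lemma algebraMap_map_ne_zero {P : Polynomial ℝ} (h : P ≠ 0) :
    algebraMap (Polynomial ℂ) (RatFunc ℂ) (P.map (algebraMap ℝ ℂ)) ≠ 0 := by
  rw [Ne, FaithfulSMul.algebraMap_eq_zero_iff, Polynomial.map_eq_zero]
  exact h

lemma PosDeg.ne_zero {r : RatFunc ℂ} {d : ℤ} (h : PosDeg r d) : r ≠ 0 := by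
  obtain ⟨P, Q, h1, h2, -, -, rfl, -⟩ := h
  exact div_ne_zero (algebraMap_map_ne_zero h1) (algebraMap_map_ne_zero h2)

lemma PosDeg.intDegree {r : RatFunc ℂ} {d : ℤ} (h : PosDeg r d) : r.intDegree = d := by
  obtain ⟨P, Q, h1, h2, -, -, rfl, rfl⟩ := h
  rw [div_eq_mul_inv, RatFunc.intDegree_mul (algebraMap_map_ne_zero h1)
    (inv_ne_zero (algebraMap_map_ne_zero h2)), RatFunc.intDegree_inv, RatFunc.intDegree_polynomial,
    RatFunc.intDegree_polynomial, Polynomial.natDegree_map, Polynomial.natDegree_map,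
    sub_eq_add_neg]

lemma coeff_mul_nonneg {P Q : Polynomial ℝ} (hP : ∀ k, 0 ≤ P.coeff k) (hQ : ∀ k, 0 ≤ Q.coeff k)
    (k : ℕ) : 0 ≤ (P * Q).coeff k := by
  rw [Polynomial.coeff_mul]
  exact Finset.sum_nonneg fun x _ => mul_nonneg (hP _) (hQ _)

lemma coeff_add_nonneg {P Q : Polynomial ℝ} (hP : ∀ k, 0 ≤ P.coeff k) (hQ : ∀ k, 0 ≤ Q.coeff k)
    (k : ℕ) : 0 ≤ (P + Q).coeff k := by
  rw [Polynomial.coeff_add]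
  exact add_nonneg (hP k) (hQ k)

lemma leadingCoeff_pos {P : Polynomial ℝ} (h : P ≠ 0) (hP : ∀ k, 0 ≤ P.coeff k) :
    0 < P.leadingCoeff :=
  lt_of_le_of_ne (hP _) (Ne.symm (Polynomial.leadingCoeff_ne_zero.mpr h))

/-- Leading terms of polynomials with nonnegative coefficients cannot cancel. -/
lemma natDegree_add_of_nonneg {P Q : Polynomial ℝ} (hP0 : P ≠ 0) (hQ0 : Q ≠ 0)
    (hP : ∀ k, 0 ≤ P.coeff k) (hQ : ∀ k, 0 ≤ Q.coeff k) :
    (P + Q).natDegree = max P.natDegree Q.natDegree ∧ P + Q ≠ 0 := by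
  have h : (P + Q).coeff (max P.natDegree Q.natDegree) ≠ 0 := by
    rw [Polynomial.coeff_add]
    rcases le_total P.natDegree Q.natDegree with h | h
    · rw [max_eq_right h]
      exact (add_pos_of_nonneg_of_pos (hP _) (leadingCoeff_pos hQ0 hQ)).ne'
    · rw [max_eq_left h]
      exact (add_pos_of_pos_of_nonneg (leadingCoeff_pos hP0 hP) (hQ _)).ne'
  exact ⟨le_antisymm (Polynomial.natDegree_add_le _ _) (Polynomial.le_natDegree_of_ne_zero h),
    fun h0 => h (by simp [h0])⟩

lemma PosDeg.mul {r s : RatFunc ℂ} {d e : ℤ} (hr : PosDeg r d) (hs : PosDeg s e) :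
    PosDeg (r * s) (d + e) := by
  obtain ⟨P, Q, h1, h2, h3, h4, rfl, rfl⟩ := hr
  obtain ⟨P', Q', h1', h2', h3', h4', rfl, rfl⟩ := hs
  refine ⟨P * P', Q * Q', mul_ne_zero h1 h1', mul_ne_zero h2 h2', coeff_mul_nonneg h3 h3',
    coeff_mul_nonneg h4 h4', ?_, ?_⟩
  · rw [Polynomial.map_mul, Polynomial.map_mul, map_mul, map_mul, div_mul_div_comm]
  · rw [Polynomial.natDegree_mul h1 h1', Polynomial.natDegree_mul h2 h2']
    push_cast
    ring

lemma PosDeg.add {r s : RatFunc ℂ} {d e : ℤ} (hr : PosDeg r d) (hs : PosDeg s e) :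
    PosDeg (r + s) (max d e) := by
  obtain ⟨P, Q, h1, h2, h3, h4, rfl, rfl⟩ := hr
  obtain ⟨P', Q', h1', h2', h3', h4', rfl, rfl⟩ := hs
  have h := natDegree_add_of_nonneg (mul_ne_zero h1 h2') (mul_ne_zero h2 h1')
    (coeff_mul_nonneg h3 h4') (coeff_mul_nonneg h4 h3')
  refine ⟨P * Q' + Q * P', Q * Q', h.2, mul_ne_zero h2 h2',
    coeff_add_nonneg (coeff_mul_nonneg h3 h4') (coeff_mul_nonneg h4 h3'),
    coeff_mul_nonneg h4 h4', ?_, ?_⟩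
  · rw [div_add_div _ _ (algebraMap_map_ne_zero h2) (algebraMap_map_ne_zero h2')]
    simp only [Polynomial.map_mul, Polynomial.map_add, map_mul, map_add]
  · rw [h.1, Polynomial.natDegree_mul h1 h2', Polynomial.natDegree_mul h2 h1',
      Polynomial.natDegree_mul h2 h2']
    push_cast
    omega

lemma PosDeg.inv {r : RatFunc ℂ} {d : ℤ} (hr : PosDeg r d) : PosDeg r⁻¹ (-d) := by
  obtain ⟨P, Q, h1, h2, h3, h4, rfl, rfl⟩ := hr
  exact ⟨Q, P, h2, h1, h4, h3, by rw [inv_div], by ring⟩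

lemma PosDeg.one : PosDeg 1 0 :=
  ⟨1, 1, one_ne_zero, one_ne_zero, fun k => by rw [Polynomial.coeff_one]; split_ifs <;> simp,
    fun k => by rw [Polynomial.coeff_one]; split_ifs <;> simp, by simp, by simp⟩

lemma PosDeg.X_pow (m : ℕ) : PosDeg (RatFunc.X ^ m) m :=
  ⟨Polynomial.X ^ m, 1, pow_ne_zero _ Polynomial.X_ne_zero, one_ne_zero,
    fun k => by rw [Polynomial.coeff_X_pow]; split_ifs <;> simp,
    fun k => by rw [Polynomial.coeff_one]; split_ifs <;> simp, by simp, by simp⟩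

lemma PosDeg.X_zpow (m : ℤ) : PosDeg (RatFunc.X ^ m) m := by
  obtain ⟨k, rfl | rfl⟩ := m.eq_nat_or_neg
  · simpa using PosDeg.X_pow k
  · simpa using (PosDeg.X_pow k).inv

/-! ### Positive functions on a torus and their tropicalizations -/

section Trop

variable {σ τ : Type}

/-- The points of the torus with positive real coordinates. -/
def posTorus (σ : Type) : Set (σ → ℂˣ) := {t | ∀ s, 0 < (t s : ℂ)}

lemma one_mem_posTorus : (1 : σ → ℂˣ) ∈ posTorus σ := fun s => by simp

/-- `F` is a subtraction-free rational function on the torus, with tropicalization `T`: the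
degree of `F` along the co-character `l` is `T l`. -/
def HasTrop (F : (σ → ℂˣ) → ℂ) (T : (σ → ℤ) → ℤ) : Prop :=
  ∃ p q : MvPolynomial σ ℂ, (∀ t ∈ posTorus σ, 0 < evalAt t p ∧ 0 < evalAt t q) ∧
    (∀ t, evalAt t q ≠ 0 → F t = evalAt t p / evalAt t q) ∧
    ∀ l, ∃ d e, PosDeg (cocharEval l p) d ∧ PosDeg (cocharEval l q) e ∧ T l = d - e

lemma HasTrop.ratOn {F : (σ → ℂˣ) → ℂ} {T : (σ → ℤ) → ℤ} (h : HasTrop F T) :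
    RatOn (posTorus σ) F := by
  obtain ⟨p, q, hpos, hF, -⟩ := h
  exact ⟨p, q, fun t ht => (hpos t ht).2.ne', hF⟩

lemma HasTrop.pos {F : (σ → ℂˣ) → ℂ} {T : (σ → ℤ) → ℤ} (h : HasTrop F T) {t : σ → ℂˣ}
    (ht : t ∈ posTorus σ) : 0 < F t := by
  obtain ⟨p, q, hpos, hF, -⟩ := h
  rw [hF t (hpos t ht).2.ne', div_eq_mul_inv]
  exact mul_pos (hpos t ht).1 (RCLike.inv_pos.mpr (hpos t ht).2)

lemma HasTrop.congr {F G : (σ → ℂˣ) → ℂ} {T T' : (σ → ℤ) → ℤ} (h : HasTrop F T)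
    (hF : ∀ t, G t = F t) (hT : ∀ l, T' l = T l) : HasTrop G T' := by
  rw [funext hF, funext hT]
  exact h

lemma HasTrop.one : HasTrop (fun _ : σ → ℂˣ => 1) fun _ => 0 :=
  ⟨1, 1, fun t _ => by simp [evalAt_one], fun t _ => by simp [evalAt_one],
    fun l => ⟨0, 0, by simpa using PosDeg.one, by simpa using PosDeg.one, by simp⟩⟩

lemma HasTrop.coord (s : σ) : HasTrop (fun t : σ → ℂˣ => (t s : ℂ)) fun l => l s :=
  ⟨MvPolynomial.X s, 1, fun t ht => by
      rw [evalAt_one, evalAt_X]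
      exact ⟨ht s, zero_lt_one⟩,
    fun t _ => by rw [evalAt_one, evalAt_X, div_one]; rfl,
    fun l => ⟨l s, 0, by simpa [cocharEval] using PosDeg.X_zpow (l s),
      by simpa using PosDeg.one, by simp⟩⟩

lemma HasTrop.mul {F G : (σ → ℂˣ) → ℂ} {T T' : (σ → ℤ) → ℤ} (hF : HasTrop F T)
    (hG : HasTrop G T') : HasTrop (fun t => F t * G t) fun l => T l + T' l := by
  obtain ⟨p, q, hpos, hF, hT⟩ := hF
  obtain ⟨p', q', hpos', hG, hT'⟩ := hG
  refine ⟨p * p', q * q', fun t ht => ?_, fun t ht => ?_, fun l => ?_⟩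
  · rw [evalAt_mul, evalAt_mul]
    exact ⟨mul_pos (hpos t ht).1 (hpos' t ht).1, mul_pos (hpos t ht).2 (hpos' t ht).2⟩
  · rw [evalAt_mul] at ht
    beta_reduce
    rw [hF t (left_ne_zero_of_mul ht), hG t (right_ne_zero_of_mul ht), evalAt_mul, evalAt_mul,
      div_mul_div_comm]
  · obtain ⟨d, e, hd, he, h⟩ := hT l
    obtain ⟨d', e', hd', he', h'⟩ := hT' l
    refine ⟨d + d', e + e', ?_, ?_, by beta_reduce; omega⟩
    · rw [map_mul]
      exact hd.mul hd'
    · rw [map_mul]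
      exact he.mul he'

lemma HasTrop.inv {F : (σ → ℂˣ) → ℂ} {T : (σ → ℤ) → ℤ} (hF : HasTrop F T) :
    HasTrop (fun t => (F t)⁻¹) fun l => -T l := by
  obtain ⟨p, q, hpos, hF, hT⟩ := hF
  refine ⟨q * q, p * q, fun t ht => ?_, fun t ht => ?_, fun l => ?_⟩
  · rw [evalAt_mul, evalAt_mul]
    exact ⟨mul_pos (hpos t ht).2 (hpos t ht).2, mul_pos (hpos t ht).1 (hpos t ht).2⟩
  · rw [evalAt_mul] at ht
    have h2 := right_ne_zero_of_mul ht
    beta_reduce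
    rw [hF t h2, evalAt_mul, evalAt_mul, inv_div, mul_div_mul_right _ _ h2]
  · obtain ⟨d, e, hd, he, h⟩ := hT l
    refine ⟨e + e, d + e, ?_, ?_, by beta_reduce; omega⟩
    · rw [map_mul]
      exact he.mul he
    · rw [map_mul]
      exact hd.mul he

lemma HasTrop.div {F G : (σ → ℂˣ) → ℂ} {T T' : (σ → ℤ) → ℤ} (hF : HasTrop F T)
    (hG : HasTrop G T') : HasTrop (fun t => F t / G t) fun l => T l - T' l := by
  simpa only [div_eq_mul_inv, sub_eq_add_neg] using hF.mul hG.inv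

lemma HasTrop.add {F G : (σ → ℂˣ) → ℂ} {T T' : (σ → ℤ) → ℤ} (hF : HasTrop F T)
    (hG : HasTrop G T') : HasTrop (fun t => F t + G t) fun l => max (T l) (T' l) := by
  obtain ⟨p, q, hpos, hF, hT⟩ := hF
  obtain ⟨p', q', hpos', hG, hT'⟩ := hG
  refine ⟨p * q' + q * p', q * q', fun t ht => ?_, fun t ht => ?_, fun l => ?_⟩
  · rw [evalAt_mul, evalAt_add, evalAt_mul, evalAt_mul]
    exact ⟨add_pos (mul_pos (hpos t ht).1 (hpos' t ht).2) (mul_pos (hpos t ht).2 (hpos' t ht).1),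
      mul_pos (hpos t ht).2 (hpos' t ht).2⟩
  · rw [evalAt_mul] at ht
    have h1 := left_ne_zero_of_mul ht
    have h2 := right_ne_zero_of_mul ht
    beta_reduce
    rw [hF t h1, hG t h2, evalAt_mul, evalAt_add, evalAt_mul, evalAt_mul, div_add_div _ _ h1 h2]
  · obtain ⟨d, e, hd, he, h⟩ := hT l
    obtain ⟨d', e', hd', he', h'⟩ := hT' l
    refine ⟨max (d + e') (e + d'), e + e', ?_, ?_, by beta_reduce; omega⟩
    · rw [map_add, map_mul, map_mul]
      exact (hd.mul he').add (he.mul hd')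
    · rw [map_mul]
      exact he.mul he'

lemma HasTrop.prod {κ : Type*} (s : Finset κ) {F : κ → (σ → ℂˣ) → ℂ} {T : κ → (σ → ℤ) → ℤ}
    (h : ∀ k ∈ s, HasTrop (F k) (T k)) :
    HasTrop (fun t => ∏ k ∈ s, F k t) fun l => ∑ k ∈ s, T k l := by
  classical
  induction s using Finset.induction_on with
  | empty => simpa using HasTrop.one
  | insert a s ha ih =>
    simp only [Finset.prod_insert ha, Finset.sum_insert ha]
    exact (h a (by simp)).mul (ih fun k hk => h k (by simp [hk]))

lemma HasTrop.sum {κ : Type*} {s : Finset κ} (hs : s.Nonempty) {F : κ → (σ → ℂˣ) → ℂ}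
    {T : κ → (σ → ℤ) → ℤ} (h : ∀ k ∈ s, HasTrop (F k) (T k)) :
    HasTrop (fun t => ∑ k ∈ s, F k t) fun l => s.sup' hs fun k => T k l := by
  classical
  induction hs using Finset.Nonempty.cons_induction with
  | singleton a => simpa using h a (by simp)
  | cons a s ha hs ih =>
    simp only [Finset.sum_cons, Finset.sup'_cons hs]
    exact (h a (by simp)).add (ih fun k hk => h k (by simp [hk]))

/-- Two polynomials that agree on a nonempty open subset of the torus are equal. -/
lemma eq_of_generically_evalAt_eq [Finite σ] {p q : MvPolynomial σ ℂ}
    (h : Generically fun t : σ → ℂˣ => evalAt t p = evalAt t q) : p = q := by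
  cases nonempty_fintype σ
  obtain ⟨r, ⟨t₀, hr⟩, h⟩ := h
  have h1 : (p - q) * (r * ∏ s, MvPolynomial.X s) = 0 := by
    refine MvPolynomial.funext fun x => ?_
    rw [map_mul, map_mul, map_prod, map_sub, map_zero]
    by_cases hx : ∀ s, x s ≠ 0
    · have := h fun s => Units.mk0 (x s) (hx s)
      change MvPolynomial.eval x r ≠ 0 → MvPolynomial.eval x p = MvPolynomial.eval x q at this
      by_cases h0 : MvPolynomial.eval x r = 0
      · simp [h0]
      · simp [this h0]
    · push Not at hx
      obtain ⟨s, hs⟩ := hx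
      rw [Finset.prod_eq_zero (Finset.mem_univ s) (by simpa using hs)]
      simp
  rcases mul_eq_zero.mp h1 with h2 | h2
  · exact sub_eq_zero.mp h2
  · rcases mul_eq_zero.mp h2 with h3 | h3
    · exact absurd (by rw [h3]; exact map_zero _) hr
    · exact absurd h3 (Finset.prod_ne_zero_iff.mpr fun s _ => MvPolynomial.X_ne_zero s)

lemma generically_and_torus [Finite σ] {P Q : (σ → ℂˣ) → Prop} (hP : Generically P)
    (hQ : Generically Q) : Generically fun t => P t ∧ Q t := by
  obtain ⟨p, ⟨t, ht⟩, hP⟩ := hP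
  obtain ⟨q, ⟨s, hs⟩, hQ⟩ := hQ
  by_cases h : ∃ x : σ → ℂˣ, evalAt x (p * q) ≠ 0
  · refine ⟨p * q, h, fun x hx => ?_⟩
    rw [evalAt_mul] at hx
    exact ⟨hP x (left_ne_zero_of_mul hx), hQ x (right_ne_zero_of_mul hx)⟩
  · push Not at h
    have h1 : p * q = 0 := eq_of_generically_evalAt_eq
      ⟨1, ⟨1, by simp [evalAt_one]⟩, fun x _ => (h x).trans (map_zero _).symm⟩
    rcases mul_eq_zero.mp h1 with h2 | h2
    · exact absurd (by rw [h2]; exact map_zero _) ht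
    · exact absurd (by rw [h2]; exact map_zero _) hs

/-- The restriction of a rational function to a co-character is unique. -/
lemma RestrictsTo.unique [Finite σ] {f : (σ → ℂˣ) →. (τ → ℂˣ)} {l : σ → ℤ} {j : τ}
    {r r' : RatFunc ℂ} (h : RestrictsTo f l j r) (h' : RestrictsTo f l j r') : r = r' := by
  obtain ⟨p, q, hq, hg, rfl⟩ := h
  obtain ⟨p', q', hq', hg', rfl⟩ := h'
  have h1 : p * q' = p' * q := by
    obtain ⟨r, hr, hgg⟩ := generically_and_torus hg hg'
    refine eq_of_generically_evalAt_eq ⟨r, hr, fun x hx => ?_⟩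
    obtain ⟨⟨s, hs, h1⟩, ⟨s', hs', h2⟩⟩ := hgg x hx
    obtain rfl := Part.mem_unique hs hs'
    rw [evalAt_mul, evalAt_mul, ← h1, ← h2]
    ring
  rw [div_eq_div_iff hq hq', ← map_mul, ← map_mul, h1]

/-- A morphism of tori with subtraction-free components is positive, and its ultra-discretization
consists of the tropicalizations of the components. -/
lemma isPositiveMor_of_hasTrop [Finite σ] [Finite τ] {f : (σ → ℂˣ) →. (τ → ℂˣ)}
    {F : τ → (σ → ℂˣ) → ℂ} {T : τ → (σ → ℤ) → ℤ} (hF : ∀ j, HasTrop (F j) (T j))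
    (h : Near (posTorus σ) fun t => ∃ s ∈ f t, ∀ j, ((s j : ℂˣ) : ℂ) = F j t) :
    IsPositiveMor f ∧ ∀ l j, ultraDisc f l j = T j l := by
  have key : ∀ l j, ∃ r, RestrictsTo f l j r ∧ PosDeg r (T j l) := by
    intro l j
    obtain ⟨p, q, hpos, hFj, hT⟩ := hF j
    obtain ⟨d, e, hd, he, hde⟩ := hT l
    refine ⟨_, ⟨p, q, he.ne_zero, ?_, rfl⟩, ?_⟩
    · have hq : Near (posTorus σ) fun t => evalAt t q ≠ 0 :=
        ⟨q, fun t ht => (hpos t ht).2.ne', fun t ht => ht⟩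
      refine ((h.and hq).mono ?_).generically ⟨1, one_mem_posTorus⟩
      rintro t ⟨⟨s, hs, hsF⟩, hqt⟩
      exact ⟨s, hs, by rw [hsF j, hFj t hqt, div_mul_cancel₀ _ hqt]⟩
    · rw [div_eq_mul_inv, hde, sub_eq_add_neg]
      exact hd.mul he.inv
  refine ⟨⟨IsRational.of_ratOn ⟨1, one_mem_posTorus⟩ (fun j => (hF j).ratOn) h, fun l j => ?_⟩,
    fun l j => ?_⟩
  · obtain ⟨r, hr, hp⟩ := key l j
    exact ⟨r, hr, hp.isPositiveRat⟩
  · obtain ⟨r, hr, hp⟩ := key l j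
    have hex : ∃ r, RestrictsTo f l j r := ⟨r, hr⟩
    rw [ultraDisc, dif_pos hex, hex.choose_spec.unique hr, hp.intDegree]

end Trop

/-! ### The free crystal and the powers of its operators -/

/-- The tropical polynomial `max_{j ≤ i} (b_j + [j < k] β)`.  The coefficients `β_k^{(i)}` are its
differences in `k`, and it is the tropicalization of `∑_{j ≤ i} c^{[j < k]} a_j`. -/
def tropSum (b : ℕ → ℤ) (i : ℕ) (β : ℤ) (k : ℕ) : ℤ :=
  (Finset.range (i + 1)).sup' Finset.nonempty_range_add_one fun j => b j + if j < k then β else 0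

lemma bMax_eq_tropSum {n : ℕ} (v : Bsharp n) (i : ℕ) (β : ℤ) {k : ℕ} (hk : k ≤ i + 1) :
    max ((β : WithBot ℤ) + bMax v i (Finset.Iio k)) (bMax v i (Finset.Icc k i)) =
      (tropSum (bSum v i) i β k : ℤ) := by
  have hu : Finset.range (i + 1) = Finset.Iio k ∪ Finset.Icc k i := by
    ext j
    simp only [Finset.mem_range, Finset.mem_union, Finset.mem_Iio, Finset.mem_Icc]
    omega
  rw [tropSum, Finset.coe_sup', hu, Finset.sup_union, bMax, bMax,
    Finset.apply_sup_eq_sup_comp_of_linearOrder (fun x => (β : WithBot ℤ) + x)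
      (fun x y h => add_le_add_right h _) (WithBot.add_bot _)]
  congr 1
  · refine Finset.sup_congr rfl fun j hj => ?_
    simp only [Function.comp, if_pos (Finset.mem_Iio.mp hj), WithBot.coe_add]
    rw [add_comm]
  · refine Finset.sup_congr rfl fun j hj => ?_
    simp only [Function.comp, if_neg (not_lt.mpr (Finset.mem_Icc.mp hj).1), add_zero]

/-- The coefficient `β_k^{(i)}` is a difference of values of one tropical polynomial, so that
sums over `k` telescope. -/
lemma betaCoeff_eq {n : ℕ} (i : Fin n) (β : ℤ) (v : Bsharp n) {k : ℕ} (hk : k ≤ i) :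
    betaCoeff i β v k = tropSum (bSum v i) i β (k + 1) - tropSum (bSum v i) i β k := by
  have h1 : (Finset.Iic k : Finset ℕ) = Finset.Iio (k + 1) := by
    ext j
    simp only [Finset.mem_Iic, Finset.mem_Iio]
    omega
  have h2 : (Finset.Ioc k i : Finset ℕ) = Finset.Icc (k + 1) i := by
    ext j
    simp only [Finset.mem_Ioc, Finset.mem_Icc]
    omega
  rw [betaCoeff, h1, h2, bMax_eq_tropSum v i β (by omega), bMax_eq_tropSum v i β (by omega)]
  rfl

/-- Prefix and suffix maxima of `b`, with a sufficiently small number `K` in the place of the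
maximum of the empty set. -/
lemma exists_prefix_suffix_max (b : ℕ → ℤ) (i : ℕ) (β : ℤ) : ∃ (P N : ℕ → ℤ) (K : ℤ),
    P 0 = K ∧ (∀ k, P (k + 1) = max (P k) (b k)) ∧ (∀ k ≤ i, N k = max (b k) (N (k + 1))) ∧
    N (i + 1) = K ∧ (∀ k ≤ i, K + 2 ≤ b k ∧ K + β + 2 ≤ b k ∧ K - β + 2 ≤ b k) ∧
    ∀ γ, β ≤ γ → γ ≤ β + 1 → ∀ k ≤ i + 1, tropSum b i γ k = max (γ + P k) (N k) := by
  set K := (Finset.range (i + 1)).inf' Finset.nonempty_range_add_one b - |β| - 2 with hK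
  have hKb : ∀ k ≤ i, K + 2 ≤ b k ∧ K + β + 2 ≤ b k ∧ K - β + 2 ≤ b k := by
    intro k hk
    have h1 : (Finset.range (i + 1)).inf' Finset.nonempty_range_add_one b ≤ b k :=
      Finset.inf'_le _ (by simp; omega)
    have h2 := le_abs_self β
    have h3 := neg_le_abs β
    omega
  refine ⟨fun k => (Finset.range k).fold max K b, fun k => (Finset.Icc k i).fold max K b, K,
    rfl, fun k => ?_, fun k hk => ?_, by simp, hKb, fun γ h1 h2 k hk => ?_⟩
  · beta_reduce
    rw [Finset.range_add_one, Finset.fold_insert Finset.notMem_range_self, max_comm]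
  · beta_reduce
    rw [← Finset.insert_Icc_add_one_left_eq_Icc hk, Finset.fold_insert (by simp)]
  · beta_reduce
    refine le_antisymm (Finset.sup'_le _ _ fun j hj => ?_) (max_le ?_ ?_)
    · rw [Finset.mem_range] at hj
      split_ifs with h
      · have : b j ≤ (Finset.range k).fold max K b :=
          (Finset.le_fold_max _).mpr (Or.inr ⟨j, by simpa using h, le_rfl⟩)
        exact le_max_of_le_left (by omega)
      · have : b j ≤ (Finset.Icc k i).fold max K b :=
          (Finset.le_fold_max _).mpr (Or.inr ⟨j, by simp; omega, le_rfl⟩)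
        exact le_max_of_le_right (by omega)
    · have : (Finset.range k).fold max K b ≤ tropSum b i γ k - γ := by
        refine (Finset.fold_max_le _).mpr ⟨?_, fun j hj => ?_⟩
        · have h3 : b 0 + (if 0 < k then γ else 0) ≤ tropSum b i γ k :=
            Finset.le_sup' (fun j => b j + if j < k then γ else 0) (by simp)
          have := hKb 0 (by omega)
          split_ifs at h3 <;> omega
        · rw [Finset.mem_range] at hj
          have h3 : b j + (if j < k then γ else 0) ≤ tropSum b i γ k :=
            Finset.le_sup' (fun j => b j + if j < k then γ else 0) (by simp; omega)
          rw [if_pos hj] at h3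
          omega
      omega
    · refine (Finset.fold_max_le _).mpr ⟨?_, fun j hj => ?_⟩
      · have h3 : b 0 + (if 0 < k then γ else 0) ≤ tropSum b i γ k :=
          Finset.le_sup' (fun j => b j + if j < k then γ else 0) (by simp)
        have := hKb 0 (by omega)
        split_ifs at h3 <;> omega
      · rw [Finset.mem_Icc] at hj
        have h3 : b j + (if j < k then γ else 0) ≤ tropSum b i γ k :=
          Finset.le_sup' (fun j => b j + if j < k then γ else 0) (by simp; omega)
        rw [if_neg (by omega)] at h3
        omega

lemma tropSum_zero (b : ℕ → ℤ) (i k k' : ℕ) : tropSum b i 0 k = tropSum b i 0 k' := by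
  simp [tropSum]

/-- If `m` is the least maximum point of `b_k - S_{k+1} - S_k`, where `S_k` is `tropSum b i β k`,
then an increase of `β` by one increases exactly the `S_k` with `k > m`.  The reason is that this
maximum point is the least index `m` for which the maximum of `β + b_j` over `j ≤ m` is not smaller
than the maximum of the `b_j` with `j > m`. -/
lemma tropSum_succ (b : ℕ → ℤ) (i : ℕ) (β : ℤ) (m : ℕ) (hm : m ≤ i)
    (hlt : ∀ k < m, b k - tropSum b i β (k + 1) - tropSum b i β k <
      b m - tropSum b i β (m + 1) - tropSum b i β m)
    (hle : ∀ k ≤ i, b k - tropSum b i β (k + 1) - tropSum b i β k ≤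
      b m - tropSum b i β (m + 1) - tropSum b i β m) {k : ℕ} (hk : k ≤ i + 1) :
    tropSum b i (β + 1) k = tropSum b i β k + if m < k then 1 else 0 := by
  obtain ⟨P, N, K, hP0, hP, hN, hNi, hK, hS⟩ := exists_prefix_suffix_max b i β
  have hS1 := hS (β + 1) (by omega) le_rfl
  have hS0 := hS β le_rfl (by omega)
  have hKP : ∀ k, K ≤ P k := by
    intro k
    induction k with
    | zero => omega
    | succ k ih => rw [hP]; omega
  have hPm : Monotone P := monotone_nat_of_le_succ fun k => by rw [hP]; exact le_max_left _ _
  have hNm : ∀ k l, k ≤ l → l ≤ i + 1 → N l ≤ N k := by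
    intro k l hkl
    induction l, hkl using Nat.le_induction with
    | base => intro _; exact le_rfl
    | succ l hkl ih =>
      intro hl
      have h1 := ih (by omega)
      have h2 := hN l (by omega)
      omega
  -- the larger one of the prefix and the suffix maximum is the total maximum
  have hE : ∀ k ≤ i + 1, max (P k) (N k) = max (P 0) (N 0) := by
    intro k
    induction k with
    | zero => intro _; rfl
    | succ k ih =>
      intro hk
      have h1 := ih (by omega)
      have h2 := hN k (by omega)
      have h3 := hP k
      omega
  have hex : ∃ k, k ≤ i ∧ N (k + 1) ≤ β + P (k + 1) :=
    ⟨i, le_rfl, by have := hK i le_rfl; have := hP i; omega⟩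
  classical
  obtain ⟨h01, h02⟩ := Nat.find_spec hex
  have hmin : ∀ k < Nat.find hex, β + P (k + 1) < N (k + 1) := by
    intro k hk
    have := Nat.find_min hex hk
    omega
  set m₀ := Nat.find hex with hm₀
  -- the suffix maximum determines `S_k` up to `m₀`, and the prefix maximum after it
  have hlow : ∀ k ≤ m₀, β + P k < N k := by
    intro k hk
    cases k with
    | zero =>
      have h1 := hN 0 (by omega)
      have h2 := hK 0 (by omega)
      omega
    | succ k => exact hmin k (by omega)
  have hhigh : ∀ k, m₀ < k → k ≤ i + 1 → N k ≤ β + P k := by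
    intro k hk hki
    have h1 := hNm (m₀ + 1) k hk hki
    have h2 : P (m₀ + 1) ≤ P k := hPm hk
    omega
  -- so `m₀` is the least maximum point, and hence equal to `m`
  have hf : b m₀ - tropSum b i β (m₀ + 1) - tropSum b i β m₀ = -(max (P 0) (N 0) + β) := by
    have h1 := hE m₀ (by omega)
    have h2 := hlow m₀ le_rfl
    have h3 := hN m₀ h01
    have h4 := hP m₀
    rw [hS0 _ (by omega), hS0 _ (by omega)]
    omega
  have hflt : ∀ k < m₀, b k - tropSum b i β (k + 1) - tropSum b i β k <
      -(max (P 0) (N 0) + β) := by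
    intro k hk
    have h1 := hE k (by omega)
    have h2 := hlow k (by omega)
    have h3 := hlow (k + 1) (by omega)
    have h4 := hN k (by omega)
    have h5 := hP k
    rw [hS0 _ (by omega), hS0 _ (by omega)]
    omega
  have hfle : ∀ k, m₀ < k → k ≤ i → b k - tropSum b i β (k + 1) - tropSum b i β k ≤
      -(max (P 0) (N 0) + β) := by
    intro k hk hki
    have h1 := hE k (by omega)
    have h2 := hhigh k (by omega) (by omega)
    have h3 := hhigh (k + 1) (by omega) (by omega)
    have h4 := hN k (by omega)
    have h5 := hP k
    rw [hS0 _ (by omega), hS0 _ (by omega)]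
    omega
  have hmm : m = m₀ := by
    rcases lt_trichotomy m m₀ with h | h | h
    · have h1 := hflt m h
      have h2 := hle m₀ h01
      omega
    · exact h
    · have h1 := hlt m₀ h
      have h2 := hfle m h hm
      omega
  rw [hS1 k hk, hS0 k hk, hmm]
  split_ifs with h
  · have := hhigh k h hk
    omega
  · have := hlow k (by omega)
    omega

section Crystal

variable {n : ℕ}

/-- The position `(m, i + 1)` exists since `m ≤ i`; by contrast `(m, i)` does not if `m = i`. -/
lemma bEntry_shiftRow_succ (i m : Fin n) (hm : m ≤ i) (d : ℤ) (v : Bsharp n) (l : ℕ) :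
    bEntry (shiftRow i m d v) l (i + 1) = bEntry v l (i + 1) - if l = m then d else 0 := by
  have hi := i.2
  have hm' : m.1 ≤ i.1 := hm
  unfold bEntry
  by_cases h : l < i.1 + 1 ∧ i.1 + 1 < n + 1
  · rw [dif_pos h, dif_pos h, shiftRow]
    have h1 : ¬ ((⟨l, h.1.trans h.2⟩ : Fin (n + 1)), (⟨i + 1, h.2⟩ : Fin (n + 1))) =
        (m.castSucc, i.castSucc) := by
      simp [Fin.ext_iff]
    rw [if_neg h1]
    by_cases h2 : l = m
    · rw [if_pos h2, if_pos (by simp [Fin.ext_iff, h2])]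
    · rw [if_neg h2, if_neg (by simp [Fin.ext_iff, h2]), sub_zero]
  · rw [dif_neg h, dif_neg h, if_neg (by omega), sub_zero]

lemma bEntry_shiftRow (i m : Fin n) (d : ℤ) (v : Bsharp n) {l : ℕ} (hl : l < i) :
    bEntry (shiftRow i m d v) l i = bEntry v l i + if l = m then d else 0 := by
  have hi := i.2
  unfold bEntry
  rw [dif_pos ⟨hl, by omega⟩, dif_pos ⟨hl, by omega⟩, shiftRow]
  by_cases h2 : l = m
  · rw [if_pos h2, if_pos (by simp [Fin.ext_iff, h2])]
  · rw [if_neg h2, if_neg (by simp [Fin.ext_iff, h2]), if_neg (by simp [Fin.ext_iff]), add_zero]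

lemma bSum_shiftRow (i m : Fin n) (hm : m ≤ i) (d : ℤ) (v : Bsharp n) {k : ℕ} (hk : k ≤ i) :
    bSum (shiftRow i m d v) i k =
      bSum v i k - (if m.1 ≤ k then d else 0) - if m.1 < k then d else 0 := by
  have h1 : ∑ l ∈ Finset.range k, bEntry (shiftRow i m d v) l i =
      ∑ l ∈ Finset.range k, (bEntry v l i + if l = m then d else 0) :=
    Finset.sum_congr rfl fun l hl => bEntry_shiftRow i m d v
      ((Finset.mem_range.mp hl).trans_le hk)
  rw [bSum, bSum, Finset.sum_congr rfl fun l _ => bEntry_shiftRow_succ i m hm d v l, h1,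
    Finset.sum_sub_distrib, Finset.sum_add_distrib, Finset.sum_ite_eq', Finset.sum_ite_eq']
  simp only [Finset.mem_range, Nat.lt_succ_iff]
  ring

lemma bEntry_sharpAct_succ (i : Fin n) (β : ℤ) (v : Bsharp n) {l : ℕ} (hl : l ≤ i) :
    bEntry (sharpAct i β v) l (i + 1) = bEntry v l (i + 1) - betaCoeff i β v l := by
  have hi := i.2
  have h : l < i.1 + 1 ∧ i.1 + 1 < n + 1 := by omega
  unfold bEntry
  rw [dif_pos h, dif_pos h, sharpAct, if_neg (by simp [Fin.ext_iff]),
    if_pos (by simp [Fin.ext_iff])]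

lemma bEntry_sharpAct (i : Fin n) (β : ℤ) (v : Bsharp n) {l : ℕ} (hl : l < i) :
    bEntry (sharpAct i β v) l i = bEntry v l i + betaCoeff i β v l := by
  have hi := i.2
  have h : l < i.1 ∧ i.1 < n + 1 := by omega
  unfold bEntry
  rw [dif_pos h, dif_pos h, sharpAct, if_pos (by simp [Fin.ext_iff])]

lemma bSum_sharpAct (i : Fin n) (β : ℤ) (v : Bsharp n) {k : ℕ} (hk : k ≤ i) :
    bSum (sharpAct i β v) i k = bSum v i k - tropSum (bSum v i) i β (k + 1) -
      tropSum (bSum v i) i β k + 2 * tropSum (bSum v i) i β 0 := by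
  have h1 : ∑ l ∈ Finset.range k, bEntry (sharpAct i β v) l i =
      ∑ l ∈ Finset.range k, (bEntry v l i +
        (tropSum (bSum v i) i β (l + 1) - tropSum (bSum v i) i β l)) :=
    Finset.sum_congr rfl fun l hl => by
      have := Finset.mem_range.mp hl
      rw [bEntry_sharpAct i β v (by omega), betaCoeff_eq i β v (by omega)]
  have h2 : ∑ l ∈ Finset.range (k + 1), bEntry (sharpAct i β v) l (i + 1) =
      ∑ l ∈ Finset.range (k + 1), (bEntry v l (i + 1) -
        (tropSum (bSum v i) i β (l + 1) - tropSum (bSum v i) i β l)) :=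
    Finset.sum_congr rfl fun l hl => by
      have := Finset.mem_range.mp hl
      rw [bEntry_sharpAct_succ i β v (by omega), betaCoeff_eq i β v (by omega)]
  rw [bSum, bSum, h1, h2, Finset.sum_sub_distrib, Finset.sum_add_distrib, Finset.sum_range_sub,
    Finset.sum_range_sub]
  ring

lemma bSum_le_sharpEps (i : Fin n) (v : Bsharp n) {k : Fin n} (hk : k ≤ i) :
    bSum v i k ≤ sharpEps i v :=
  Finset.le_sup' (fun k : Fin n => bSum v i k) (Finset.mem_Iic.mpr hk)

lemma min_argmax_spec (i : Fin n) (v : Bsharp n) :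
    let m := (argmax i v).min' (argmax_nonempty i v)
    m ≤ i ∧ (∀ k < m, bSum v i k < bSum v i m) ∧ ∀ k ≤ i, bSum v i k ≤ bSum v i m := by
  intro m
  have h := Finset.mem_filter.mp (Finset.min'_mem (argmax i v) (argmax_nonempty i v))
  have h1 := Finset.mem_Iic.mp h.1
  refine ⟨h1, fun k hk => ?_, fun k hk => (bSum_le_sharpEps i v hk).trans_eq h.2.symm⟩
  have hki : k ≤ i := hk.le.trans h1
  refine lt_of_le_of_ne ((bSum_le_sharpEps i v hki).trans_eq h.2.symm) fun he => ?_
  exact absurd (Finset.min'_le _ k (Finset.mem_filter.mpr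
    ⟨Finset.mem_Iic.mpr hki, he.trans h.2⟩)) (not_le.mpr hk)

lemma max_argmax_spec (i : Fin n) (v : Bsharp n) :
    let m := (argmax i v).max' (argmax_nonempty i v)
    m ≤ i ∧ (∀ k ≤ i, m < k → bSum v i k < bSum v i m) ∧ ∀ k ≤ i, bSum v i k ≤ bSum v i m := by
  intro m
  have h := Finset.mem_filter.mp (Finset.max'_mem (argmax i v) (argmax_nonempty i v))
  have h1 := Finset.mem_Iic.mp h.1
  refine ⟨h1, fun k hki hk => ?_, fun k hk => (bSum_le_sharpEps i v hk).trans_eq h.2.symm⟩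
  refine lt_of_le_of_ne ((bSum_le_sharpEps i v hki).trans_eq h.2.symm) fun he => ?_
  exact absurd (Finset.le_max' _ k (Finset.mem_filter.mpr
    ⟨Finset.mem_Iic.mpr hki, he.trans h.2⟩)) (not_le.mpr hk)

lemma min_argmax_eq (i m : Fin n) (v : Bsharp n) (hm : m ≤ i)
    (h1 : ∀ k < m, bSum v i k < bSum v i m) (h2 : ∀ k ≤ i, bSum v i k ≤ bSum v i m) :
    (argmax i v).min' (argmax_nonempty i v) = m := by
  obtain ⟨h3, h4, h5⟩ := min_argmax_spec i v
  rcases lt_trichotomy ((argmax i v).min' (argmax_nonempty i v)) m with h | h | h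
  · exact absurd (h1 _ h) (not_lt.mpr (h5 m hm))
  · exact h
  · exact absurd (h4 _ h) (not_lt.mpr (h2 _ h3))

lemma max_argmax_eq (i m : Fin n) (v : Bsharp n) (hm : m ≤ i)
    (h1 : ∀ k ≤ i, m < k → bSum v i k < bSum v i m) (h2 : ∀ k ≤ i, bSum v i k ≤ bSum v i m) :
    (argmax i v).max' (argmax_nonempty i v) = m := by
  obtain ⟨h3, h4, h5⟩ := max_argmax_spec i v
  rcases lt_trichotomy ((argmax i v).max' (argmax_nonempty i v)) m with h | h | h
  · exact absurd (h4 _ hm h) (not_lt.mpr (h2 _ h3))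
  · exact h
  · exact absurd (h1 _ h3 h) (not_lt.mpr (h5 m hm))

lemma shiftRow_shiftRow_neg (i m : Fin n) (d : ℤ) (v : Bsharp n) :
    shiftRow i m (-d) (shiftRow i m d v) = v := by
  funext p
  unfold shiftRow
  split_ifs <;> ring

/-- The raising operator `ẽ_i` of `B^♯` as a map. -/
def sharpUp (i : Fin n) (v : Bsharp n) : Bsharp n :=
  shiftRow i ((argmax i v).min' (argmax_nonempty i v)) 1 v

/-- The lowering operator `f̃_i` of `B^♯` as a map. -/
def sharpDown (i : Fin n) (v : Bsharp n) : Bsharp n :=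
  shiftRow i ((argmax i v).max' (argmax_nonempty i v)) (-1) v

lemma sharpDown_sharpUp (i : Fin n) (v : Bsharp n) : sharpDown i (sharpUp i v) = v := by
  obtain ⟨h1, h2, h3⟩ := min_argmax_spec i v
  have h : (argmax i (sharpUp i v)).max' (argmax_nonempty i _) =
      (argmax i v).min' (argmax_nonempty i v) := by
    set m := (argmax i v).min' (argmax_nonempty i v) with hm
    refine max_argmax_eq i m _ h1 (fun k hk hmk => ?_) fun k hk => ?_
    · rw [sharpUp, bSum_shiftRow i _ h1 1 v hk, bSum_shiftRow i _ h1 1 v h1]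
      have hmk' : m.1 < k.1 := hmk
      have := h3 k hk
      split_ifs <;> omega
    · rw [sharpUp, bSum_shiftRow i _ h1 1 v hk, bSum_shiftRow i _ h1 1 v h1]
      have := h3 k hk
      have h4 : k.1 < m.1 → _ := h2 k
      split_ifs <;> omega
  rw [sharpDown, h, sharpUp, shiftRow_shiftRow_neg]

lemma sharpUp_sharpDown (i : Fin n) (v : Bsharp n) : sharpUp i (sharpDown i v) = v := by
  obtain ⟨h1, h2, h3⟩ := max_argmax_spec i v
  have h : (argmax i (sharpDown i v)).min' (argmax_nonempty i _) =
      (argmax i v).max' (argmax_nonempty i v) := by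
    set m := (argmax i v).max' (argmax_nonempty i v) with hm
    refine min_argmax_eq i m _ h1 (fun k hmk => ?_) fun k hk => ?_
    · have hmk' : k.1 < m.1 := hmk
      have hk : k ≤ i := hmk.le.trans h1
      rw [sharpDown, bSum_shiftRow i _ h1 _ v hk, bSum_shiftRow i _ h1 _ v h1]
      have := h3 k hk
      split_ifs <;> omega
    · rw [sharpDown, bSum_shiftRow i _ h1 _ v hk, bSum_shiftRow i _ h1 _ v h1]
      have := h3 k hk
      have h4 : m.1 < k.1 → _ := h2 k hk
      split_ifs <;> omega
  rw [sharpUp, h, sharpDown]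
  simpa using shiftRow_shiftRow_neg i ((argmax i v).max' (argmax_nonempty i v)) (-1) v

lemma sharpAct_zero (i : Fin n) (v : Bsharp n) : sharpAct i 0 v = v := by
  funext p
  have hp : p.1.1.1 < p.1.2.1 := p.2
  unfold sharpAct
  split_ifs with h1 h2
  · have := congrArg Fin.val h1
    rw [Fin.val_castSucc] at this
    rw [betaCoeff_eq i 0 v (by omega), tropSum_zero _ _ _ p.1.1.1]
    ring
  · have := congrArg Fin.val h2
    rw [Fin.val_succ] at this
    rw [betaCoeff_eq i 0 v (by omega), tropSum_zero _ _ _ p.1.1.1]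
    ring
  · rfl

/-- The explicit action is additive in `β`. -/
lemma sharpUp_sharpAct (i : Fin n) (β : ℤ) (v : Bsharp n) :
    sharpUp i (sharpAct i β v) = sharpAct i (β + 1) v := by
  obtain ⟨h1, h2, h3⟩ := min_argmax_spec i (sharpAct i β v)
  rw [sharpUp]
  set m := (argmax i (sharpAct i β v)).min' (argmax_nonempty i _) with hm
  have hmi : m.1 ≤ i.1 := h1
  have hS : ∀ k ≤ i.1 + 1, _ := fun k hk =>
    tropSum_succ (bSum v i) i β m hmi (fun k hk => by
      have := h2 ⟨k, by omega⟩ hk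
      rw [bSum_sharpAct i β v (by change k ≤ _; omega), bSum_sharpAct i β v hmi] at this
      change bSum v i k - tropSum (bSum v i) i β (k + 1) - tropSum (bSum v i) i β k + _ < _ at this
      omega) (fun k hk => by
      have := h3 ⟨k, by omega⟩ hk
      rw [bSum_sharpAct i β v hk, bSum_sharpAct i β v hmi] at this
      change bSum v i k - tropSum (bSum v i) i β (k + 1) - tropSum (bSum v i) i β k + _ ≤ _ at this
      omega) (k := k) hk
  have hβ : ∀ k ≤ i.1, betaCoeff i (β + 1) v k = betaCoeff i β v k + if k = m then 1 else 0 := by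
    intro k hk
    rw [betaCoeff_eq i _ v hk, betaCoeff_eq i _ v hk, hS _ (by omega), hS _ (by omega)]
    split_ifs <;> omega
  funext p
  obtain ⟨⟨a, b⟩, hp⟩ := p
  have hp' : a.1 < b.1 := hp
  simp only [shiftRow, sharpAct, Prod.mk.injEq]
  by_cases hb : b = i.castSucc
  · have hb' : b.1 = i.1 := by rw [hb]; rfl
    have hne : ¬ b = i.succ := fun h => by rw [h, Fin.val_succ] at hb'; omega
    rw [hβ a.1 (by omega)]
    simp only [hb, if_true, and_true]
    have hne' : ¬ i.castSucc = i.succ := fun h => hne (hb.trans h)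
    have hiff : a = m.castSucc ↔ a.1 = m.1 := by rw [Fin.ext_iff]; rfl
    simp only [hne', and_false, if_false, hiff]
    split_ifs <;> ring
  · by_cases hb2 : b = i.succ
    · have hb' : b.1 = i.1 + 1 := by rw [hb2]; rfl
      rw [hβ a.1 (by omega)]
      have hiff : a = m.castSucc ↔ a.1 = m.1 := by rw [Fin.ext_iff]; rfl
      have hne' : ¬ i.succ = i.castSucc := fun h => hb (hb2.trans h)
      simp only [hb2, hne', and_false, and_true, if_true, if_false, hiff]
      split_ifs <;> ring
    · simp [hb, hb2]

lemma sharpDown_sharpAct (i : Fin n) (β : ℤ) (v : Bsharp n) :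
    sharpDown i (sharpAct i β v) = sharpAct i (β - 1) v := by
  have h := sharpUp_sharpAct i (β - 1) v
  rw [sub_add_cancel] at h
  rw [← h, sharpDown_sharpUp]

lemma triplet_e_eq (i : Fin n) (β : ℤ) (v : Bsharp n) :
    (sharpCrystal n).triplet.e i β v = sharpAct i β v := by
  have hup : ∀ m : ℕ, (sharpUp i)^[m] v = sharpAct i m v := by
    intro m
    induction m with
    | zero => simpa using (sharpAct_zero i v).symm
    | succ m ih =>
      rw [Function.iterate_succ_apply', ih, sharpUp_sharpAct]
      push_cast
      rfl
  have hdown : ∀ m : ℕ, (sharpDown i)^[m] v = sharpAct i (-m) v := by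
    intro m
    induction m with
    | zero => simpa using (sharpAct_zero i v).symm
    | succ m ih =>
      rw [Function.iterate_succ_apply', ih, sharpDown_sharpAct]
      congr 1
      push_cast
      ring
  cases β with
  | ofNat m => exact hup m
  | negSucc m =>
    rw [Int.negSucc_eq]
    exact_mod_cast hdown (m + 1)

lemma sharpWt_shiftRow (i m : Fin n) (hm : m ≤ i) (d : ℤ) (v : Bsharp n) :
    sharpWt (shiftRow i m d v) = sharpWt v + d • simpleRoot n i := by
  have hm' : m.1 ≤ i.1 := hm
  -- the sum over `k ≤ j < l` of the entries changes only for `j = i`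
  have key : ∀ j : Fin n, (∑ p : SharpIdx n,
      if p.1.1 ≤ j.castSucc ∧ j.succ ≤ p.1.2 then shiftRow i m d v p else 0) =
      (∑ p : SharpIdx n, if p.1.1 ≤ j.castSucc ∧ j.succ ≤ p.1.2 then v p else 0) -
        if j = i then d else 0 := by
    intro j
    have hsplit : ∀ p : SharpIdx n,
        (if p.1.1 ≤ j.castSucc ∧ j.succ ≤ p.1.2 then shiftRow i m d v p else 0) =
        (if p.1.1 ≤ j.castSucc ∧ j.succ ≤ p.1.2 then v p else 0) +
        ((if p.1 = (m.castSucc, i.castSucc) then (if m ≤ j ∧ j < i then d else 0) else 0) -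
        if p = ⟨(m.castSucc, i.succ), Fin.castSucc_lt_succ_iff.mpr hm⟩ then
          (if m ≤ j ∧ j ≤ i then d else 0) else 0) := by
      rintro ⟨⟨a, b⟩, hp⟩
      have hp' : a.1 < b.1 := hp
      simp only [shiftRow, Prod.mk.injEq, Subtype.mk.injEq]
      simp only [Fin.ext_iff, Fin.le_def, Fin.lt_def, Fin.val_castSucc, Fin.val_succ]
      split_ifs <;> omega
    rw [Finset.sum_congr rfl fun p _ => hsplit p, Finset.sum_add_distrib, Finset.sum_sub_distrib,
      Finset.sum_ite_eq' Finset.univ]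
    have h1 : (∑ p : SharpIdx n, if p.1 = (m.castSucc, i.castSucc) then
        (if m ≤ j ∧ j < i then d else 0) else 0) = if m ≤ j ∧ j < i then d else 0 := by
      by_cases hmi : m < i
      · rw [Finset.sum_eq_single ⟨(m.castSucc, i.castSucc), Fin.castSucc_lt_castSucc_iff.mpr hmi⟩]
        · simp
        · intro p _ hp
          rw [if_neg fun h => hp (Subtype.ext h)]
        · simp
      · rw [if_neg fun h => hmi (h.1.trans_lt h.2)]
        simp
    rw [h1]
    simp only [Finset.mem_univ, if_true, Fin.ext_iff, Fin.le_def, Fin.lt_def]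
    split_ifs <;> omega
  rw [sharpWt, sharpWt, Finset.sum_congr rfl fun j _ => by rw [key j]]
  simp only [sub_smul, Finset.sum_sub_distrib, ite_smul, zero_smul, Finset.sum_ite_eq',
    Finset.mem_univ, if_true]
  abel

theorem isFreeCrystal_sharpCrystal (n : ℕ) : IsFreeCrystal (sharpCrystal n) := by
  refine ⟨⟨fun i b => ?_, fun i b b' h => ?_, fun i b b' h => ?_, fun i b b' => ?_,
    fun i b h => ?_⟩, fun i => ⟨⟨sharpUp i, sharpDown i, sharpDown_sharpUp i, sharpUp_sharpDown i⟩,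
      fun _ => rfl, fun _ => rfl⟩⟩
  · change ((sharpWt b i + sharpEps i b : ℤ) : WithBot ℤ) = (sharpEps i b : ℤ) + (sharpWt b i : ℤ)
    rw [← WithBot.coe_add, add_comm]
  · obtain rfl : sharpUp i b = b' := Option.some.inj h
    change sharpWt (sharpUp i b) = sharpWt b + _
    rw [sharpUp, sharpWt_shiftRow i _ (min_argmax_spec i b).1, one_smul]
  · obtain rfl : sharpDown i b = b' := Option.some.inj h
    change sharpWt (sharpDown i b) = sharpWt b - _
    rw [sharpDown, sharpWt_shiftRow i _ (max_argmax_spec i b).1, neg_one_smul, sub_eq_add_neg]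
  · change some (sharpUp i b') = some b ↔ some (sharpDown i b) = some b'
    rw [Option.some_inj, Option.some_inj]
    constructor
    · rintro rfl
      exact sharpDown_sharpUp i b'
    · rintro rfl
      exact sharpUp_sharpDown i b
  · exact absurd h (WithBot.coe_ne_bot)

end Crystal

/-! ### The monomial change of coordinates -/

section Monomial

variable {n : ℕ}

lemma entry_mk (A : TriIdx n → ℂˣ) {k j : ℕ} (h1 : k ≤ j) (h2 : j < n) :
    entry A k j = A ⟨(⟨k, h1.trans_lt h2⟩, ⟨j, h2⟩), h1⟩ := dif_pos ⟨h1, h2⟩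

lemma entry_self (A : TriIdx n → ℂˣ) (p : TriIdx n) : entry A p.1.1 p.1.2 = A p :=
  entry_mk A p.2 p.1.2.2

/-- The product of the first `k` entries of the column `j`. -/
def colProd (A : TriIdx n → ℂˣ) (k j : ℕ) : ℂˣ := ∏ l ∈ Finset.range k, entry A l j

/-- The product of the `k` entries on the diagonal that ends at the position `(k - 1, j)`. -/
def diagProd (a : TriIdx n → ℂˣ) (k j : ℕ) : ℂˣ :=
  ∏ l ∈ Finset.range k, entry a (k - 1 - l) (j - l)

/-- For `j = 0` the truncated index `j - 1` does no harm, since then `k = 0` and the denominator is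
an empty product. -/
lemma entry_xiInv (A : TriIdx n → ℂˣ) {k j : ℕ} (h1 : k ≤ j) (h2 : j < n) :
    entry (xiInv A) k j = colProd A (k + 1) j / colProd A k (j - 1) := entry_mk _ h1 h2

lemma entry_xi (a : TriIdx n → ℂˣ) {k j : ℕ} (h1 : k ≤ j) (h2 : j < n) :
    entry (xi a) k j = diagProd a (k + 1) j / diagProd a k j := by
  rw [entry_mk _ h1 h2]
  unfold xi diagProd
  refine congrArg₂ (· / ·) rfl (Finset.prod_congr rfl fun l _ => ?_)
  congr 1
  change k - (l + 1) = _
  omega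

lemma xi_xiInv (A : TriIdx n → ℂˣ) : xi (xiInv A) = A := by
  funext p
  obtain ⟨⟨⟨k, hk⟩, ⟨j, hj⟩⟩, hkj⟩ := p
  have hkj' : k ≤ j := hkj
  have h1 : ∀ l ∈ Finset.range (k + 1), entry (xiInv A) (k - l) (j - l) =
      colProd A (k + 1 - l) (j - l) / colProd A (k + 1 - (l + 1)) (j - (l + 1)) := by
    intro l hl
    rw [Finset.mem_range] at hl
    rw [entry_xiInv A (by omega) (by omega), show k - l + 1 = k + 1 - l by omega,
      show k + 1 - (l + 1) = k - l by omega, show j - (l + 1) = j - l - 1 by omega]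
  have h2 : ∀ l ∈ Finset.range k, entry (xiInv A) (k - (l + 1)) (j - l) =
      colProd A (k - l) (j - l) / colProd A (k - (l + 1)) (j - (l + 1)) := by
    intro l hl
    rw [Finset.mem_range] at hl
    rw [entry_xiInv A (by omega) (by omega), show k - (l + 1) + 1 = k - l by omega,
      show j - (l + 1) = j - l - 1 by omega]
  change (∏ l ∈ Finset.range (k + 1), entry (xiInv A) (k - l) (j - l)) /
    (∏ l ∈ Finset.range k, entry (xiInv A) (k - (l + 1)) (j - l)) = _
  rw [Finset.prod_congr rfl h1, Finset.prod_congr rfl h2,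
    Finset.prod_range_div' (fun l => colProd A (k + 1 - l) (j - l)),
    Finset.prod_range_div' (fun l => colProd A (k - l) (j - l))]
  simp only [Nat.sub_self, Nat.sub_zero]
  rw [colProd, colProd, Finset.prod_range_succ, colProd, colProd, Finset.prod_range_zero,
    Finset.prod_range_zero, div_one, div_one, mul_div_cancel_left, entry_mk A hkj' hj]

lemma colProd_xi (a : TriIdx n → ℂˣ) {k j : ℕ} (hk : k ≤ j + 1) (hj : j < n) :
    colProd (xi a) k j = diagProd a k j := by
  have h1 : ∀ l ∈ Finset.range k, entry (xi a) l j = diagProd a (l + 1) j / diagProd a l j := by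
    intro l hl
    rw [Finset.mem_range] at hl
    exact entry_xi a (by omega) hj
  rw [colProd, Finset.prod_congr rfl h1, Finset.prod_range_div (fun l => diagProd a l j)]
  simp [diagProd]

lemma xiInv_xi (a : TriIdx n → ℂˣ) : xiInv (xi a) = a := by
  funext p
  have hp : p.1.1.1 ≤ p.1.2.1 := p.2
  have hn := p.1.2.2
  rw [← entry_self (xiInv (xi a)), entry_xiInv _ hp hn, colProd_xi _ (by omega) hn,
    colProd_xi _ (by omega) (by omega), diagProd, Finset.prod_range_succ']
  have h1 : ∀ l ∈ Finset.range p.1.1.1, entry a (p.1.1.1 + 1 - 1 - (l + 1)) (p.1.2.1 - (l + 1)) =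
      entry a (p.1.1.1 - 1 - l) (p.1.2.1 - 1 - l) := by
    intro l _
    congr 1 <;> omega
  rw [Finset.prod_congr rfl h1, diagProd, mul_div_cancel_left]
  exact entry_self a p

/-- The products of the parameters `a` along a diagonal telescope. -/
lemma prod_diagonal_xiInv (A : TriIdx n → ℂˣ) {k m : ℕ} (h : k + m < n + 1) :
    ∏ l ∈ Finset.range k, entry (xiInv A) l (l + m) = colProd A k (k + m - 1) := by
  have h1 : ∀ l ∈ Finset.range k, entry (xiInv A) l (l + m) =
      colProd A (l + 1) (l + 1 + m - 1) / colProd A l (l + m - 1) := by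
    intro l hl
    rw [Finset.mem_range] at hl
    rw [entry_xiInv A (by omega) (by omega), show l + 1 + m - 1 = l + m by omega]
  rw [Finset.prod_congr rfl h1, Finset.prod_range_div (fun l => colProd A l (l + m - 1))]
  simp [colProd]

/-- Multiplication of the columns `i - 1` and `i` by the successive quotients of `d` and by their
inverses. -/
def scaleCols (i : ℕ) (d : ℕ → ℂˣ) (A : TriIdx n → ℂˣ) : TriIdx n → ℂˣ := fun p =>
  A p * if p.1.2.1 + 1 = i then d (p.1.1 + 1) / d p.1.1
    else if p.1.2.1 = i then d p.1.1 / d (p.1.1 + 1) else 1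

lemma colProd_scaleCols (i : ℕ) {d : ℕ → ℂˣ} (hd : d 0 = 1) (A : TriIdx n → ℂˣ) {k j : ℕ}
    (hk : k ≤ j + 1) (hj : j < n) : colProd (scaleCols i d A) k j =
      colProd A k j * if j + 1 = i then d k else if j = i then (d k)⁻¹ else 1 := by
  have h1 : ∀ l ∈ Finset.range k, entry (scaleCols i d A) l j = entry A l j *
      if j + 1 = i then d (l + 1) / d l else if j = i then d l / d (l + 1) else 1 := by
    intro l hl
    rw [Finset.mem_range] at hl
    rw [entry_mk _ (by omega) hj, entry_mk _ (by omega) hj]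
    rfl
  rw [colProd, Finset.prod_congr rfl h1, Finset.prod_mul_distrib]
  refine congrArg₂ (· * ·) rfl ?_
  split_ifs with h2 h3
  · rw [Finset.prod_range_div, hd, div_one]
  · rw [Finset.prod_range_div', hd, one_div]
  · simp

/-- The effect of `e_i^c` on the factorization parameters. -/
lemma entry_xiInv_scaleCols (i : ℕ) {d : ℕ → ℂˣ} (hd : d 0 = 1) (A : TriIdx n → ℂˣ) {k j : ℕ}
    (hk : k ≤ j) (hj : j < n) : entry (xiInv (scaleCols i d A)) k j =
      entry (xiInv A) k j * if j = i then (d k * d (k + 1))⁻¹ else if j = i + 1 then d k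
        else if j + 1 = i then d (k + 1) else 1 := by
  rw [entry_xiInv _ hk hj, entry_xiInv _ hk hj, colProd_scaleCols i hd A (by omega) hj,
    colProd_scaleCols i hd A (by omega) (by omega), mul_div_mul_comm]
  refine congrArg₂ (· * ·) rfl ?_
  rcases Nat.eq_zero_or_pos k with rfl | hk0
  · simp only [hd, inv_one, ite_self, div_one, one_mul]
    split_ifs <;> first | rfl | omega
  · rw [show j - 1 + 1 = j by omega]
    split_ifs <;> first | omega | simp [div_eq_mul_inv, mul_comm]

end Monomial

/-! ### Matrix identities -/

section Mat

variable {n : ℕ}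

lemma transvection_mul_apply {m : Type*} [Fintype m] [DecidableEq m] (p q : m) (c : ℂ)
    (M : Matrix m m ℂ) (x y : m) :
    (Matrix.transvection p q c * M) x y = M x y + if x = p then c * M q y else 0 := by
  split_ifs with h
  · rw [h, Matrix.transvection_mul_apply_same]
  · rw [Matrix.transvection_mul_apply_of_ne _ _ _ _ h, add_zero]

lemma mul_transvection_apply {m : Type*} [Fintype m] [DecidableEq m] (p q : m) (c : ℂ)
    (M : Matrix m m ℂ) (x y : m) :
    (M * Matrix.transvection p q c) x y = M x y + if y = q then c * M x p else 0 := by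
  split_ifs with h
  · rw [h, Matrix.mul_transvection_apply_same]
  · rw [Matrix.mul_transvection_apply_of_ne _ _ _ _ h, add_zero]

/-- The matrix `α_i^∨(d) x_i(s / d)`: the block of the rows and columns `i`, `i + 1` has the rows
`(d, s)` and `(0, d⁻¹)`. -/
def hMat (i : Fin n) (d s : ℂ) : Matrix (Fin (n + 1)) (Fin (n + 1)) ℂ := fun x y =>
  if x = y then (if x.1 = i.1 then d else if x.1 = i.1 + 1 then d⁻¹ else 1)
  else if x.1 = i.1 ∧ y.1 = i.1 + 1 then s else 0

lemma hMat_one (i : Fin n) (s : ℂ) :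
    hMat i 1 s = Matrix.transvection i.castSucc i.succ s := by
  ext x y
  simp only [hMat, Matrix.transvection, Matrix.add_apply, Matrix.one_apply, Matrix.single_apply,
    Fin.ext_iff, Fin.val_castSucc, Fin.val_succ]
  split_ifs <;> first | omega | simp

/-- The matrix `hMat i d s` moves past `y_j(a)`: only `d` changes, and only for `j = i`, while `a`
is rescaled. -/
lemma hMat_mul_y (i j : Fin n) {d d' s a : ℂ} (hd : d ≠ 0) (hd' : d' ≠ 0)
    (h : d' = d + if j = i then s * a else 0) :
    hMat i d s * Matrix.transvection j.succ j.castSucc a =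
      Matrix.transvection j.succ j.castSucc
        (a * if j.1 = i.1 then (d * d')⁻¹ else if j.1 = i.1 + 1 then d
          else if j.1 + 1 = i.1 then d' else 1) * hMat i d' s := by
  ext x y
  rw [transvection_mul_apply, mul_transvection_apply]
  simp only [hMat, Fin.ext_iff, Fin.val_castSucc, Fin.val_succ] at h ⊢
  rcases lt_trichotomy j.1 i.1 with hji | hji | hji
  · have hne : j.1 ≠ i.1 := hji.ne
    rw [if_neg hne, add_zero] at h
    subst h
    simp only [hne, if_false, show ¬ j.1 = i.1 + 1 by omega, show ¬ j.1 + 1 = i.1 + 1 by omega,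
      false_and, and_false]
    split_ifs <;> first | omega | (field_simp; done) | ring
  · rw [if_pos hji] at h
    simp only [hji]
    simp only [if_true, true_and, and_true, show ¬ i.1 + 1 = i.1 by omega,
      show ¬ i.1 = i.1 + 1 by omega, if_false]
    have h1 : d⁻¹ = d'⁻¹ + a * (d * d')⁻¹ * s := by
      field_simp
      rw [h]
      ring
    have h2 : a * d⁻¹ = a * (d * d')⁻¹ * d' := by field_simp
    split_ifs <;> first | omega | linear_combination -h | linear_combination h1 |
      linear_combination h2 | ring
  · have hne : j.1 ≠ i.1 := hji.ne'
    rw [if_neg hne, add_zero] at h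
    subst h
    simp only [hne, if_false, show ¬ j.1 + 1 = i.1 by omega, show ¬ j.1 + 1 = i.1 + 1 by omega,
      false_and, and_false]
    split_ifs <;> first | omega | (field_simp; done) | ring

end Mat

section Action

variable {n : ℕ}

lemma hMat_eq (i : Fin n) (d s : ℂ) : hMat i d s =
    Matrix.diagonal (fun x : Fin (n + 1) =>
      if x.1 = i.1 then d else if x.1 = i.1 + 1 then d⁻¹ else 1) +
      Matrix.single i.castSucc i.succ s := by
  ext x y
  simp only [hMat, Matrix.add_apply, Matrix.diagonal_apply, Matrix.single_apply, Fin.ext_iff,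
    Fin.val_castSucc, Fin.val_succ, eq_comm (a := i.1), eq_comm (a := i.1 + 1)]
  split_ifs <;> first | omega | simp

lemma mul_hMat_apply (i : Fin n) (d s : ℂ) (M : Matrix (Fin (n + 1)) (Fin (n + 1)) ℂ)
    (x y : Fin (n + 1)) : (M * hMat i d s) x y =
      M x y * (if y.1 = i.1 then d else if y.1 = i.1 + 1 then d⁻¹ else 1) +
        if y = i.succ then M x i.castSucc * s else 0 := by
  rw [hMat_eq, mul_add, Matrix.add_apply, Matrix.mul_diagonal]
  congr 1
  split_ifs with h
  · rw [h, Matrix.mul_single_apply_same]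
  · rw [Matrix.mul_single_apply_of_ne _ _ _ _ _ h]

lemma hMat_upper (i : Fin n) (d s : ℂ) (x y : Fin (n + 1)) (h : y < x) : hMat i d s x y = 0 := by
  have h' : y.1 < x.1 := h
  rw [hMat, if_neg h.ne', if_neg (by omega)]

lemma hMat_mul_inv (i : Fin n) {d : ℂ} (hd : d ≠ 0) (s : ℂ) :
    hMat i d⁻¹ (-s) * hMat i d s = 1 := by
  ext x y
  rw [mul_hMat_apply]
  simp only [hMat, Matrix.one_apply, Fin.ext_iff, Fin.val_castSucc, Fin.val_succ]
  split_ifs <;> first | omega | simp [hd, mul_comm]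

/-! ### Gauss decomposition -/

/-- A lower unitriangular matrix as an element of `U⁻`. -/
def UMinus.mk (M : Matrix (Fin (n + 1)) (Fin (n + 1)) ℂ)
    (h : ∀ j k, j ≤ k → M j k = (1 : Matrix (Fin (n + 1)) (Fin (n + 1)) ℂ) j k) : UMinus n :=
  ⟨⟨M, by
    rw [Matrix.det_of_isLowerTriangular M fun j k hjk => by
      have hjk' : j < k := hjk
      rw [h j k hjk'.le, Matrix.one_apply_ne hjk'.ne]]
    exact Finset.prod_eq_one fun j _ => by rw [h j j le_rfl, Matrix.one_apply_eq]⟩, h⟩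

lemma UMinus.apply_self (u : UMinus n) (j : Fin (n + 1)) : u.1.1 j j = 1 := by
  rw [u.2 j j le_rfl, Matrix.one_apply_eq]

lemma UMinus.apply_of_lt (u : UMinus n) {j k : Fin (n + 1)} (h : j < k) : u.1.1 j k = 0 := by
  rw [u.2 j k h.le, Matrix.one_apply_ne h.ne]

lemma UMinus.ext_matrix {u v : UMinus n} (h : u.1.1 = v.1.1) : u = v :=
  Subtype.ext (Subtype.ext h)

/-- The embedding of `U⁻` into the matrix algebra. -/
def UMinus.toMat : UMinus n →* Matrix (Fin (n + 1)) (Fin (n + 1)) ℂ where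
  toFun u := u.1.1
  map_one' := rfl
  map_mul' _ _ := rfl

/-- Uniqueness of the Gauss decomposition. -/
lemma gauss_unique {v v' : UMinus n} {b b' : Matrix (Fin (n + 1)) (Fin (n + 1)) ℂ}
    (hb : ∀ j k, k < j → b j k = 0) (hb' : ∀ j k, k < j → b' j k = 0) (hdet : b.det ≠ 0)
    (h : v.1.1 * b = v'.1.1 * b') : v = v' := by
  have hdiag : ∀ k, b k k ≠ 0 := by
    rw [Matrix.det_of_isUpperTriangular fun j k hjk => hb j k hjk] at hdet
    exact fun k => Finset.prod_ne_zero_iff.mp hdet k (Finset.mem_univ k)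
  have hinv : (v'⁻¹).1.1 * v'.1.1 = 1 := congrArg UMinus.toMat (inv_mul_cancel v')
  have hw : (v'⁻¹ * v).1.1 * b = b' := by
    change ((v'⁻¹).1.1 * v.1.1) * b = b'
    rw [mul_assoc, h, ← mul_assoc, hinv, one_mul]
  set w := v'⁻¹ * v with hwdef
  have key : ∀ k j : Fin (n + 1), k < j → w.1.1 j k = 0 := by
    intro k
    induction k using WellFoundedLT.induction with
    | ind k ih =>
      intro j hkj
      have h1 := congrFun (congrFun hw j) k
      rw [hb' j k hkj, Matrix.mul_apply, Finset.sum_eq_single k] at h1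
      · exact (mul_eq_zero.mp h1).resolve_right (hdiag k)
      · intro l _ hl
        rcases lt_or_gt_of_ne hl with hl | hl
        · rw [ih l hl j (hl.trans hkj), zero_mul]
        · rw [hb l k hl, mul_zero]
      · simp
  have hw1 : w = 1 := by
    refine UMinus.ext_matrix (Matrix.ext fun j k => ?_)
    change w.1.1 j k = (1 : Matrix (Fin (n + 1)) (Fin (n + 1)) ℂ) j k
    rcases le_or_gt j k with hjk | hjk
    · exact w.2 j k hjk
    · rw [key k j hjk, Matrix.one_apply_ne hjk.ne']
  rw [hwdef, inv_mul_eq_one] at hw1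
  exact hw1.symm

/-- By uniqueness of the Gauss decomposition, `π⁻⁻` takes the value read off from any of them. -/
lemma piMM_eq_some {g : G n} {v : UMinus n} {b : Matrix (Fin (n + 1)) (Fin (n + 1)) ℂ}
    (hb : ∀ j k, k < j → b j k = 0) (h : g.1 = v.1.1 * b) : piMM g = Part.some v := by
  have hdet : b.det = 1 := by
    have h1 := congrArg Matrix.det h
    rw [Matrix.det_mul, v.1.2, one_mul, g.2] at h1
    exact h1.symm
  have hex : ∃ v : UMinus n, ∃ b : G n, (∀ j k, k < j → b.1 j k = 0) ∧ g = v.1 * b :=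
    ⟨v, ⟨b, hdet⟩, hb, Subtype.ext h⟩
  refine Part.eq_some_iff.mpr ⟨hex, ?_⟩
  obtain ⟨b', hb', hg⟩ := hex.choose_spec
  refine gauss_unique (b := b'.1) (b' := b) hb' hb (by rw [b'.2]; exact one_ne_zero) ?_
  rw [← h]
  exact (congrArg (fun g : G n => g.1) hg).symm

lemma chi_e_eq_some {i : Fin n} {c : ℂˣ} {u v : UMinus n} {d : ℂ} (hφ : phi i u ≠ 0)
    (h : hMat i 1 (((c : ℂ) - 1) / phi i u) * u.1.1 = v.1.1 * hMat i d (((c : ℂ) - 1) / phi i u)) :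
    (chiUMinus n).e i (c, u) = Part.some v := by
  change Part.assert (phi i u ≠ 0) _ = _
  rw [Part.assert_pos hφ]
  refine piMM_eq_some (hMat_upper i d (((c : ℂ) - 1) / phi i u)) ?_
  rw [← h, hMat_one]
  rfl

/-- The matrix of `e_i^c(u)`. -/
def eMat (i : Fin n) (c : ℂ) (M : Matrix (Fin (n + 1)) (Fin (n + 1)) ℂ) :
    Matrix (Fin (n + 1)) (Fin (n + 1)) ℂ :=
  hMat i 1 ((c - 1) / M i.succ i.castSucc) * M * hMat i c⁻¹ (-((c - 1) / M i.succ i.castSucc))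

/-- The choice of `s = (c - 1) / φ_i` and of the upper triangular factor on the right makes
`eMat i c u` lower unitriangular. -/
lemma eMat_apply_of_le {i : Fin n} {c : ℂ} (hc : c ≠ 0) {u : UMinus n} (hφ : phi i u ≠ 0)
    (j k : Fin (n + 1)) (hjk : j ≤ k) :
    eMat i c u.1.1 j k = (1 : Matrix (Fin (n + 1)) (Fin (n + 1)) ℂ) j k := by
  change u.1.1 i.succ i.castSucc ≠ 0 at hφ
  have hjk' : j.1 ≤ k.1 := hjk
  have hs : (c - 1) / u.1.1 i.succ i.castSucc * u.1.1 i.succ i.castSucc = c - 1 :=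
    div_mul_cancel₀ _ hφ
  unfold eMat
  set s := (c - 1) / u.1.1 i.succ i.castSucc
  rw [hMat_one, mul_hMat_apply, transvection_mul_apply, transvection_mul_apply, u.2 j k hjk]
  by_cases hki : k = i.succ
  · subst hki
    rw [u.2 i.succ i.succ le_rfl]
    by_cases hj : j = i.castSucc
    · subst hj
      rw [u.2 i.castSucc i.castSucc le_rfl, hs]
      simp [Fin.ext_iff]
      ring
    · by_cases hj2 : j = i.succ
      · subst hj2
        simp [Fin.ext_iff]
        linear_combination -hs
      · have h1 : j.1 ≠ i.1 := fun h => hj (Fin.ext h)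
        have h2 : j.1 ≠ i.1 + 1 := fun h => hj2 (Fin.ext h)
        rw [Fin.val_succ] at hjk'
        rw [UMinus.apply_of_lt u (show j < i.castSucc by rw [Fin.lt_def, Fin.val_castSucc]; omega)]
        simp [hj, hj2]
  · have h3 : k.1 ≠ i.1 + 1 := fun h => hki (Fin.ext h)
    rw [if_neg hki, add_zero, if_neg h3]
    by_cases hk : k = i.castSucc
    · subst hk
      by_cases hj : j = i.castSucc
      · subst hj
        rw [hs]
        simp [hc]
      · simp [hj]
    · have h4 : k.1 ≠ i.1 := fun h => hk (Fin.ext h)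
      rw [if_neg h4, mul_one]
      split_ifs with hj
      · subst hj
        rw [Fin.val_castSucc] at hjk'
        rw [UMinus.apply_of_lt u (show i.succ < k by rw [Fin.lt_def, Fin.val_succ]; omega),
          mul_zero, add_zero]
      · rw [add_zero]

/-- The point `e_i^c(u)`. -/
def eMinus (i : Fin n) (c : ℂˣ) (u : UMinus n) (hφ : phi i u ≠ 0) : UMinus n :=
  UMinus.mk (eMat i c u.1.1) (eMat_apply_of_le c.ne_zero hφ)

lemma eMinus_mul_hMat (i : Fin n) (c : ℂˣ) (u : UMinus n) (hφ : phi i u ≠ 0) :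
    hMat i 1 (((c : ℂ) - 1) / phi i u) * u.1.1 =
      (eMinus i c u hφ).1.1 * hMat i c (((c : ℂ) - 1) / phi i u) := by
  change _ = hMat i 1 (((c : ℂ) - 1) / phi i u) * u.1.1 *
    hMat i (c : ℂ)⁻¹ (-(((c : ℂ) - 1) / phi i u)) * hMat i c (((c : ℂ) - 1) / phi i u)
  rw [mul_assoc _ (hMat i (c : ℂ)⁻¹ _), hMat_mul_inv i c.ne_zero, mul_one]

lemma chi_e_eq (i : Fin n) (c : ℂˣ) (u : UMinus n) (hφ : phi i u ≠ 0) :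
    (chiUMinus n).e i (c, u) = Part.some (eMinus i c u hφ) :=
  chi_e_eq_some hφ (eMinus_mul_hMat i c u hφ)

/-! ### The factorization map and the action on it -/

lemma hom_telescope_reverse {M : Type*} [Monoid M] (n : ℕ) (H : ℕ → M) (g g' : Fin n → M)
    (h : ∀ j : Fin n, H (j + 1) * g j = g' j * H j) :
    H n * ((List.finRange n).reverse.map g).prod =
      ((List.finRange n).reverse.map g').prod * H 0 := by
  induction n generalizing H with
  | zero => simp
  | succ n ih =>
    have h1 := ih (fun k => H (k + 1)) (fun j => g j.succ) (fun j => g' j.succ) fun j => h j.succ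
    have h0 := h 0
    simp only [List.finRange_succ, List.reverse_cons, List.map_append, List.map_reverse,
      List.map_map, List.map_cons, List.map_nil, List.prod_append, List.prod_cons, List.prod_nil,
      mul_one, zero_add, Fin.val_zero] at h1 h0 ⊢
    rw [← mul_assoc]
    refine (congrArg (· * g 0) h1).trans ?_
    rw [mul_assoc, h0, mul_assoc]
    rfl

/-- If `H j` turns into `H (j + 1)` on its way past the `j`-th factor, then `H 0` turns into `H n`
on its way past the product. -/
lemma hom_telescope {M : Type*} [Monoid M] (n : ℕ) (H : ℕ → M) (g g' : Fin n → M)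
    (h : ∀ j : Fin n, H j * g j = g' j * H (j + 1)) :
    H 0 * ((List.finRange n).map g).prod = ((List.finRange n).map g').prod * H n := by
  induction n generalizing H with
  | zero => simp
  | succ n ih =>
    have h1 := ih (fun k => H (k + 1)) (fun j => g j.succ) (fun j => g' j.succ) fun j => h j.succ
    have h0 := h 0
    simp only [List.finRange_succ, List.map_cons, List.prod_cons, List.map_map, Fin.val_zero,
      zero_add] at h1 h0 ⊢
    rw [← mul_assoc, h0, mul_assoc]
    refine (congrArg (g' 0 * ·) h1).trans ?_
    rw [mul_assoc]
    rfl

/-- The entry `a_{k,j}` as a complex number, and `0` if there is no such entry. -/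
def entryC (a : TriIdx n → ℂˣ) (k j : ℕ) : ℂ :=
  if k ≤ j ∧ j < n then (entry a k j : ℂ) else 0

/-- The factor `y_n(a_{k,n}) ⋯ y_k(a_{k,k})` of `θ(a)` as a matrix. -/
def rowMat (a : TriIdx n → ℂˣ) (k : ℕ) : Matrix (Fin (n + 1)) (Fin (n + 1)) ℂ :=
  ((List.finRange n).reverse.map fun j : Fin n =>
    Matrix.transvection j.succ j.castSucc (entryC a k j)).prod

lemma theta_eq_prod (a : TriIdx n → ℂˣ) :
    (theta a).1.1 = ((List.finRange n).map fun k => rowMat a k.1).prod := by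
  change UMinus.toMat (theta a) = _
  rw [theta, map_list_prod, List.map_map]
  congr 2
  funext k
  simp only [Function.comp]
  rw [map_list_prod, List.map_map, rowMat]
  congr 2
  funext j
  simp only [Function.comp]
  by_cases h : k ≤ j
  · have h' : k.1 ≤ j.1 := h
    rw [dif_pos h, entryC, if_pos ⟨h', j.2⟩, entry_mk a h' j.2]
    rfl
  · have h' : ¬ k.1 ≤ j.1 := h
    rw [dif_neg h, entryC, if_neg fun h1 => h' h1.1, Matrix.transvection_zero]
    exact map_one _

/-- `x_i(s)` is moved through `θ(a)`; it picks up torus factors `α_i^∨(d_k)` on its way past the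
rows of `a`. -/
lemma hMat_mul_theta (i : Fin n) (a a' : TriIdx n → ℂˣ) (s : ℂ) (d : ℕ → ℂˣ) (hd0 : d 0 = 1)
    (hd : ∀ k < n, (d (k + 1) : ℂ) = d k + s * entryC a k i)
    (ha' : ∀ k j : ℕ, k ≤ j → j < n → entry a' k j =
      entry a k j * if j = i then (d k * d (k + 1))⁻¹ else if j = i + 1 then d k
        else if j + 1 = i then d (k + 1) else 1) :
    hMat i 1 s * (theta a).1.1 = (theta a').1.1 * hMat i (d n) s := by
  rw [theta_eq_prod, theta_eq_prod]
  have h := hom_telescope n (fun k => hMat i (d k : ℂ) s) (fun k => rowMat a k.1)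
    (fun k => rowMat a' k.1) fun k => ?_
  · simpa [hd0] using h
  · have hk := hd k.1 k.2
    have h1 := hom_telescope_reverse n
      (fun m => hMat i (if i.1 < m then (d k : ℂ) else d (k.1 + 1)) s)
      (fun j : Fin n => Matrix.transvection j.succ j.castSucc (entryC a k j))
      (fun j : Fin n => Matrix.transvection j.succ j.castSucc (entryC a' k j)) fun j => ?_
    · simpa [rowMat] using h1
    · have hne : ∀ m, (if i.1 < m then (d k.1 : ℂ) else d (k.1 + 1)) ≠ 0 := by
        intro m
        split_ifs
        · exact (d k.1).ne_zero
        · exact (d (k.1 + 1)).ne_zero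
      rw [hMat_mul_y i j (hne _) (hne j) (a := entryC a k j)]
      · congr 2
        unfold entryC
        by_cases hkj : k.1 ≤ j.1 ∧ j.1 < n
        · rw [if_pos hkj, if_pos hkj, ha' k j hkj.1 hkj.2]
          split_ifs <;> first | omega | simp
        · rw [if_neg hkj, if_neg hkj, zero_mul]
      · by_cases hji : j = i
        · subst hji
          simpa using hk
        · have hji' : j.1 ≠ i.1 := fun h => hji (Fin.ext h)
          rw [if_neg hji, add_zero]
          split_ifs <;> first | omega | rfl

lemma phi_mul (i : Fin n) (u v : UMinus n) : phi i (u * v) = phi i u + phi i v := by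
  change (u.1.1 * v.1.1) i.succ i.castSucc = u.1.1 i.succ i.castSucc + v.1.1 i.succ i.castSucc
  have hne : i.castSucc ≠ i.succ := Fin.castSucc_lt_succ.ne
  rw [Matrix.mul_apply, ← Finset.sum_subset (Finset.subset_univ {i.castSucc, i.succ}),
    Finset.sum_pair hne, UMinus.apply_self, UMinus.apply_self, mul_one, one_mul]
  intro l _ hl
  simp only [Finset.mem_insert, Finset.mem_singleton, not_or, Fin.ext_iff, Fin.val_castSucc,
    Fin.val_succ] at hl
  rcases lt_or_ge l.1 i.1 with h | h
  · rw [UMinus.apply_of_lt v (show l < i.castSucc from h), mul_zero]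
  · rw [UMinus.apply_of_lt u (show i.succ < l by rw [Fin.lt_def, Fin.val_succ]; omega), zero_mul]

lemma phi_one (i : Fin n) : phi i (1 : UMinus n) = 0 :=
  Matrix.one_apply_ne Fin.castSucc_lt_succ.ne'

lemma phi_list_prod (i : Fin n) (l : List (UMinus n)) : phi i l.prod = (l.map (phi i)).sum := by
  induction l with
  | nil => exact phi_one i
  | cons u l ih => rw [List.prod_cons, phi_mul, ih, List.map_cons, List.sum_cons]

lemma phi_yMinus (i j : Fin n) (t : ℂ) : phi i (yMinus j t) = if j = i then t else 0 := by
  change Matrix.transvection j.succ j.castSucc t i.succ i.castSucc = _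
  have hne : i.succ ≠ i.castSucc := Fin.castSucc_lt_succ.ne'
  simp [Matrix.transvection, Matrix.single_apply, Matrix.one_apply_ne hne]

lemma phi_theta (i : Fin n) (a : TriIdx n → ℂˣ) :
    phi i (theta a) = ∑ k ∈ Finset.range (i + 1), (entry a k i : ℂ) := by
  rw [theta, phi_list_prod, List.map_map]
  have h1 : ∀ k : Fin n, (phi i ∘ fun k : Fin n => ((List.finRange n).reverse.map fun j =>
      if h : k ≤ j then yMinus j (a ⟨(k, j), h⟩ : ℂ) else 1).prod) k = entryC a k i := by
    intro k
    simp only [Function.comp]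
    rw [phi_list_prod, List.map_map, List.map_reverse, List.sum_reverse, ← List.ofFn_eq_map,
      List.sum_ofFn, Finset.sum_eq_single i]
    · simp only [Function.comp]
      by_cases h : k ≤ i
      · have h' : k.1 ≤ i.1 := h
        rw [dif_pos h, phi_yMinus, if_pos rfl, entryC, if_pos ⟨h', i.2⟩, entry_mk a h' i.2]
      · have h' : ¬ k.1 ≤ i.1 := h
        rw [dif_neg h, phi_one, entryC, if_neg fun h1 => h' h1.1]
    · intro j _ hj
      simp only [Function.comp]
      split_ifs
      · rw [phi_yMinus, if_neg hj]
      · exact phi_one i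
    · simp
  rw [List.map_congr_left fun k _ => h1 k, ← List.ofFn_eq_map, List.sum_ofFn,
    Fin.sum_univ_eq_sum_range (fun k => entryC a k i)]
  have hi := i.2
  refine (Finset.sum_subset (Finset.range_mono (by omega)) fun k _ hk => ?_).symm.trans
    (Finset.sum_congr rfl fun k hk => ?_)
  · rw [Finset.mem_range] at hk
    rw [entryC, if_neg (by omega)]
  · rw [Finset.mem_range] at hk
    rw [entryC, if_pos (by omega)]

/-- The sum `∑_{l ≤ i} c^{[l < k]} a_{l,i}`. -/
def shiftSum (i : ℕ) (c : ℂ) (a : TriIdx n → ℂˣ) (k : ℕ) : ℂ :=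
  ∑ l ∈ Finset.range (i + 1), (entry a l i : ℂ) * if l < k then c else 1

open Classical in
/-- The torus factor `d_k = shiftSum k / shiftSum 0` in the commutation of `x_i` with the first
`k` rows of `θ(a)`; it is `1` if the quotient vanishes. -/
def shiftUnit (i : ℕ) (c : ℂ) (a : TriIdx n → ℂˣ) (k : ℕ) : ℂˣ :=
  if h : shiftSum i c a k / shiftSum i c a 0 ≠ 0 then Units.mk0 _ h else 1

lemma shiftSum_zero (i : Fin n) (c : ℂ) (a : TriIdx n → ℂˣ) :
    shiftSum i c a 0 = phi i (theta a) := by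
  simp [shiftSum, phi_theta]

lemma shiftSum_succ (i : Fin n) (c : ℂ) (a : TriIdx n → ℂˣ) (k : ℕ) :
    shiftSum i c a (k + 1) = shiftSum i c a k + (c - 1) * entryC a k i := by
  have h : ∀ l ∈ Finset.range (i.1 + 1), (entry a l i : ℂ) * (if l < k + 1 then c else 1) =
      (entry a l i : ℂ) * (if l < k then c else 1) +
        if l = k then (c - 1) * entryC a l i else 0 := by
    intro l hl
    rw [Finset.mem_range] at hl
    have hi := i.2
    have h1 : entryC a l i = entry a l i := if_pos (by omega)
    rw [h1]
    split_ifs <;> first | omega | ring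
  rw [shiftSum, Finset.sum_congr rfl h, Finset.sum_add_distrib, Finset.sum_ite_eq', shiftSum]
  congr 1
  split_ifs with hk
  · rfl
  · rw [Finset.mem_range] at hk
    rw [entryC, if_neg (by omega), mul_zero]

lemma coe_shiftUnit {i : ℕ} {c : ℂ} {a : TriIdx n → ℂˣ} {k : ℕ} (h0 : shiftSum i c a 0 ≠ 0)
    (hk : shiftSum i c a k ≠ 0) :
    (shiftUnit i c a k : ℂ) = shiftSum i c a k / shiftSum i c a 0 := by
  rw [shiftUnit, dif_pos (div_ne_zero hk h0), Units.val_mk0]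

/-- The action of `e_i^c` on `U⁻` in the coordinates `A`. -/
lemma chi_e_theta (i : Fin n) (c : ℂˣ) (A : TriIdx n → ℂˣ)
    (h : ∀ k ≤ n, shiftSum i c (xiInv A) k ≠ 0) :
    phi i (theta (xiInv A)) ≠ 0 ∧ (chiUMinus n).e i (c, theta (xiInv A)) =
      Part.some (theta (xiInv (scaleCols i (shiftUnit i c (xiInv A)) A))) := by
  have h0 := h 0 (Nat.zero_le n)
  have hφ : phi i (theta (xiInv A)) ≠ 0 := by rwa [← shiftSum_zero i c]
  have hd : ∀ k ≤ n, (shiftUnit i c (xiInv A) k : ℂ) =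
      shiftSum i c (xiInv A) k / shiftSum i c (xiInv A) 0 := fun k hk => coe_shiftUnit h0 (h k hk)
  have hd0 : shiftUnit i c (xiInv A) 0 = 1 := by
    rw [← Units.val_inj, hd 0 (Nat.zero_le n), div_self h0, Units.val_one]
  refine ⟨hφ, chi_e_eq_some hφ (hMat_mul_theta i _ _ _ _ hd0 (fun k hk => ?_) fun k j hkj hj =>
    entry_xiInv_scaleCols i hd0 A hkj hj)⟩
  rw [hd _ (by omega), hd _ (by omega), shiftSum_succ, shiftSum_zero]
  ring

end Action

/-! ### The inverse of the factorization map -/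

section Peel

variable {n : ℕ}

/-- The row factor of `θ(a)` as an element of `U⁻`. -/
def rowU (a : TriIdx n → ℂˣ) (k : ℕ) : UMinus n :=
  ((List.finRange n).reverse.map fun j : Fin n => yMinus j (entryC a k j)).prod

lemma toMat_rowU (a : TriIdx n → ℂˣ) (k : ℕ) : UMinus.toMat (rowU a k) = rowMat a k := by
  rw [rowU, map_list_prod, List.map_map, rowMat]
  rfl

/-- The product of the row factors of `θ(a)` from the row `k` on. -/
def tailU (a : TriIdx n → ℂˣ) (k : ℕ) : UMinus n :=
  (((List.finRange n).drop k).map fun l : Fin n => rowU a l).prod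

lemma tailU_zero (a : TriIdx n → ℂˣ) : tailU a 0 = theta a := by
  refine UMinus.ext_matrix ?_
  rw [theta_eq_prod]
  change UMinus.toMat (tailU a 0) = _
  rw [tailU, map_list_prod, List.map_map, List.drop_zero]
  congr 2
  funext k
  exact toMat_rowU a k

lemma tailU_last (a : TriIdx n → ℂˣ) : tailU a n = 1 := by
  rw [tailU, List.drop_of_length_le (by simp), List.map_nil, List.prod_nil]

lemma tailU_eq_mul (a : TriIdx n → ℂˣ) {k : ℕ} (hk : k < n) :
    tailU a k = rowU a k * tailU a (k + 1) := by
  rw [tailU, List.drop_eq_getElem_cons (by simpa using hk), List.map_cons, List.prod_cons, tailU]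
  simp

/-- The inverse of the row factor. -/
def rowInv (a : TriIdx n → ℂˣ) (k : ℕ) : Matrix (Fin (n + 1)) (Fin (n + 1)) ℂ :=
  1 + ∑ j : Fin n, Matrix.single j.succ j.castSucc (-entryC a k j)

lemma list_prod_mul_reverse {M κ : Type*} [Monoid M] (f g : κ → M) (h : ∀ j, f j * g j = 1)
    (L : List κ) : (L.map f).prod * (L.reverse.map g).prod = 1 := by
  induction L with
  | nil => simp
  | cons j L ih =>
    rw [List.map_cons, List.prod_cons, List.reverse_cons, List.map_append, List.prod_append,
      mul_assoc, ← mul_assoc (L.map f).prod, ih, one_mul]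
    simpa using h j

lemma prod_transvection_sorted (g : Fin n → ℂ) (L : List (Fin n)) (hL : L.Pairwise (· < ·)) :
    (L.map fun j => Matrix.transvection j.succ j.castSucc (g j)).prod =
      1 + (L.map fun j => Matrix.single j.succ j.castSucc (g j)).sum := by
  induction L with
  | nil => simp
  | cons j L ih =>
    rw [List.pairwise_cons] at hL
    rw [List.map_cons, List.prod_cons, ih hL.2, List.map_cons, List.sum_cons, Matrix.transvection]
    have h : Matrix.single j.succ j.castSucc (g j) *
        (L.map fun j => Matrix.single j.succ j.castSucc (g j)).sum = 0 := by
      rw [← List.sum_map_mul_left]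
      refine List.sum_eq_zero fun M hM => ?_
      obtain ⟨l, hl, rfl⟩ := List.mem_map.mp hM
      apply Matrix.single_mul_single_of_ne
      intro h
      have h1 : j.1 < l.1 := hL.1 l hl
      have h2 := congrArg Fin.val h
      rw [Fin.val_castSucc, Fin.val_succ] at h2
      omega
    rw [add_mul, one_mul, mul_add, h, mul_one, add_zero]
    abel

lemma rowInv_mul_rowMat (a : TriIdx n → ℂˣ) (k : ℕ) : rowInv a k * rowMat a k = 1 := by
  have h : rowInv a k = ((List.finRange n).map fun j : Fin n =>
      Matrix.transvection j.succ j.castSucc (-entryC a k j)).prod := by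
    rw [prod_transvection_sorted (fun j : Fin n => -entryC a k j) _ (List.pairwise_lt_finRange n),
      rowInv, ← List.ofFn_eq_map, List.sum_ofFn]
  rw [h, rowMat]
  refine list_prod_mul_reverse _ _ (fun j => ?_) _
  rw [Matrix.transvection_mul_transvection_same _ _ Fin.castSucc_lt_succ.ne', neg_add_cancel,
    Matrix.transvection_zero]

lemma rowInv_mul_apply_succ (a : TriIdx n → ℂˣ) (k : ℕ)
    (M : Matrix (Fin (n + 1)) (Fin (n + 1)) ℂ) (j : Fin n) (q : Fin (n + 1)) :
    (rowInv a k * M) j.succ q = M j.succ q - entryC a k j * M j.castSucc q := by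
  rw [rowInv, add_mul, one_mul, Finset.sum_mul, Matrix.add_apply, Matrix.sum_apply,
    Finset.sum_eq_single j]
  · rw [Matrix.single_mul_apply_same]
    ring
  · intro l _ hl
    rw [Matrix.single_mul_apply_of_ne]
    simpa [eq_comm] using hl
  · simp

lemma rowInv_mul_apply_zero (a : TriIdx n → ℂˣ) (k : ℕ)
    (M : Matrix (Fin (n + 1)) (Fin (n + 1)) ℂ) (q : Fin (n + 1)) :
    (rowInv a k * M) 0 q = M 0 q := by
  rw [rowInv, add_mul, one_mul, Finset.sum_mul, Matrix.add_apply, Matrix.sum_apply,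
    Finset.sum_eq_zero, add_zero]
  intro l _
  rw [Matrix.single_mul_apply_of_ne]
  exact (Fin.succ_ne_zero l).symm

lemma rowInv_mul_tailU (a : TriIdx n → ℂˣ) {k : ℕ} (hk : k < n) :
    rowInv a k * (tailU a k).1.1 = (tailU a (k + 1)).1.1 := by
  rw [tailU_eq_mul a hk]
  change rowInv a k * ((rowU a k).1.1 * (tailU a (k + 1)).1.1) = _
  rw [← mul_assoc]
  change rowInv a k * UMinus.toMat (rowU a k) * _ = _
  rw [toMat_rowU, rowInv_mul_rowMat, one_mul]

/-- The matrices that fix the first `k` standard basis vectors. -/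
def fixFirst (n k : ℕ) : Submonoid (Matrix (Fin (n + 1)) (Fin (n + 1)) ℂ) where
  carrier := {M | ∀ q : Fin (n + 1), q.1 < k → ∀ p, M p q = (1 : Matrix _ _ ℂ) p q}
  one_mem' _ _ _ := rfl
  mul_mem' := by
    intro M N hM hN q hq p
    rw [Matrix.mul_apply, Finset.sum_eq_single q]
    · rw [hM q hq, hN q hq, Matrix.one_apply_eq, mul_one]
    · intro l _ hl
      rw [hN q hq, Matrix.one_apply_ne hl, mul_zero]
    · simp

lemma tailU_apply_of_lt (a : TriIdx n → ℂˣ) (k : ℕ) (p q : Fin (n + 1)) (hq : q.1 < k) :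
    (tailU a k).1.1 p q = (1 : Matrix (Fin (n + 1)) (Fin (n + 1)) ℂ) p q := by
  have h : UMinus.toMat (tailU a k) ∈ fixFirst n k := by
    rw [tailU, map_list_prod, List.map_map]
    refine Submonoid.list_prod_mem _ fun M hM => ?_
    obtain ⟨l, hl, rfl⟩ := List.mem_map.mp hM
    have hkl : k ≤ l.1 := by
      obtain ⟨m, hm, rfl⟩ := List.getElem_of_mem hl
      simp
    simp only [Function.comp]
    rw [toMat_rowU, rowMat]
    refine Submonoid.list_prod_mem _ fun M hM => ?_
    obtain ⟨j, -, rfl⟩ := List.mem_map.mp hM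
    intro q hq p
    by_cases hlj : l.1 ≤ j.1
    · rw [Matrix.transvection, Matrix.add_apply, Matrix.single_apply, if_neg, add_zero]
      rintro ⟨-, h⟩
      have := congrArg Fin.val h
      rw [Fin.val_castSucc] at this
      omega
    · rw [entryC, if_neg fun h => hlj h.1, Matrix.transvection_zero]
  exact h q hq p

lemma tailU_apply_succ (a : TriIdx n → ℂˣ) {k : ℕ} (hk : k < n) (j : Fin n) (q : Fin (n + 1)) :
    (tailU a k).1.1 j.succ q =
      (tailU a (k + 1)).1.1 j.succ q + entryC a k j * (tailU a k).1.1 j.castSucc q := by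
  rw [← rowInv_mul_tailU a hk, rowInv_mul_apply_succ]
  ring

lemma tailU_apply_col (a : TriIdx n → ℂˣ) {k : ℕ} (hk : k < n) {p : ℕ} (hkp : k ≤ p)
    (hp : p < n + 1) : (tailU a k).1.1 ⟨p, hp⟩ ⟨k, by omega⟩ =
      ∏ j ∈ Finset.Ico k p, (entry a k j : ℂ) := by
  induction p, hkp using Nat.le_induction with
  | base => rw [UMinus.apply_self, Finset.Ico_self, Finset.prod_empty]
  | succ p hkp ih =>
    have h := tailU_apply_succ a hk ⟨p, by omega⟩ ⟨k, by omega⟩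
    rw [tailU_apply_of_lt a (k + 1) _ _ (by simp), Matrix.one_apply_ne] at h
    · change (tailU a k).1.1 ⟨p + 1, hp⟩ _ = 0 + entryC a k p * (tailU a k).1.1 ⟨p, _⟩ _ at h
      rw [h, ih (by omega), Finset.prod_Ico_succ_top hkp, entryC, if_pos ⟨hkp, by omega⟩]
      ring
    · simp only [Fin.succ_mk, ne_eq, Fin.mk.injEq]
      omega

/-- The entries of a matrix, continued by zero. -/
def matN (M : Matrix (Fin (n + 1)) (Fin (n + 1)) ℂ) (p q : ℕ) : ℂ :=
  if h : p < n + 1 ∧ q < n + 1 then M ⟨p, h.1⟩ ⟨q, h.2⟩ else 0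

/-- `k` steps of the elimination that inverts `θ`: in the step `k` a multiple of the row `p - 1` is
subtracted from each row `p > k`, to the effect that the column `k` becomes that of the unit
matrix. -/
def peel (M : ℕ → ℕ → ℂ) : ℕ → ℕ → ℕ → ℂ
  | 0 => M
  | k + 1 => fun p q =>
    if k + 1 ≤ p then peel M k p q - peel M k p k / peel M k (p - 1) k * peel M k (p - 1) q
    else peel M k p q

lemma peel_zero (M : ℕ → ℕ → ℂ) : peel M 0 = M := rfl

lemma peel_succ (M : ℕ → ℕ → ℂ) (k p q : ℕ) : peel M (k + 1) p q =
    if k + 1 ≤ p then peel M k p q - peel M k p k / peel M k (p - 1) k * peel M k (p - 1) q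
    else peel M k p q := rfl

lemma peel_theta (a : TriIdx n → ℂˣ) {k : ℕ} (hk : k ≤ n) {p q : ℕ} (hp : p < n + 1)
    (hq : q < n + 1) :
    peel (matN (theta a).1.1) k p q = (tailU a k).1.1 ⟨p, hp⟩ ⟨q, hq⟩ := by
  induction k generalizing p q with
  | zero => rw [peel_zero, tailU_zero, matN, dif_pos ⟨hp, hq⟩]
  | succ k ih =>
    have hk' : k < n := by omega
    have hkk := fun {p q : ℕ} => ih (p := p) (q := q) hk'.le
    rw [peel_succ]
    split_ifs with hkp
    · obtain ⟨j, rfl⟩ : ∃ j, p = j + 1 := ⟨p - 1, by omega⟩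
      rw [Nat.add_sub_cancel, hkk hp hq, hkk hp (by omega), hkk (by omega) (by omega),
        hkk (by omega) hq, tailU_apply_col a hk' (by omega), tailU_apply_col a hk' (by omega),
        Finset.prod_Ico_succ_top (by omega), mul_div_cancel_left₀]
      · have h := tailU_apply_succ a hk' ⟨j, by omega⟩ ⟨q, hq⟩
        change (tailU a k).1.1 ⟨j + 1, hp⟩ _ = (tailU a (k + 1)).1.1 ⟨j + 1, hp⟩ _ +
          entryC a k j * (tailU a k).1.1 ⟨j, _⟩ _ at h
        rw [h, entryC, if_pos (by omega)]
        ring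
      · exact Finset.prod_ne_zero_iff.mpr fun l _ => Units.ne_zero _
    · rw [hkk hp hq, ← rowInv_mul_tailU a hk']
      cases p with
      | zero => exact (rowInv_mul_apply_zero a k _ _).symm
      | succ j =>
        refine Eq.trans ?_ (rowInv_mul_apply_succ a k _ ⟨j, by omega⟩ _).symm
        rw [entryC, if_neg (by simp only []; omega), zero_mul, sub_zero]
        rfl

/-- `θ(a)` determines `a`. -/
lemma entry_eq_peel (a : TriIdx n → ℂˣ) {k j : ℕ} (hk : k ≤ j) (hj : j < n) :
    (entry a k j : ℂ) = peel (matN (theta a).1.1) k (j + 1) k /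
      peel (matN (theta a).1.1) k j k := by
  rw [peel_theta a (by omega) (by omega) (by omega), peel_theta a (by omega) (by omega) (by omega),
    tailU_apply_col a (by omega) (by omega), tailU_apply_col a (by omega) hk,
    Finset.prod_Ico_succ_top hk, mul_div_cancel_left₀]
  exact Finset.prod_ne_zero_iff.mpr fun l _ => Units.ne_zero _

lemma theta_injective : Function.Injective (theta : (TriIdx n → ℂˣ) → UMinus n) := by
  intro a a' h
  funext p
  rw [← entry_self a, ← entry_self a', ← Units.val_inj, entry_eq_peel a p.2 p.1.2.2,
    entry_eq_peel a' p.2 p.1.2.2, h]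

/-- The elimination applied to `u` succeeds if none of the pivots vanishes; then it factorizes
`u`. -/
lemma theta_eq_of_peel (u : UMinus n) (a : TriIdx n → ℂˣ)
    (h0 : ∀ k p, k ≤ p → p < n → peel (matN u.1.1) k p k ≠ 0)
    (ha : ∀ k j, k ≤ j → j < n → (entry a k j : ℂ) =
      peel (matN u.1.1) k (j + 1) k / peel (matN u.1.1) k j k) : theta a = u := by
  have hlow : ∀ k ≤ n, (∀ p q, p ≤ q → q < n + 1 →
      peel (matN u.1.1) k p q = if p = q then 1 else 0) ∧
      ∀ q < k, ∀ p < n + 1, peel (matN u.1.1) k p q = if p = q then 1 else 0 := by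
    intro k
    induction k with
    | zero =>
      intro _
      refine ⟨fun p q hpq hq => ?_, fun q hq => absurd hq (Nat.not_lt_zero q)⟩
      rw [peel_zero, matN, dif_pos ⟨by omega, hq⟩, u.2 _ _ hpq, Matrix.one_apply]
      simp only [Fin.mk.injEq]
    | succ k ih =>
      intro hk
      obtain ⟨h1, h2⟩ := ih (by omega)
      refine ⟨fun p q hpq hq => ?_, fun q hq p hp => ?_⟩
      · rw [peel_succ]
        by_cases hkp : k + 1 ≤ p
        · rw [if_pos hkp, h1 p q hpq hq, h1 (p - 1) q (by omega) hq,
            if_neg (by omega : ¬ p - 1 = q)]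
          ring
        · rw [if_neg hkp, h1 p q hpq hq]
      · rw [peel_succ]
        by_cases hkp : k + 1 ≤ p
        · rw [if_pos hkp, if_neg (by omega)]
          rcases Nat.lt_or_ge q k with hqk | hqk
          · rw [h2 q hqk p hp, h2 q hqk (p - 1) (by omega), if_neg (by omega), if_neg (by omega)]
            ring
          · obtain rfl : q = k := by omega
            rw [div_mul_cancel₀ _ (h0 q (p - 1) (by omega) (by omega)), sub_self]
        · rw [if_neg hkp]
          rcases Nat.lt_or_ge q k with hqk | hqk
          · exact h2 q hqk p hp
          · exact h1 p q (by omega) (by omega)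
  have key : ∀ m ≤ n, ∀ p q : Fin (n + 1),
      peel (matN u.1.1) (n - m) p q = (tailU a (n - m)).1.1 p q := by
    intro m
    induction m with
    | zero =>
      intro _ p q
      have h3 : peel (matN u.1.1) n p q = if p.1 = q.1 then 1 else 0 := by
        rcases Nat.lt_or_ge q.1 n with h | h
        · exact (hlow n le_rfl).2 q h p p.2
        · exact (hlow n le_rfl).1 p q (by omega) q.2
      rw [Nat.sub_zero, h3, tailU_last]
      change _ = (1 : Matrix (Fin (n + 1)) (Fin (n + 1)) ℂ) p q
      simp only [Matrix.one_apply, Fin.ext_iff]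
    | succ m ih =>
      intro hm
      have ih' := ih (by omega)
      rw [show n - m = n - (m + 1) + 1 by omega] at ih'
      set k := n - (m + 1) with hk
      have hkn : k < n := by omega
      -- the rows are recovered from top to bottom
      rintro ⟨p, hp⟩ q
      induction p with
      | zero =>
        have h3 := ih' ⟨0, hp⟩ q
        rw [← rowInv_mul_tailU a hkn] at h3
        rw [peel_succ, if_neg (by simp)] at h3
        exact h3.trans (rowInv_mul_apply_zero a k _ q)
      | succ p ihp =>
        have h3 := ih' ⟨p + 1, hp⟩ q
        have h4 := ihp (by omega)
        have h5 := tailU_apply_succ a hkn ⟨p, by omega⟩ q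
        change (tailU a k).1.1 ⟨p + 1, hp⟩ _ = (tailU a (k + 1)).1.1 ⟨p + 1, hp⟩ _ +
          entryC a k p * (tailU a k).1.1 ⟨p, _⟩ _ at h5
        rw [h5, ← h3, peel_succ]
        simp only [Nat.add_sub_cancel] at h4 ⊢
        split_ifs with hkp
        · rw [← h4, entryC, if_pos (by omega), ha k p (by omega) (by omega)]
          ring
        · rw [entryC, if_neg (by omega)]
          ring
  refine UMinus.ext_matrix (Matrix.ext fun p q => ?_)
  have h := key n le_rfl p q
  rw [Nat.sub_self, tailU_zero, peel_zero, matN, dif_pos ⟨p.2, q.2⟩] at h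
  exact h.symm

end Peel

/-! ### The generalized minors -/

section Minor

variable {n : ℕ}

/-- The embedding of the indices of the last `i + 1` rows. -/
def lastRows (i : Fin n) (r : Fin (i + 1)) : Fin (n + 1) := ⟨n - i + r, by omega⟩

/-- The embedding of the indices of the first `i + 1` columns. -/
def firstCols (i : Fin n) (r : Fin (i + 1)) : Fin (n + 1) := ⟨r, by omega⟩

/-- The matrix coefficient `f_i` is the minor of the last `i + 1` rows and the first `i + 1`
columns. -/
lemma fCoeff_eq_det (i : Fin n) (g : G n) :
    fCoeff i g = (g.1.submatrix (lastRows i) (firstCols i)).det := by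
  rw [fCoeff, exteriorPower.map_apply_ιMulti, exteriorPower.pairingDual_ιMulti_ιMulti,
    ← Matrix.det_transpose]
  congr 1
  ext r s
  simp only [Matrix.transpose_apply, Matrix.of_apply, Function.comp, LinearMap.proj_apply,
    Matrix.mulVecLin_apply, Matrix.mulVec_single_one, Matrix.col_apply, Matrix.submatrix_apply]
  rfl

lemma submatrix_mul_left {l m o : Type*} [Fintype l] [Fintype m] [DecidableEq m]
    (x : Matrix m m ℂ) (g : Matrix m m ℂ) {e : l → m} (he : Function.Injective e) (f : o → m)
    (h : ∀ r k, (∀ s, e s ≠ k) → x (e r) k = 0) :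
    (x * g).submatrix e f = x.submatrix e e * g.submatrix e f := by
  ext r s
  simp only [Matrix.submatrix_apply, Matrix.mul_apply]
  refine Eq.trans ?_ (Finset.sum_map Finset.univ (⟨e, he⟩ : l ↪ m) fun k => x (e r) k * g k (f s))
  refine (Finset.sum_subset (Finset.subset_univ _) fun k _ hk => ?_).symm
  rw [h r k fun s hs => hk (by simpa using ⟨s, hs⟩), zero_mul]

lemma submatrix_mul_right {l m o : Type*} [Fintype o] [Fintype m] [DecidableEq m]
    (g : Matrix m m ℂ) (b : Matrix m m ℂ) (e : l → m) {f : o → m} (hf : Function.Injective f)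
    (h : ∀ s k, (∀ r, f r ≠ k) → b k (f s) = 0) :
    (g * b).submatrix e f = g.submatrix e f * b.submatrix f f := by
  ext r s
  simp only [Matrix.submatrix_apply, Matrix.mul_apply]
  refine Eq.trans ?_ (Finset.sum_map Finset.univ (⟨f, hf⟩ : o ↪ m) fun k => g (e r) k * b k (f s))
  refine (Finset.sum_subset (Finset.subset_univ _) fun k _ hk => ?_).symm
  rw [h s k fun s hs => hk (by simpa using ⟨s, hs⟩), mul_zero]

/-- The minors that use the last rows are invariant under `x_i(s)` from the left, and
the Borel subgroup acts from the right by the highest weight. -/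
lemma det_submatrix_of_mul_hMat (i j : Fin n) {s d : ℂ} (hd : d ≠ 0)
    {u v : Matrix (Fin (n + 1)) (Fin (n + 1)) ℂ} (h : hMat i 1 s * u = v * hMat i d s) :
    (u.submatrix (lastRows j) (firstCols j)).det =
      (v.submatrix (lastRows j) (firstCols j)).det * if j = i then d else 1 := by
  have hj := j.2
  have he : Function.Injective (lastRows j) := fun r s hrs => by
    have := congrArg Fin.val hrs
    simp only [lastRows] at this
    exact Fin.ext (by omega)
  have hf : Function.Injective (firstCols j) := fun r s hrs => by
    have := congrArg Fin.val hrs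
    simp only [firstCols] at this
    exact Fin.ext (by omega)
  have h1 := congrArg (fun M => (Matrix.submatrix M (lastRows j) (firstCols j)).det) h
  beta_reduce at h1
  rw [submatrix_mul_left _ _ he, submatrix_mul_right _ _ _ hf, Matrix.det_mul, Matrix.det_mul,
    Matrix.det_of_isUpperTriangular (M := (hMat i 1 s).submatrix _ _),
    Matrix.det_of_isUpperTriangular (M := (hMat i d s).submatrix _ _)] at h1
  · have h2 : ∏ r, (hMat i 1 s).submatrix (lastRows j) (lastRows j) r r = 1 := by
      refine Finset.prod_eq_one fun r _ => ?_
      rw [Matrix.submatrix_apply, hMat, if_pos rfl]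
      split_ifs <;> simp
    have h3 : ∏ r, (hMat i d s).submatrix (firstCols j) (firstCols j) r r =
        if j = i then d else 1 := by
      have h4 : ∀ r : Fin (j + 1), (hMat i d s).submatrix (firstCols j) (firstCols j) r r =
          (if r.1 = i.1 then d else 1) * if r.1 = i.1 + 1 then d⁻¹ else 1 := by
        intro r
        rw [Matrix.submatrix_apply, hMat, if_pos rfl]
        change (if r.1 = i.1 then d else if r.1 = i.1 + 1 then d⁻¹ else 1) = _
        split_ifs <;> first | omega | simp
      rw [Finset.prod_congr rfl fun r _ => h4 r, Fin.prod_univ_eq_prod_range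
        (fun r => (if r = i.1 then d else 1) * if r = i.1 + 1 then d⁻¹ else 1),
        Finset.prod_mul_distrib, Finset.prod_ite_eq', Finset.prod_ite_eq']
      simp only [Finset.mem_range, Fin.ext_iff]
      split_ifs <;> first | omega | simp [hd]
    rw [h2, h3, one_mul] at h1
    exact h1
  · intro r s hrs
    have hrs' : s.1 < r.1 := hrs
    exact hMat_upper _ _ _ _ _ (by simpa [firstCols] using hrs')
  · intro r s hrs
    have hrs' : s.1 < r.1 := hrs
    exact hMat_upper _ _ _ _ _ (by simpa [lastRows] using hrs')
  · intro s k hk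
    refine hMat_upper _ _ _ _ _ ?_
    by_contra hlt
    rw [not_lt, Fin.le_def] at hlt
    simp only [firstCols] at hlt
    exact hk ⟨k.1, by omega⟩ (Fin.ext rfl)
  · intro r k hk
    refine hMat_upper _ _ _ _ _ ?_
    by_contra hlt
    rw [not_lt, Fin.le_def] at hlt
    simp only [lastRows] at hlt
    exact hk ⟨k.1 - (n - j), by omega⟩ (Fin.ext (by simp only [lastRows]; omega))

lemma fCoeff_eMinus (i j : Fin n) (c : ℂˣ) (u : UMinus n) (hφ : phi i u ≠ 0) :
    fCoeff j u.1 = fCoeff j (eMinus i c u hφ).1 * if j = i then (c : ℂ) else 1 := by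
  rw [fCoeff_eq_det, fCoeff_eq_det]
  exact det_submatrix_of_mul_hMat i j c.ne_zero (eMinus_mul_hMat i c u hφ)

/-- The minor of the last `m` rows and of `m` columns from the column `k` on. -/
def corner (M : Matrix (Fin (n + 1)) (Fin (n + 1)) ℂ) (k m : ℕ) : ℂ :=
  (Matrix.of fun r s : Fin m => matN M (n + 1 - m + r) (k + s)).det

lemma fCoeff_eq_corner (i : Fin n) (g : G n) : fCoeff i g = corner g.1 0 (i + 1) := by
  rw [fCoeff_eq_det, corner]
  congr 1
  ext r s
  rw [Matrix.submatrix_apply, Matrix.of_apply, matN, dif_pos (by omega)]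
  exact congrArg₂ g.1 (Fin.ext (by simp only [lastRows]; omega))
    (Fin.ext (by simp only [firstCols]; omega))

/-- Row operations remove the row factor `k` from all rows but the first, and clear the first
column below its first entry. -/
lemma corner_tailU_succ (a : TriIdx n → ℂˣ) {k m : ℕ} (h : k + m < n) :
    corner (tailU a k).1.1 k (m + 1) =
      (∏ j ∈ Finset.Ico k (n - m), (entry a k j : ℂ)) *
        corner (tailU a (k + 1)).1.1 (k + 1) m := by
  set B : Matrix (Fin (m + 1)) (Fin (m + 1)) ℂ := Matrix.of fun r s =>
    if r = 0 then matN (tailU a k).1.1 (n - m) (k + s)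
    else matN (tailU a (k + 1)).1.1 (n - m + r) (k + s) with hB
  have hrow : ∀ p < n, ∀ q < n + 1, matN (tailU a k).1.1 (p + 1) q =
      matN (tailU a (k + 1)).1.1 (p + 1) q + entryC a k p * matN (tailU a k).1.1 p q := by
    intro p hp q hq
    rw [matN, dif_pos (by omega), matN, dif_pos (by omega), matN, dif_pos (by omega)]
    exact tailU_apply_succ a (by omega) ⟨p, hp⟩ ⟨q, hq⟩
  rw [corner, Matrix.det_eq_of_forall_row_eq_smul_add_pred (B := B)
    (fun r => entryC a k (n - m + r)), Matrix.det_succ_column_zero, Finset.sum_eq_single 0]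
  · have h1 : B 0 0 = ∏ j ∈ Finset.Ico k (n - m), (entry a k j : ℂ) := by
      rw [hB, Matrix.of_apply, if_pos rfl, matN, dif_pos (by simp; omega)]
      exact tailU_apply_col a (by omega) (by omega) (by omega)
    rw [h1, corner, Fin.val_zero, pow_zero, one_mul]
    congr 2
    ext r s
    rw [Matrix.submatrix_apply, Matrix.of_apply, hB, Matrix.of_apply,
      if_neg (by simp), Fin.zero_succAbove, Fin.val_succ, Fin.val_succ]
    congr 1 <;> omega
  · intro r _ hr
    have hr' : r.1 ≠ 0 := fun h => hr (Fin.ext h)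
    have h1 : B r 0 = 0 := by
      rw [hB, Matrix.of_apply, if_neg hr, matN, dif_pos (by simp; omega),
        tailU_apply_of_lt _ _ _ _ (by simp), Matrix.one_apply_ne]
      intro h2
      have := congrArg Fin.val h2
      simp at this
      omega
    rw [h1, mul_zero, zero_mul]
  · simp
  · intro s
    rw [hB, Matrix.of_apply, Matrix.of_apply, if_pos rfl]
    congr 1
    simp
  · intro r s
    have := hrow (n - m + r) (by omega) (k + s) (by omega)
    rw [hB, Matrix.of_apply, Matrix.of_apply, Matrix.of_apply, if_neg (Fin.succ_ne_zero r),
      Fin.val_succ, Fin.val_castSucc, show n + 1 - (m + 1) = n - m by omega]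
    exact this

lemma corner_tailU (a : TriIdx n → ℂˣ) (m k : ℕ) (h : k + m ≤ n) :
    corner (tailU a k).1.1 k m = ∏ l ∈ Finset.range m, ∏ j ∈ Finset.range (n + 1 - m - k),
      (entry a (k + l) (k + l + j) : ℂ) := by
  induction m generalizing k with
  | zero => simp [corner]
  | succ m ih =>
    rw [corner_tailU_succ a (by omega), ih (k + 1) (by omega), Finset.prod_range_succ', mul_comm,
      Finset.prod_Ico_eq_prod_range, show n - m - k = n + 1 - (m + 1) - k by omega,
      show n + 1 - m - (k + 1) = n + 1 - (m + 1) - k by omega]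
    refine congrArg₂ (· * ·) (Finset.prod_congr rfl fun l _ => ?_) rfl
    rw [show k + 1 + l = k + (l + 1) by omega]

/-- The minors are monomials in the coordinates `A`. -/
lemma fCoeff_theta (i : Fin n) (A : TriIdx n → ℂˣ) : fCoeff i (theta (xiInv A)).1 =
    ((∏ j ∈ Finset.range (n - i), colProd A (i + 1) (i + j) : ℂˣ) : ℂ) := by
  have hi := i.2
  rw [fCoeff_eq_corner, ← tailU_zero, corner_tailU _ _ _ (by omega), Finset.prod_comm,
    Units.coe_prod, show n + 1 - (i.1 + 1) - 0 = n - i by omega]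
  refine Finset.prod_congr rfl fun j hj => ?_
  rw [Finset.mem_range] at hj
  have h := prod_diagonal_xiInv A (k := i + 1) (m := j) (by omega)
  rw [show i.1 + 1 + j - 1 = i + j by omega] at h
  rw [← h, Units.coe_prod]
  simp only [zero_add]

/-! ### The map to the torus -/

lemma coroot_mul (i : Fin n) (c d : ℂˣ) : coroot i (c * d) = coroot i c * coroot i d := by
  refine Subtype.ext ?_
  change (Pi.mulSingle i.castSucc (c * d) * Pi.mulSingle i.succ (c * d)⁻¹ : Fin (n + 1) → ℂˣ) =
    (Pi.mulSingle i.castSucc c * Pi.mulSingle i.succ c⁻¹ : Fin (n + 1) → ℂˣ) *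
      (Pi.mulSingle i.castSucc d * Pi.mulSingle i.succ d⁻¹ : Fin (n + 1) → ℂˣ)
  rw [mul_inv, Pi.mulSingle_mul, Pi.mulSingle_mul, mul_mul_mul_comm]

lemma coroot_one (i : Fin n) : coroot i 1 = 1 := by
  have h := coroot_mul i 1 1
  rw [mul_one] at h
  exact (mul_eq_left.mp h.symm)

lemma fundCoords_coroot (i : Fin n) (c : ℂˣ) : fundCoords (coroot i c) = Pi.mulSingle i c := by
  funext j
  change ∏ k ∈ Finset.Iic j.castSucc, ((Pi.mulSingle i.castSucc c : Fin (n + 1) → ℂˣ) k *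
    (Pi.mulSingle i.succ c⁻¹ : Fin (n + 1) → ℂˣ) k) = _
  rw [Finset.prod_mul_distrib]
  simp only [Pi.mulSingle_apply, Finset.prod_ite_eq', Finset.mem_Iic]
  simp only [Fin.ext_iff, Fin.le_def, Fin.val_succ, Fin.val_castSucc]
  split_ifs <;> first | omega | simp

lemma fundCoords_mul (s t : T n) : fundCoords (s * t) = fundCoords s * fundCoords t := by
  funext j
  exact Finset.prod_mul_distrib

lemma fundCoords_prod_coroot (c : Fin n → ℂˣ) : fundCoords (∏ i, coroot i (c i)) = c := by
  have h := map_prod (MonoidHom.mk' (fundCoords (n := n)) fundCoords_mul)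
    (fun i => coroot i (c i)) Finset.univ
  refine h.trans ?_
  simp only [MonoidHom.mk'_apply, fundCoords_coroot]
  exact Finset.univ_prod_mulSingle c

lemma chi_γ_eq {u : UMinus n} (h : ∀ i : Fin n, fCoeff i u.1 ≠ 0) : (chiUMinus n).γ u =
    Part.some (∏ i : Fin n, coroot i (Units.mk0 (fCoeff i u.1) (h i))⁻¹) :=
  Part.eq_some_iff.mpr ⟨h, rfl⟩

lemma chi_γ_e (i : Fin n) (c : ℂˣ) (u : UMinus n) (hφ : phi i u ≠ 0)
    (h : ∀ i : Fin n, fCoeff i u.1 ≠ 0) : ∃ y ∈ (chiUMinus n).e i (c, u),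
      ∃ t ∈ (chiUMinus n).γ u, coroot i c * t ∈ (chiUMinus n).γ y := by
  have h' : ∀ j : Fin n, fCoeff j (eMinus i c u hφ).1 ≠ 0 := by
    intro j h0
    have h1 := fCoeff_eMinus i j c u hφ
    rw [h0, zero_mul] at h1
    exact h j h1
  refine ⟨eMinus i c u hφ, ?_, ∏ i : Fin n, coroot i (Units.mk0 (fCoeff i u.1) (h i))⁻¹, ?_, ?_⟩
  · rw [chi_e_eq i c u hφ]
    exact Part.mem_some _
  · rw [chi_γ_eq h]
    exact Part.mem_some _
  · rw [chi_γ_eq h', Part.mem_some_iff]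
    have h2 : ∀ j : Fin n, (Units.mk0 (fCoeff j (eMinus i c u hφ).1) (h' j))⁻¹ =
        (if j = i then c else 1) * (Units.mk0 (fCoeff j u.1) (h j))⁻¹ := by
      intro j
      have h3 : Units.mk0 (fCoeff j u.1) (h j) =
          Units.mk0 (fCoeff j (eMinus i c u hφ).1) (h' j) * if j = i then c else 1 := by
        rw [← Units.val_inj, Units.val_mk0, fCoeff_eMinus i j c u hφ, Units.val_mul, Units.val_mk0]
        split_ifs <;> simp
      rw [h3, mul_inv_rev, mul_inv_cancel_left]
    simp only [h2, coroot_mul, Finset.prod_mul_distrib]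
    refine congrArg₂ (· * ·) ?_ rfl
    rw [Finset.prod_eq_single i, if_pos rfl]
    · intro j _ hj
      rw [if_neg hj, coroot_one]
    · simp

end Minor

/-! ### The positive structure and its ultra-discretization -/

section Positive

variable {n : ℕ}

lemma bEntry_cocharEquiv (l : TriIdx n → ℤ) {k j : ℕ} (h1 : k ≤ j) (h2 : j < n) :
    bEntry (cocharEquiv n l) k (j + 1) = l ⟨(⟨k, h1.trans_lt h2⟩, ⟨j, h2⟩), h1⟩ := by
  rw [bEntry, dif_pos (by omega)]
  rfl

lemma hasTrop_colProd {σ : Type} (e : TriIdx n → σ) {k j : ℕ} (hk : k ≤ j + 1) (hj : j < n) :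
    HasTrop (fun t : σ → ℂˣ => (colProd (fun p => t (e p)) k j : ℂ)) fun l =>
      ∑ m ∈ Finset.range k, bEntry (cocharEquiv n fun p => l (e p)) m (j + 1) := by
  have h : ∀ m ∈ Finset.range k, HasTrop
      (fun t : σ → ℂˣ => (entry (fun p => t (e p)) m j : ℂ))
      fun l => bEntry (cocharEquiv n fun p => l (e p)) m (j + 1) := by
    intro m hm
    rw [Finset.mem_range] at hm
    refine (HasTrop.coord (e ⟨(⟨m, by omega⟩, ⟨j, hj⟩), by rw [Fin.mk_le_mk]; omega⟩)).congr
      (fun t => ?_) fun l => ?_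
    · rw [entry_mk _ (by omega) hj]
    · rw [bEntry_cocharEquiv _ (by omega) hj]
  exact (HasTrop.prod _ h).congr (fun t => Units.coe_prod _ _) fun l => rfl

/-- The tropicalizations of the factorization parameters `a_{k,i}` are the functions `b_k^{(i)}`. -/
lemma hasTrop_entry_xiInv {σ : Type} (e : TriIdx n → σ) {k j : ℕ} (hk : k ≤ j) (hj : j < n) :
    HasTrop (fun t : σ → ℂˣ => (entry (xiInv fun p => t (e p)) k j : ℂ)) fun l =>
      bSum (cocharEquiv n fun p => l (e p)) j k := by
  refine ((hasTrop_colProd e (k := k + 1) (by omega) hj).div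
    (hasTrop_colProd e (k := k) (j := j - 1) (by omega) (by omega))).congr (fun t => ?_) fun l => ?_
  · rw [entry_xiInv _ hk hj, Units.val_div_eq_div_val]
  · rw [bSum]
    rcases Nat.eq_zero_or_pos k with rfl | h0
    · simp
    · rw [show j - 1 + 1 = j by omega]

/-- The totally positive points of `U⁻` that are reached by the factorization map. -/
def posU (n : ℕ) : Set (UMinus n) := {u | ∃ A ∈ posTorus (TriIdx n), theta (xiInv A) = u}

lemma posU_nonempty : (posU n).Nonempty := ⟨_, 1, one_mem_posTorus, rfl⟩

lemma entry_xiInv_pos {A : TriIdx n → ℂˣ} (hA : A ∈ posTorus (TriIdx n)) {k j : ℕ} (hk : k ≤ j)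
    (hj : j < n) : 0 < (entry (xiInv A) k j : ℂ) :=
  (hasTrop_entry_xiInv id hk hj).pos hA

lemma shiftSum_pos {A : TriIdx n → ℂˣ} (hA : A ∈ posTorus (TriIdx n)) (i : Fin n) {c : ℂ}
    (hc : 0 < c) (k : ℕ) : 0 < shiftSum i c (xiInv A) k := by
  refine Finset.sum_pos (fun l hl => ?_) Finset.nonempty_range_add_one
  rw [Finset.mem_range] at hl
  refine mul_pos (entry_xiInv_pos hA (by omega) i.2) ?_
  split_ifs
  · exact hc
  · exact zero_lt_one

lemma phi_pos {u : UMinus n} (hu : u ∈ posU n) (i : Fin n) : 0 < phi i u := by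
  obtain ⟨A, hA, rfl⟩ := hu
  rw [← shiftSum_zero i 1]
  exact shiftSum_pos hA i zero_lt_one 0

lemma fCoeff_ne_zero {u : UMinus n} (hu : u ∈ posU n) (i : Fin n) : fCoeff i u.1 ≠ 0 := by
  obtain ⟨A, hA, rfl⟩ := hu
  rw [fCoeff_theta]
  exact Units.ne_zero _

/-- The operators `e_i^c` with `c > 0` preserve the set of totally positive points. -/
lemma eMinus_mem_posU {u : UMinus n} (hu : u ∈ posU n) (i : Fin n) {c : ℂˣ} (hc : 0 < (c : ℂ))
    (hφ : phi i u ≠ 0) : eMinus i c u hφ ∈ posU n := by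
  obtain ⟨A, hA, rfl⟩ := hu
  have h : ∀ k, 0 < shiftSum i c (xiInv A) k := shiftSum_pos hA i hc
  have h1 := (chi_e_theta i c A fun k _ => (h k).ne').2
  rw [chi_e_eq i c _ hφ, Part.some_inj] at h1
  rw [h1]
  have hinv : ∀ z : ℂ, 0 < z → 0 < z⁻¹ := fun z hz => RCLike.inv_pos.mpr hz
  have hd : ∀ k, 0 < (shiftUnit i c (xiInv A) k : ℂ) := by
    intro k
    rw [coe_shiftUnit (h 0).ne' (h k).ne', div_eq_mul_inv]
    exact mul_pos (h k) (hinv _ (h 0))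
  refine ⟨_, fun p => ?_, rfl⟩
  rw [scaleCols, Units.val_mul]
  refine mul_pos (hA p) ?_
  split_ifs
  · rw [Units.val_div_eq_div_val, div_eq_mul_inv]
    exact mul_pos (hd _) (hinv _ (hd _))
  · rw [Units.val_div_eq_div_val, div_eq_mul_inv]
    exact mul_pos (hd _) (hinv _ (hd _))
  · simp

lemma ratOn_uMinus_coord (S : Set (UMinus n)) (p q : Fin (n + 1)) :
    RatOn S fun u : UMinus n => u.1.1 p q :=
  RatOn.coord (X := UMinus n) (p, q)

lemma ratOn_list_prod {X ι κ m : Type} [AffCoords X ι] [Fintype m] [DecidableEq m] {S : Set X}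
    (F : κ → X → Matrix m m ℂ) (hF : ∀ k p q, RatOn S fun x => F k x p q) (L : List κ)
    (p q : m) : RatOn S fun x => (L.map fun k => F k x).prod p q := by
  induction L generalizing p q with
  | nil => exact RatOn.const _
  | cons k L ih =>
    simp only [List.map_cons, List.prod_cons]
    exact RatOn.matrix_mul (hF k) ih p q

lemma ratOn_theta (p q : Fin (n + 1)) :
    RatOn (posTorus (TriIdx n)) fun A => (theta (xiInv A)).1.1 p q := by
  simp only [theta_eq_prod]
  refine ratOn_list_prod (fun (k : Fin n) A => rowMat (xiInv A) k) (fun k p q => ?_) _ p q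
  refine ratOn_list_prod (fun (j : Fin n) A =>
    Matrix.transvection j.succ j.castSucc (entryC (xiInv A) k j)) (fun j p q => ?_) _ p q
  simp only [Matrix.transvection, Matrix.add_apply, Matrix.single_apply]
  refine (RatOn.const _).add ?_
  split_ifs
  · by_cases h : k.1 ≤ j.1 ∧ j.1 < n
    · simp only [entryC, if_pos h]
      exact (hasTrop_entry_xiInv id h.1 h.2).ratOn
    · simp only [entryC, if_neg h]
      exact RatOn.const _
  · exact RatOn.const _

lemma peel_ne_zero {u : UMinus n} (hu : u ∈ posU n) {k p : ℕ} (hkp : k ≤ p) (hp : p < n + 1)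
    (hk : k < n) : peel (matN u.1.1) k p k ≠ 0 := by
  obtain ⟨A, hA, rfl⟩ := hu
  rw [peel_theta _ (by omega) hp (by omega), tailU_apply_col _ hk hkp]
  exact Finset.prod_ne_zero_iff.mpr fun l _ => Units.ne_zero _

lemma ratOn_peel {k : ℕ} (hk : k ≤ n) {p : ℕ} (hp : p < n + 1) (q : ℕ) :
    RatOn (posU n) fun u => peel (matN u.1.1) k p q := by
  induction k generalizing p q with
  | zero =>
    by_cases hq : q < n + 1
    · simp only [peel_zero, matN, dif_pos (And.intro hp hq)]
      exact ratOn_uMinus_coord _ _ _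
    · simp only [peel_zero, matN, dif_neg fun h : p < n + 1 ∧ q < n + 1 => hq h.2]
      exact RatOn.const _
  | succ k ih =>
    simp only [peel_succ]
    have ih' := fun {p : ℕ} => ih (by omega) (p := p)
    split_ifs with h
    · exact (ih' hp q).sub (((ih' hp k).div (ih' (by omega) k)
        fun u hu => peel_ne_zero hu (by omega) (by omega) (by omega)).mul (ih' (by omega) q))
    · exact ih' hp q

lemma thetaHat_eq (A : TriIdx n → ℂˣ) : thetaHat n A = Part.some (theta (xiInv A)) := rfl

lemma pinv_thetaHat (A : TriIdx n → ℂˣ) :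
    pinv (thetaHat n) (theta (xiInv A)) = Part.some A := by
  have hex : ∃ A', theta (xiInv A) ∈ thetaHat n A' := ⟨A, Part.mem_some _⟩
  refine Part.eq_some_iff.mpr ⟨hex, ?_⟩
  have h : theta (xiInv A) = theta (xiInv hex.choose) := Part.mem_some_iff.mp hex.choose_spec
  have h1 := congrArg xi (theta_injective h)
  rw [xi_xiInv, xi_xiInv] at h1
  exact h1.symm

/-- The parameter `a_{k,j}` of a point of `U⁻` as a rational function. -/
def peelRatio (k j : ℕ) (u : UMinus n) : ℂ :=
  peel (matN u.1.1) k (j + 1) k / peel (matN u.1.1) k j k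

lemma exists_theta_eq (u : UMinus n)
    (h : ∀ k p, k ≤ p → p < n + 1 → k < n → peel (matN u.1.1) k p k ≠ 0) :
    ∃ a : TriIdx n → ℂˣ, theta a = u ∧
      ∀ k j, k ≤ j → j < n → (entry a k j : ℂ) = peelRatio k j u := by
  have h1 : ∀ p : TriIdx n, peelRatio p.1.1 p.1.2 u ≠ 0 := by
    intro p
    have hp : p.1.1.1 ≤ p.1.2.1 := p.2
    exact div_ne_zero (h _ _ (by omega) (by omega) (by omega))
      (h _ _ (by omega) (by omega) (by omega))
  have h2 : ∀ k j, k ≤ j → j < n →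
      (entry (fun p => Units.mk0 _ (h1 p)) k j : ℂ) = peelRatio k j u := by
    intro k j hk hj
    rw [entry_mk _ hk hj]
    rfl
  exact ⟨fun p => Units.mk0 _ (h1 p),
    theta_eq_of_peel u _ (fun k p hkp hp => h k p hkp (by omega) (by omega)) h2, h2⟩

lemma near_exists_theta : Near (posU n) fun u => ∃ a : TriIdx n → ℂˣ, theta a = u ∧
    ∀ k j, k ≤ j → j < n → (entry a k j : ℂ) = peelRatio k j u := by
  have h : Near (posU n) fun u => ∀ (k : Fin n) (p : Fin (n + 1)), k.1 ≤ p.1 →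
      peel (matN u.1.1) k p k ≠ 0 := by
    refine Near.forall fun k => Near.forall fun p => ?_
    by_cases hkp : k.1 ≤ p.1
    · exact ((ratOn_peel k.2.le p.2 k).ne_zero fun u hu => peel_ne_zero hu hkp p.2 k.2).mono
        fun u hu _ => hu
    · exact Near.of_forall fun u h => absurd h hkp
  exact h.mono fun u hu => exists_theta_eq u fun k p hkp hp hk => hu ⟨k, hk⟩ ⟨p, hp⟩ hkp

/-- The inverse of `θ̂` is the composition of `ξ` with the quotients of the pivots of the
elimination. -/
theorem isBirational_thetaHat (n : ℕ) : IsBirational (thetaHat n) := by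
  refine ⟨?_, ?_, ?_, ?_⟩
  · refine IsRational.of_ratOn ⟨1, one_mem_posTorus⟩
      (F := fun j A => (theta (xiInv A)).1.1 j.1 j.2) (fun j => ratOn_theta j.1 j.2)
      (Near.of_forall fun A => ⟨_, Part.mem_some _, fun j => rfl⟩)
  · refine IsRational.of_ratOn posU_nonempty
      (F := fun p u => (∏ l ∈ Finset.range (p.1.1 + 1), peelRatio (p.1.1 - l) (p.1.2 - l) u) /
        ∏ l ∈ Finset.range p.1.1, peelRatio (p.1.1 - (l + 1)) (p.1.2 - l) u) (fun p => ?_)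
      (near_exists_theta.mono ?_)
    · have hp : p.1.1.1 ≤ p.1.2.1 := p.2
      have hr : ∀ k j, k ≤ j → j < n → RatOn (posU n) (peelRatio k j) := fun k j hk hj =>
        (ratOn_peel (by omega) (by omega) k).div (ratOn_peel (by omega) (by omega) k)
          fun u hu => peel_ne_zero hu hk (by omega) (by omega)
      refine (RatOn.prod _ fun l hl => ?_).div (RatOn.prod _ fun l hl => ?_) fun u hu => ?_
      · rw [Finset.mem_range] at hl
        exact hr _ _ (by omega) (by omega)
      · rw [Finset.mem_range] at hl
        exact hr _ _ (by omega) (by omega)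
      · refine Finset.prod_ne_zero_iff.mpr fun l hl => ?_
        rw [Finset.mem_range] at hl
        exact div_ne_zero (peel_ne_zero hu (by omega) (by omega) (by omega))
          (peel_ne_zero hu (by omega) (by omega) (by omega))
    · rintro u ⟨a, rfl, ha⟩
      refine ⟨xi a, ?_, fun p => ?_⟩
      · have h := pinv_thetaHat (xi a)
        rw [xiInv_xi] at h
        rw [h]
        exact Part.mem_some _
      · have hp : p.1.1.1 ≤ p.1.2.1 := p.2
        change ((xi a p : ℂˣ) : ℂ) = _
        rw [xi, Units.val_div_eq_div_val, Units.coe_prod, Units.coe_prod]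
        refine congrArg₂ (· / ·) (Finset.prod_congr rfl fun l hl => ?_)
          (Finset.prod_congr rfl fun l hl => ?_)
        · rw [Finset.mem_range] at hl
          exact ha _ _ (by omega) (by omega)
        · rw [Finset.mem_range] at hl
          exact ha _ _ (by omega) (by omega)
  · refine (Near.of_forall (S := posTorus (TriIdx n)) fun A => ?_).generically
      ⟨1, one_mem_posTorus⟩
    refine ⟨theta (xiInv A), Part.mem_some _, ?_⟩
    rw [pinv_thetaHat]
    exact Part.mem_some _
  · refine (near_exists_theta.mono ?_).generically posU_nonempty
    rintro u ⟨a, rfl, -⟩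
    have h := pinv_thetaHat (xi a)
    rw [xiInv_xi] at h
    refine ⟨xi a, ?_, ?_⟩
    · rw [h]
      exact Part.mem_some _
    · rw [thetaHat_eq, xiInv_xi]
      exact Part.mem_some _

/-- The morphism `γ ∘ θ̂` is positive, and its ultra-discretization is the family of the
coefficients of the weight. -/
lemma γPull_thetaHat : IsPositiveMor ((chiUMinus n).γPull (thetaHat n)) ∧
    ∀ l i, ultraDisc ((chiUMinus n).γPull (thetaHat n)) l i =
      -∑ j ∈ Finset.range (n - i), ∑ m ∈ Finset.range (i.1 + 1),
        bEntry (cocharEquiv n l) m (i + j + 1) := by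
  have hF : ∀ i : Fin n, HasTrop (fun A => (fCoeff i (theta (xiInv A)).1)⁻¹) fun l =>
      -∑ j ∈ Finset.range (n - i), ∑ m ∈ Finset.range (i.1 + 1),
        bEntry (cocharEquiv n l) m (i + j + 1) := by
    intro i
    have h := HasTrop.prod (Finset.range (n - i)) fun j hj =>
      hasTrop_colProd (n := n) id (k := i.1 + 1) (j := i + j) (by omega)
        (by rw [Finset.mem_range] at hj; omega)
    refine h.inv.congr (fun A => ?_) fun l => rfl
    rw [fCoeff_theta, Units.coe_prod]
    rfl
  refine isPositiveMor_of_hasTrop hF (Near.of_forall fun A => ?_)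
  have h0 : ∀ i : Fin n, fCoeff i (theta (xiInv A)).1 ≠ 0 := by
    intro i
    rw [fCoeff_theta]
    exact Units.ne_zero _
  refine ⟨fun i => (Units.mk0 _ (h0 i))⁻¹, ?_, fun i => ?_⟩
  · rw [GeomCrystalData.γPull, thetaHat_eq, Part.bind_some, chi_γ_eq h0, Part.map_some,
      fundCoords_prod_coroot]
    exact Part.mem_some _
  · rw [Units.val_inv_eq_inv_val, Units.val_mk0]

/-- The morphisms `e_{i,θ̂}` are positive, and their ultra-discretizations change two adjacent
columns by differences of tropical sums. -/
lemma ePull_thetaHat (i : Fin n) : IsPositiveMor ((chiUMinus n).ePull (thetaHat n) i) ∧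
    ∀ l p, ultraDisc ((chiUMinus n).ePull (thetaHat n) i) l p = l (some p) +
      (let S := tropSum (bSum (cocharEquiv n fun q => l (some q)) i) i (l none)
      if p.1.2.1 + 1 = i then S (p.1.1 + 1) - S p.1.1
        else if p.1.2.1 = i then S p.1.1 - S (p.1.1 + 1) else 0) := by
  have hS : ∀ k, HasTrop (fun t : Option (TriIdx n) → ℂˣ =>
      shiftSum i (t none) (xiInv fun q => t (some q)) k)
      fun l => tropSum (bSum (cocharEquiv n fun q => l (some q)) i) i (l none) k := by
    intro k
    refine HasTrop.sum Finset.nonempty_range_add_one fun m hm => ?_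
    rw [Finset.mem_range] at hm
    refine (hasTrop_entry_xiInv some (by omega) i.2).mul ?_
    split_ifs
    · exact HasTrop.coord none
    · exact HasTrop.one
  have hF : ∀ p : TriIdx n, HasTrop (fun t : Option (TriIdx n) → ℂˣ => (t (some p) : ℂ) *
      (let S := shiftSum i (t none) (xiInv fun q => t (some q))
      if p.1.2.1 + 1 = i then S (p.1.1 + 1) / S p.1.1
        else if p.1.2.1 = i then S p.1.1 / S (p.1.1 + 1) else 1))
      fun l => l (some p) +
      (let S := tropSum (bSum (cocharEquiv n fun q => l (some q)) i) i (l none)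
      if p.1.2.1 + 1 = i then S (p.1.1 + 1) - S p.1.1
        else if p.1.2.1 = i then S p.1.1 - S (p.1.1 + 1) else 0) := by
    intro p
    refine (HasTrop.coord (some p)).mul ?_
    split_ifs
    · exact (hS _).div (hS _)
    · exact (hS _).div (hS _)
    · exact HasTrop.one
  refine isPositiveMor_of_hasTrop hF ?_
  have hne : Near (posTorus (Option (TriIdx n))) fun t => ∀ k : Fin (n + 1),
      shiftSum i (t none) (xiInv fun q => t (some q)) k ≠ 0 :=
    Near.forall fun k => (hS k).ratOn.ne_zero fun t ht => ((hS k).pos ht).ne'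
  refine hne.mono fun t ht => ?_
  have ht' : ∀ k ≤ n, shiftSum i (t none) (xiInv fun q => t (some q)) k ≠ 0 := fun k hk =>
    ht ⟨k, by omega⟩
  refine ⟨scaleCols i (shiftUnit i (t none) (xiInv fun q => t (some q))) fun q => t (some q),
    ?_, fun p => ?_⟩
  · rw [GeomCrystalData.ePull, thetaHat_eq, Part.bind_some,
      (chi_e_theta i (t none) (fun q => t (some q)) ht').2, Part.bind_some, pinv_thetaHat]
    exact Part.mem_some _
  · have hp : p.1.1.1 ≤ p.1.2.1 := p.2
    have h1 := ht' p.1.1 (by omega)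
    have h2 := ht' (p.1.1 + 1) (by omega)
    have h0 := ht' 0 (by omega)
    rw [scaleCols, Units.val_mul]
    refine congrArg₂ (· * ·) rfl ?_
    split_ifs
    · rw [Units.val_div_eq_div_val, coe_shiftUnit h0 h1, coe_shiftUnit h0 h2,
        div_div_div_cancel_right₀ h0]
    · rw [Units.val_div_eq_div_val, coe_shiftUnit h0 h1, coe_shiftUnit h0 h2,
        div_div_div_cancel_right₀ h0]
    · rfl

theorem isPositiveStructure_thetaHat (n : ℕ) :
    IsPositiveStructure (chiUMinus n) (thetaHat n) :=
  ⟨isBirational_thetaHat n, γPull_thetaHat.1, fun i => (ePull_thetaHat i).1⟩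

/-- The coefficient of `α_i` in the weight, up to the sign, as a sum over columns of partial column
sums, as it arises from the minor `f_i`. -/
lemma sum_sharpIdx_eq (i : Fin n) (v : Bsharp n) :
    (∑ p : SharpIdx n, if p.1.1 ≤ i.castSucc ∧ i.succ ≤ p.1.2 then v p else 0) =
      ∑ j ∈ Finset.range (n - i), ∑ m ∈ Finset.range (i.1 + 1), bEntry v m (i + j + 1) := by
  have hi := i.2
  rw [← Finset.sum_product', ← Finset.sum_filter]
  refine Finset.sum_bij (fun p _ => (p.1.2.1 - i - 1, p.1.1.1)) (fun p hp => ?_)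
    (fun p hp p' hp' h => ?_) (fun x hx => ?_) fun p hp => ?_
  · have h1 := (Finset.mem_filter.mp hp).2
    rw [Fin.le_def, Fin.le_def, Fin.val_castSucc, Fin.val_succ] at h1
    rw [Finset.mem_product, Finset.mem_range, Finset.mem_range]
    have := p.1.2.2
    simp only []
    omega
  · have h1 := (Finset.mem_filter.mp hp).2
    have h2 := (Finset.mem_filter.mp hp').2
    rw [Fin.le_def, Fin.le_def, Fin.val_castSucc, Fin.val_succ] at h1 h2
    rw [Prod.mk.injEq] at h
    exact Subtype.ext (Prod.ext (Fin.ext h.2) (Fin.ext (by omega)))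
  · rw [Finset.mem_product, Finset.mem_range, Finset.mem_range] at hx
    refine ⟨⟨(⟨x.2, by omega⟩, ⟨i + x.1 + 1, by omega⟩), by rw [Fin.mk_lt_mk]; omega⟩,
      Finset.mem_filter.mpr ⟨Finset.mem_univ _, ?_⟩, Prod.ext ?_ rfl⟩
    · rw [Fin.le_def, Fin.le_def, Fin.val_castSucc, Fin.val_succ]
      simp only []
      omega
    · simp only []
      omega
  · have h1 := (Finset.mem_filter.mp hp).2
    rw [Fin.le_def, Fin.le_def, Fin.val_castSucc, Fin.val_succ] at h1
    have h2 : p.1.1.1 < p.1.2.1 := p.2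
    have h3 : i.1 + (p.1.2.1 - i - 1) + 1 = p.1.2.1 := by omega
    have h4 := p.1.2.2
    simp only [h3]
    rw [bEntry, dif_pos ⟨h2, h4⟩]

theorem identifiedBy_cocharEquiv (n : ℕ) :
    (ultraDiscCrystal (chiUMinus n) (thetaHat n)).IdentifiedBy (sharpCrystal n).triplet
      (cocharEquiv n) := by
  refine ⟨fun l => ?_, fun i β l => ?_⟩
  · change sharpWt (cocharEquiv n l) = ∑ i : Fin n, _
    rw [sharpWt, ← Finset.sum_neg_distrib]
    refine Finset.sum_congr rfl fun i _ => ?_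
    rw [γPull_thetaHat.2, sum_sharpIdx_eq, neg_smul]
  · rw [triplet_e_eq]
    funext q
    obtain ⟨p, rfl⟩ := (idxEquiv n).surjective q
    have h1 : ∀ l' : TriIdx n → ℤ, cocharEquiv n l' (idxEquiv n p) = l' p := fun l' =>
      congrArg l' ((idxEquiv n).symm_apply_apply p)
    rw [h1]
    change _ = ultraDisc ((chiUMinus n).ePull (thetaHat n) i) _ p
    have hp : p.1.1.1 ≤ p.1.2.1 := p.2
    rw [(ePull_thetaHat i).2, sharpAct, h1]
    have h2 : (idxEquiv n p).1.1.1 = p.1.1.1 := rfl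
    have h3 : (idxEquiv n p).1.2 = p.1.2.succ := rfl
    rw [h2, h3]
    simp only [Fin.ext_iff, Fin.val_succ, Fin.val_castSucc, Nat.add_right_cancel_iff, Option.elim]
    split_ifs with h4 h5
    · rw [betaCoeff_eq i β _ (by omega)]
    · rw [betaCoeff_eq i β _ (by omega)]
      ring
    · rw [add_zero]

end Positive

/-! ### The geometric crystal axioms -/

section Crystal

variable {n : ℕ}

lemma ratOn_fCoeff (i : Fin n) (S : Set (UMinus n)) : RatOn S fun u : UMinus n => fCoeff i u.1 := by
  simp only [fCoeff_eq_det]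
  exact RatOn.det fun p q => ratOn_uMinus_coord S _ _

lemma near_fCoeff_ne_zero : Near (posU n) fun u : UMinus n => ∀ i : Fin n, fCoeff i u.1 ≠ 0 :=
  Near.forall fun i => (ratOn_fCoeff i _).ne_zero fun _ hu => fCoeff_ne_zero hu i

lemma near_phi_ne_zero (i : Fin n) : Near (posU n) fun u : UMinus n => phi i u ≠ 0 :=
  (ratOn_uMinus_coord _ i.succ i.castSucc).ne_zero fun _ hu => (phi_pos hu i).ne'

lemma coe_coroot (i : Fin n) (c : ℂˣ) (k : Fin (n + 1)) : ((coroot i c).1 k : ℂ) =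
    (if k = i.castSucc then (c : ℂ) else 1) * if k = i.succ then (c : ℂ)⁻¹ else 1 := by
  change (((Pi.mulSingle i.castSucc c : Fin (n + 1) → ℂˣ) k *
    (Pi.mulSingle i.succ c⁻¹ : Fin (n + 1) → ℂˣ) k : ℂˣ) : ℂ) = _
  rw [Units.val_mul, Pi.mulSingle_apply, Pi.mulSingle_apply]
  split_ifs <;> simp

lemma isRational_γ (n : ℕ) : IsRational (chiUMinus n).γ := by
  refine IsRational.of_ratOn posU_nonempty (F := fun k u => ∏ i : Fin n,
    (if k = i.castSucc then (fCoeff i u.1)⁻¹ else 1) * if k = i.succ then fCoeff i u.1 else 1)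
    (fun k => RatOn.prod _ fun i _ => RatOn.mul ?_ ?_) (near_fCoeff_ne_zero.mono fun u h => ?_)
  · split_ifs
    · exact (ratOn_fCoeff i _).inv fun u hu => fCoeff_ne_zero hu i
    · exact RatOn.const _
  · split_ifs
    · exact ratOn_fCoeff i _
    · exact RatOn.const _
  · refine ⟨_, by rw [chi_γ_eq h]; exact Part.mem_some _, fun k => ?_⟩
    change (((∏ i : Fin n, coroot i (Units.mk0 (fCoeff i u.1) (h i))⁻¹ : T n).1 k : ℂˣ) : ℂ) = _
    rw [Subgroup.val_finsetProd, Finset.prod_apply, Units.coe_prod]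
    refine Finset.prod_congr rfl fun i _ => ?_
    rw [coe_coroot, Units.val_inv_eq_inv_val, Units.val_mk0, inv_inv]

lemma ratOn_hMat {X ι : Type} [AffCoords X ι] {S : Set X} (i : Fin n) {d s : X → ℂ}
    (hd : RatOn S d) (h0 : ∀ x ∈ S, d x ≠ 0) (hs : RatOn S s) (p q : Fin (n + 1)) :
    RatOn S fun x => hMat i (d x) (s x) p q := by
  simp only [hMat]
  split_ifs
  · exact hd
  · exact hd.inv h0
  · exact RatOn.const _
  · exact hs
  · exact RatOn.const _

lemma ratOn_eMat {X ι : Type} [AffCoords X ι] {S : Set X} (i : Fin n) {c : X → ℂ}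
    {M : X → Matrix (Fin (n + 1)) (Fin (n + 1)) ℂ} (hc : RatOn S c) (h0 : ∀ x ∈ S, c x ≠ 0)
    (hM : ∀ p q, RatOn S fun x => M x p q) (hφ : ∀ x ∈ S, M x i.succ i.castSucc ≠ 0)
    (p q : Fin (n + 1)) : RatOn S fun x => eMat i (c x) (M x) p q := by
  have hs : RatOn S fun x => (c x - 1) / M x i.succ i.castSucc :=
    (hc.sub (RatOn.const 1)).div (hM _ _) hφ
  exact RatOn.matrix_mul (RatOn.matrix_mul
    (ratOn_hMat i (RatOn.const 1) (fun _ _ => one_ne_zero) hs) hM)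
    (ratOn_hMat i (hc.inv h0) (fun x hx => inv_ne_zero (h0 x hx)) hs.neg) p q

/-- Totally positive points of the domain of the operators `e_i`. -/
def posE (n : ℕ) : Set (ℂˣ × UMinus n) := {z | 0 < (z.1 : ℂ) ∧ z.2 ∈ posU n}

lemma posE_nonempty : (posE n).Nonempty := by
  obtain ⟨u, hu⟩ := posU_nonempty (n := n)
  exact ⟨(1, u), by simp, hu⟩

lemma ratOn_snd_coord {X ι : Type} [AffCoords X ι] (S : Set (X × UMinus n)) (p q : Fin (n + 1)) :
    RatOn S fun z : X × UMinus n => z.2.1.1 p q :=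
  RatOn.coord (X := X × UMinus n) (Sum.inr (p, q))

lemma near_phi_snd_ne_zero (i : Fin n) : Near (posE n) fun z => phi i z.2 ≠ 0 :=
  (ratOn_snd_coord _ i.succ i.castSucc).ne_zero fun _ hz => (phi_pos hz.2 i).ne'

lemma isRational_e (i : Fin n) : IsRational ((chiUMinus n).e i) := by
  have hc : RatOn (posE n) fun z => (z.1 : ℂ) := RatOn.coord (X := ℂˣ × UMinus n) (Sum.inl ())
  refine IsRational.of_ratOn posE_nonempty
    (F := fun (p : Fin (n + 1) × Fin (n + 1)) z => eMat i (z.1 : ℂ) z.2.1.1 p.1 p.2)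
    (fun p => ratOn_eMat i hc (fun z _ => z.1.ne_zero) (ratOn_snd_coord _)
      (fun z hz => (phi_pos hz.2 i).ne') _ _) ((near_phi_snd_ne_zero i).mono fun z hz => ?_)
  exact ⟨_, by rw [chi_e_eq i z.1 z.2 hz]; exact Part.mem_some _, fun p => rfl⟩

lemma generically_e_one (i : Fin n) :
    Generically fun u : UMinus n => u ∈ (chiUMinus n).e i (1, u) := by
  refine ((near_phi_ne_zero i).mono fun u hu => ?_).generically posU_nonempty
  rw [chi_e_eq_some (v := u) (d := 1) hu]
  · exact Part.mem_some _
  · rw [Units.val_one, sub_self, zero_div, hMat_one, Matrix.transvection_zero, one_mul, mul_one]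

lemma generically_γ_e (i : Fin n) : Generically fun z : ℂˣ × UMinus n =>
    ∃ y ∈ (chiUMinus n).e i z, ∃ t ∈ (chiUMinus n).γ z.2, coroot i z.1 * t ∈ (chiUMinus n).γ y := by
  have h : Near (posE n) fun z => ∀ j : Fin n, fCoeff j z.2.1 ≠ 0 := by
    refine Near.forall fun j => RatOn.ne_zero ?_ fun z hz => fCoeff_ne_zero hz.2 j
    simp only [fCoeff_eq_det]
    exact RatOn.det fun p q => ratOn_snd_coord _ _ _
  exact (((near_phi_snd_ne_zero i).and h).mono fun z hz =>
    chi_γ_e i z.1 z.2 hz.1 hz.2).generically posE_nonempty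

/-! ### The operators attached to words -/

/-- The value at a diagonal matrix, not necessarily of determinant one, of the character
`∑ m_j α_j`. -/
def diagChar (m : Fin n → ℤ) (τ : Fin (n + 1) → ℂˣ) : ℂˣ :=
  ∏ j : Fin n, (τ j.castSucc / τ j.succ) ^ m j

/-- The character `s_j(α_k) = α_k - ⟨h_j, α_k⟩ α_j`, evaluated at `τ`. -/
lemma simple_swap (j k : Fin n) (τ : Fin (n + 1) → ℂˣ) :
    τ (Equiv.swap j.castSucc j.succ k.castSucc) / τ (Equiv.swap j.castSucc j.succ k.succ) =
      τ k.castSucc / τ k.succ * (τ j.castSucc / τ j.succ) ^ (-CartanMatrix.A n j k) := by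
  rcases eq_or_ne j k with rfl | hjk
  · rw [Equiv.swap_apply_left, Equiv.swap_apply_right]
    have h : (-CartanMatrix.A n j j) = -2 := by simp [CartanMatrix.A]
    rw [h, zpow_neg, zpow_ofNat, pow_two, mul_inv, mul_inv_cancel_left, inv_div]
  have h1 : j.1 ≠ k.1 := fun h => hjk (Fin.ext h)
  by_cases h2 : j.1 + 1 = k.1
  · have h3 : k.castSucc = j.succ := Fin.ext h2.symm
    rw [h3, Equiv.swap_apply_right, Equiv.swap_apply_of_ne_of_ne]
    · simp [CartanMatrix.A, hjk, h2]
    · rw [Ne, Fin.ext_iff, Fin.val_succ, Fin.val_castSucc]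
      omega
    · rw [Ne, Fin.ext_iff, Fin.val_succ, Fin.val_succ]
      omega
  by_cases h3 : k.1 + 1 = j.1
  · have h4 : j.castSucc = k.succ := Fin.ext h3.symm
    rw [h4, Equiv.swap_apply_left, Equiv.swap_apply_of_ne_of_ne]
    · simp [CartanMatrix.A, hjk, h3]
    · rw [Ne, Fin.ext_iff, Fin.val_succ, Fin.val_castSucc]
      omega
    · rw [Ne, Fin.ext_iff, Fin.val_succ, Fin.val_castSucc]
      omega
  · rw [Equiv.swap_apply_of_ne_of_ne, Equiv.swap_apply_of_ne_of_ne]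
    · simp [CartanMatrix.A, hjk, h2, h3]
    all_goals
      simp only [Ne, Fin.ext_iff, Fin.val_succ, Fin.val_castSucc]
      omega

lemma zpow_finset_sum {H κ : Type*} [CommGroup H] (a : H) (s : Finset κ) (m : κ → ℤ) :
    a ^ ∑ k ∈ s, m k = ∏ k ∈ s, a ^ m k := by
  classical
  induction s using Finset.induction_on with
  | empty => simp
  | insert k s hk ih => rw [Finset.sum_insert hk, Finset.prod_insert hk, zpow_add, ih]

lemma diagChar_rootReflection (j : Fin n) (m : Fin n → ℤ) (τ : Fin (n + 1) → ℂˣ) :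
    diagChar (rootReflection j m) τ = diagChar m (τ ∘ Equiv.swap j.castSucc j.succ) := by
  simp only [diagChar, rootReflection, Function.comp, simple_swap, mul_zpow, Pi.sub_apply,
    zpow_sub, Finset.prod_mul_distrib]
  refine congrArg₂ (· * ·) rfl ?_
  rw [Finset.prod_eq_single j]
  · rw [Pi.single_eq_same, ← zpow_neg, ← Finset.sum_neg_distrib, zpow_finset_sum]
    refine Finset.prod_congr rfl fun k _ => ?_
    rw [← zpow_mul, neg_mul]
  · intro k _ hk
    rw [Pi.single_eq_of_ne hk, zpow_zero, inv_one]
  · simp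

lemma diagChar_single (i : Fin n) (τ : Fin (n + 1) → ℂˣ) :
    diagChar (Pi.single i 1) τ = τ i.castSucc / τ i.succ := by
  rw [diagChar, Finset.prod_eq_single i]
  · simp
  · intro k _ hk
    rw [Pi.single_eq_of_ne hk, zpow_zero]
  · simp

lemma wordProd_cons (i : Fin n) (w : List (Fin n)) :
    wordProd (i :: w) = Equiv.swap i.castSucc i.succ * wordProd w := by
  simp [wordProd]

lemma wordProd_cons_inv_apply (i : Fin n) (w : List (Fin n)) (k : Fin (n + 1)) :
    (wordProd (i :: w))⁻¹ k = (wordProd w)⁻¹ (Equiv.swap i.castSucc i.succ k) := by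
  rw [wordProd_cons, mul_inv_rev, Equiv.swap_inv, Equiv.Perm.mul_apply]

lemma rootChar_foldl (w : List (Fin n)) (m : Fin n → ℤ) (t : T n) :
    rootChar (w.foldl (fun m j => rootReflection j m) m) t =
      diagChar m fun k => t.1 ((wordProd w)⁻¹ k) := by
  induction w generalizing m with
  | nil => rfl
  | cons j w ih =>
    rw [List.foldl_cons, ih, diagChar_rootReflection]
    exact congrArg (diagChar m) (funext fun k => congrArg t.1 (wordProd_cons_inv_apply j w k).symm)

/-- The parameter `α^{(k)}(t)` is the value of the simple root `α_i` at the image of `t` under the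
Weyl group element of the rest of the word. -/
lemma rootChar_word (i : Fin n) (w : List (Fin n)) (t : T n) :
    rootChar (w.foldl (fun m j => rootReflection j m) (Pi.single i 1)) t =
      t.1 ((wordProd w)⁻¹ i.castSucc) / t.1 ((wordProd w)⁻¹ i.succ) := by
  rw [rootChar_foldl, diagChar_single]

/-- The inverse of a diagonal matrix as a matrix. -/
def diagInv (τ : Fin (n + 1) → ℂˣ) : Matrix (Fin (n + 1)) (Fin (n + 1)) ℂ :=
  Matrix.diagonal fun k => ((τ k)⁻¹ : ℂˣ)

/-- For `d = α_i(τ)` the Borel element `hMat i d s` exchanges two entries of `τ⁻¹`, up to the factor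
`x_i(s)` that appears on the right. -/
lemma hMat_mul_diagInv (i : Fin n) (τ : Fin (n + 1) → ℂˣ) (s : ℂ) :
    hMat i ((τ i.castSucc / τ i.succ : ℂˣ) : ℂ) s * diagInv τ =
      diagInv (fun k => τ (Equiv.swap i.castSucc i.succ k)) * hMat i 1 s := by
  have h0 : ∀ k, (τ k : ℂ) ≠ 0 := fun k => (τ k).ne_zero
  have h1 := h0 i.castSucc
  have h2 := h0 i.succ
  ext x y
  rw [diagInv, diagInv, Matrix.mul_diagonal, Matrix.diagonal_mul, Units.val_div_eq_div_val,
    Units.val_inv_eq_inv_val, Units.val_inv_eq_inv_val]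
  by_cases hx : x = i.castSucc
  · subst hx
    rw [Equiv.swap_apply_left]
    by_cases hy : i.castSucc = y
    · subst hy
      simp only [hMat, if_true, Fin.val_castSucc]
      field_simp
    · by_cases hy2 : y = i.succ
      · subst hy2
        simp only [hMat, if_neg hy, Fin.val_castSucc, Fin.val_succ, and_self, if_true]
        rw [mul_comm]
      · have h3 : ¬ y.1 = i.1 + 1 := fun h => hy2 (Fin.ext h)
        simp only [hMat, if_neg hy, h3, and_false, if_false, zero_mul, mul_zero]
  · have h3 : ¬ x.1 = i.1 := fun h => hx (Fin.ext h)
    by_cases hxy : x = y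
    · subst hxy
      by_cases hx2 : x = i.succ
      · subst hx2
        rw [Equiv.swap_apply_right]
        rw [Fin.val_succ] at h3
        simp only [hMat, if_true, if_neg h3, Fin.val_succ]
        field_simp
      · have h4 : ¬ x.1 = i.1 + 1 := fun h => hx2 (Fin.ext h)
        rw [Equiv.swap_apply_of_ne_of_ne hx hx2]
        simp only [hMat, if_true, if_neg h3, if_neg h4, one_mul, mul_one]
    · simp only [hMat, if_neg hxy, h3, false_and, if_false, zero_mul, mul_zero]

/-- If an upper unitriangular matrix, given by its transpose `w`, conjugates two lower triangular
matrices with the same diagonal, whose entries are distinct, then it is the unit matrix. -/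
lemma conj_lower_unique (w : UMinus n) {L L' : Matrix (Fin (n + 1)) (Fin (n + 1)) ℂ}
    (hL : ∀ j k, j < k → L j k = 0) (hL' : ∀ j k, j < k → L' j k = 0)
    (hd : ∀ k, L k k = L' k k) (hinj : ∀ j k, j ≠ k → L j j ≠ L k k)
    (h : w.1.1.transpose * L = L' * w.1.1.transpose) : w = 1 := by
  -- induction on the distance from the corner: the entries at greater distance from the diagonal
  -- vanish already
  have key : ∀ g : ℕ, ∀ j k : Fin (n + 1), j < k → n < k.1 - j.1 + g → w.1.1 k j = 0 := by
    intro g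
    induction g with
    | zero => intro j k _ h2; omega
    | succ g ih =>
      intro j k hjk hg
      have hjk' : j.1 < k.1 := hjk
      have h1 := congrFun (congrFun h j) k
      rw [Matrix.mul_apply, Matrix.mul_apply, Finset.sum_eq_single k, Finset.sum_eq_single j,
        Matrix.transpose_apply, ← hd j] at h1
      · have h2 : w.1.1 k j * (L k k - L j j) = 0 := by linear_combination h1
        exact (mul_eq_zero.mp h2).resolve_right (sub_ne_zero.mpr (hinj k j hjk.ne'))
      · intro l _ hl
        rcases lt_or_gt_of_ne hl with hl | hl
        · have hl' : l.1 < j.1 := hl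
          rw [Matrix.transpose_apply, ih l k (hl.trans hjk) (by omega), mul_zero]
        · rw [hL' j l hl, zero_mul]
      · simp
      · intro l _ hl
        rcases lt_or_gt_of_ne hl with hl | hl
        · rw [hL l k hl, mul_zero]
        · have hl' : k.1 < l.1 := hl
          rw [Matrix.transpose_apply, ih j l (hjk.trans hl) (by omega), zero_mul]
      · simp
  refine UMinus.ext_matrix (Matrix.ext fun j k => ?_)
  change w.1.1 j k = (1 : Matrix (Fin (n + 1)) (Fin (n + 1)) ℂ) j k
  rcases le_or_gt j k with hjk | hjk
  · exact w.2 j k hjk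
  · rw [key (n + 1) k j hjk (by omega), Matrix.one_apply_ne hjk.ne']

/-- The point `y` of `U⁻` is related to `u` by an upper unitriangular matrix `x` with
`x u t⁻¹ x⁻¹ = y τ⁻¹`.  The matrix `x` is given by its transpose `v`. -/
def ConjBy (t τ : Fin (n + 1) → ℂˣ) (u y : UMinus n) : Prop :=
  ∃ v : UMinus n, v.1.1.transpose * u.1.1 * diagInv t = y.1.1 * diagInv τ * v.1.1.transpose

lemma ConjBy.unique {t τ : Fin (n + 1) → ℂˣ} (hτ : Function.Injective τ) {u y y' : UMinus n}
    (h : ConjBy t τ u y) (h' : ConjBy t τ u y') : y = y' := by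
  obtain ⟨v, hv⟩ := h
  obtain ⟨v', hv'⟩ := h'
  have hlow : ∀ y : UMinus n, ∀ j k, j < k → (y.1.1 * diagInv τ) j k = 0 := by
    intro y j k hjk
    rw [diagInv, Matrix.mul_diagonal, UMinus.apply_of_lt y hjk, zero_mul]
  have hdiag : ∀ y : UMinus n, ∀ k, (y.1.1 * diagInv τ) k k = ((τ k)⁻¹ : ℂˣ) := by
    intro y k
    rw [diagInv, Matrix.mul_diagonal, UMinus.apply_self, one_mul]
  have hinv : v.1.1.transpose * (v⁻¹).1.1.transpose = 1 := by
    rw [← Matrix.transpose_mul, show (v⁻¹).1.1 * v.1.1 = 1 from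
      congrArg UMinus.toMat (inv_mul_cancel v), Matrix.transpose_one]
  have hw : v'.1.1.transpose = (v⁻¹ * v').1.1.transpose * v.1.1.transpose := by
    rw [← Matrix.transpose_mul]
    exact congrArg (fun z : UMinus n => z.1.1.transpose) (mul_inv_cancel_left v v').symm
  have h1 : (v⁻¹ * v').1.1.transpose * (y.1.1 * diagInv τ) =
      y'.1.1 * diagInv τ * (v⁻¹ * v').1.1.transpose := by
    rw [hw, mul_assoc, mul_assoc, ← mul_assoc v.1.1.transpose, hv, ← mul_assoc, ← mul_assoc] at hv'
    have h2 := congrArg (· * (v⁻¹).1.1.transpose) hv'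
    simpa only [mul_assoc, hinv, mul_one] using h2
  have h2 := conj_lower_unique _ (hlow y) (hlow y') (fun k => by rw [hdiag, hdiag])
    (fun j k hjk => by
      rw [hdiag, hdiag, Ne, Units.val_inj, inv_inj]
      exact fun h => hjk (hτ h)) h1
  rw [h2] at h1
  have h3 : (1 : UMinus n).1.1.transpose = 1 := Matrix.transpose_one
  rw [h3, one_mul, mul_one] at h1
  have hup : ∀ j k : Fin (n + 1), k < j → diagInv τ j k = 0 := fun j k hjk =>
    Matrix.diagonal_apply_ne _ hjk.ne'
  refine gauss_unique hup hup ?_ h1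
  rw [diagInv, Matrix.det_diagonal]
  exact Finset.prod_ne_zero_iff.mpr fun k _ => Units.ne_zero _

/-- The operator `e_i^c` with `c = α_i(τ)` permutes the entries of `τ`. -/
lemma ConjBy.eMinus {t τ : Fin (n + 1) → ℂˣ} {u y : UMinus n} (h : ConjBy t τ u y) (i : Fin n)
    (hφ : phi i y ≠ 0) : ConjBy t (fun k => τ (Equiv.swap i.castSucc i.succ k)) u
      (eMinus i (τ i.castSucc / τ i.succ) y hφ) := by
  obtain ⟨v, hv⟩ := h
  set s := (((τ i.castSucc / τ i.succ : ℂˣ) : ℂ) - 1) / phi i y with hs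
  refine ⟨v * yMinus i s, ?_⟩
  have h1 : (v * yMinus i s).1.1.transpose = hMat i 1 s * v.1.1.transpose := by
    change (v.1.1 * Matrix.transvection i.succ i.castSucc s).transpose = _
    rw [Matrix.transpose_mul, hMat_one, Matrix.transvection, Matrix.transvection,
      Matrix.transpose_add, Matrix.transpose_one, Matrix.transpose_single]
  rw [h1, mul_assoc, mul_assoc, ← mul_assoc v.1.1.transpose, hv, ← mul_assoc, ← mul_assoc,
    eMinus_mul_hMat, mul_assoc _ (hMat _ _ _) (diagInv _), ← hs, hMat_mul_diagInv, ← mul_assoc,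
    ← mul_assoc]

/-- Pairs of a positive regular element of the torus and a totally positive point. -/
def posT (n : ℕ) : Set (T n × UMinus n) :=
  {z | (∀ k, 0 < (z.1.1 k : ℂ)) ∧ Function.Injective z.1.1 ∧ z.2 ∈ posU n}

lemma posT_nonempty : (posT n).Nonempty := by
  obtain ⟨u, hu⟩ := posU_nonempty (n := n)
  set q : ℂˣ := Units.mk0 2 two_ne_zero
  -- distinct powers of `2`, with product one by symmetry
  set t : Fin (n + 1) → ℂˣ := fun k => q ^ ((k : ℤ) - (k.rev : ℤ)) with ht
  have hprod : ∏ k, t k = 1 := by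
    simp only [ht, zpow_sub, Finset.prod_mul_distrib, Finset.prod_inv_distrib, mul_inv_eq_one]
    exact (Equiv.prod_comp Fin.revPerm fun k : Fin (n + 1) => q ^ (k : ℤ)).symm
  have hcoe : ∀ k, (t k : ℂ) = (((2 : ℝ) ^ ((k : ℤ) - (k.rev : ℤ)) : ℝ) : ℂ) := by
    intro k
    simp only [ht, Units.val_zpow_eq_zpow_val]
    push_cast
    rfl
  refine ⟨(⟨t, hprod⟩, u), fun k => ?_, fun j k hjk => ?_, hu⟩
  · change 0 < (t k : ℂ)
    rw [hcoe, Complex.zero_lt_real]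
    positivity
  · change t j = t k at hjk
    have h1 := congrArg Units.val hjk
    rw [hcoe, hcoe, Complex.ofReal_inj] at h1
    have h2 := zpow_right_injective₀ (by norm_num : (0 : ℝ) < 2) (by norm_num) h1
    simp only [Fin.val_rev] at h2
    exact Fin.ext (by omega)

lemma ratOn_fst_coord (S : Set (T n × UMinus n)) (k : Fin (n + 1)) :
    RatOn S fun z : T n × UMinus n => (z.1.1 k : ℂ) :=
  RatOn.coord (X := T n × UMinus n) (Sum.inl k)

lemma near_injective : Near (posT n) fun z => Function.Injective z.1.1 := by
  have h : ∀ j k, Near (posT n) fun z => j ≠ k → (z.1.1 j : ℂ) - z.1.1 k ≠ 0 := by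
    intro j k
    by_cases hjk : j = k
    · exact Near.of_forall fun z h => absurd hjk h
    · refine (((ratOn_fst_coord _ j).sub (ratOn_fst_coord _ k)).ne_zero fun z hz h => ?_).mono
        fun z hz _ => hz
      exact hjk (hz.2.1 (Units.val_injective (sub_eq_zero.mp h)))
  refine (Near.forall fun j => Near.forall fun k => h j k).mono fun z hz j k hjk => ?_
  by_contra hne
  exact hz j k hne (by rw [hjk, sub_self])

/-- Near the positive points the operator attached to a word `w` is defined, with rational matrix
entries; it preserves total positivity, and its value `y` is such that `y w(t)⁻¹` is conjugate to
`u t⁻¹` under `U`. -/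
lemma eWord_spec (w : List (Fin n)) :
    ∃ Y : T n × UMinus n → Matrix (Fin (n + 1)) (Fin (n + 1)) ℂ,
      (∀ p q, RatOn (posT n) fun z => Y z p q) ∧ Near (posT n) fun z =>
        ∃ y ∈ (chiUMinus n).eWord w z, y.1.1 = Y z ∧ (z ∈ posT n → y ∈ posU n) ∧
          ConjBy z.1.1 (fun k => z.1.1 ((wordProd w)⁻¹ k)) z.2 y := by
  induction w with
  | nil =>
    refine ⟨fun z => z.2.1.1, ratOn_snd_coord _, Near.of_forall fun z =>
      ⟨z.2, Part.mem_some _, rfl, fun hz => hz.2.2, 1, ?_⟩⟩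
    have h : (1 : UMinus n).1.1.transpose = 1 := Matrix.transpose_one
    rw [h, one_mul, mul_one]
    rfl
  | cons i w ih =>
    obtain ⟨Y, hY, hnear⟩ := ih
    set c : T n × UMinus n → ℂˣ := fun z =>
      z.1.1 ((wordProd w)⁻¹ i.castSucc) / z.1.1 ((wordProd w)⁻¹ i.succ) with hc
    have hcR : RatOn (posT n) fun z => (c z : ℂ) := by
      simp only [hc, Units.val_div_eq_div_val]
      exact (ratOn_fst_coord _ _).div (ratOn_fst_coord _ _) fun z _ => Units.ne_zero _
    have hcpos : ∀ z ∈ posT n, 0 < (c z : ℂ) := by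
      intro z hz
      simp only [hc, Units.val_div_eq_div_val]
      rw [div_eq_mul_inv]
      exact mul_pos (hz.1 _) (RCLike.inv_pos.mpr (hz.1 _))
    have hφ : ∀ z ∈ posT n, Y z i.succ i.castSucc ≠ 0 := by
      obtain ⟨q, hq, h⟩ := hnear
      intro z hz
      obtain ⟨y, -, hyY, hpos, -⟩ := h z (hq z hz)
      rw [← hyY]
      exact (phi_pos (hpos hz) i).ne'
    refine ⟨fun z => eMat i (c z) (Y z), ratOn_eMat i hcR (fun z _ => Units.ne_zero _) hY hφ,
      (hnear.and ((hY _ _).ne_zero hφ)).mono ?_⟩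
    rintro z ⟨⟨y, hy, hyY, hpos, hconj⟩, hz⟩
    rw [← hyY] at hz
    change phi i y ≠ 0 at hz
    refine ⟨eMinus i (c z) y hz, ?_, ?_, fun hzS => eMinus_mem_posU (hpos hzS) i (hcpos z hzS) hz,
      ?_⟩
    · change _ ∈ ((chiUMinus n).eWord w z).bind _
      rw [rootChar_word, Part.eq_some_iff.mpr hy, Part.bind_some,
        chi_e_eq i _ y hz]
      exact Part.mem_some _
    · beta_reduce
      rw [← hyY]
      rfl
    · simp only [wordProd_cons_inv_apply]
      exact hconj.eMinus i hz

lemma generically_e_word (w w' : List (Fin n)) (h : wordProd w = wordProd w') :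
    Generically fun z : T n × UMinus n =>
      ∃ y, y ∈ (chiUMinus n).eWord w z ∧ y ∈ (chiUMinus n).eWord w' z := by
  obtain ⟨_, -, h1⟩ := eWord_spec w
  obtain ⟨_, -, h2⟩ := eWord_spec w'
  refine (((h1.and h2).and near_injective).mono ?_).generically posT_nonempty
  rintro z ⟨⟨⟨y, hy, -, -, hc⟩, y', hy', -, -, hc'⟩, hinj⟩
  rw [← h] at hc'
  obtain rfl := hc.unique (hinj.comp (wordProd w)⁻¹.injective) hc'
  exact ⟨y, hy, hy'⟩

theorem isGeometricCrystal_chiUMinus (n : ℕ) : IsGeometricCrystal (chiUMinus n) where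
  rational_γ := isRational_γ n
  rational_e := isRational_e
  e_one := generically_e_one
  γ_e := generically_γ_e
  e_word w w' _ _ h := generically_e_word w w' h

end Crystal

end GeomCrys

end

theorem theorem5p5 (n : ℕ) :
    -- the triplet `χ_{U⁻}` is a geometric crystal, and `θ̂` is a positive structure on it
    GeomCrys.IsGeometricCrystal (GeomCrys.chiUMinus n) ∧
    GeomCrys.IsPositiveStructure (GeomCrys.chiUMinus n) (GeomCrys.thetaHat n) ∧
    -- `θ̂ = θ ∘ ξ⁻¹`
    (∀ a : GeomCrys.TriIdx n → ℂˣ,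
      GeomCrys.xi (GeomCrys.xiInv a) = a ∧ GeomCrys.xiInv (GeomCrys.xi a) = a) ∧
    -- `B^♯` is a free crystal, on which `ẽ_i^β` acts by the explicit formula
    GeomCrys.IsFreeCrystal (GeomCrys.sharpCrystal n) ∧
    (∀ (i : Fin n) (β : ℤ) (v : GeomCrys.Bsharp n),
      (GeomCrys.sharpCrystal n).triplet.e i β v = GeomCrys.sharpAct i β v) ∧
    -- the ultra-discretization of `χ_{U⁻}` with respect to `θ̂` is `B^♯`
    (GeomCrys.ultraDiscCrystal (GeomCrys.chiUMinus n) (GeomCrys.thetaHat n)).IdentifiedBy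
      (GeomCrys.sharpCrystal n).triplet (GeomCrys.cocharEquiv n) ∧
    -- so `χ_{U⁻}` is a tropicalization of `B^♯`
    GeomCrys.IsTropicalization (GeomCrys.chiUMinus n) (GeomCrys.sharpCrystal n) :=
  have hgeom := GeomCrys.isGeometricCrystal_chiUMinus n
  have hpos := GeomCrys.isPositiveStructure_thetaHat n
  have hfree := GeomCrys.isFreeCrystal_sharpCrystal n
  have hid := GeomCrys.identifiedBy_cocharEquiv n
  ⟨hgeom, hpos, fun a => ⟨GeomCrys.xi_xiInv a, GeomCrys.xiInv_xi a⟩, hfree, GeomCrys.triplet_e_eq,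
    hid, hgeom, hfree, GeomCrys.TriIdx n, inferInstance, GeomCrys.thetaHat n, hpos,
    GeomCrys.cocharEquiv n, hid⟩
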